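/- **Setting.** Let $\mathcal X,\widetilde{\mathcal X},\mathcal Y$ be finite sets and let $(X_i,\widetilde X_i,Y_i)$, $i=1,\dots,n$, be i.i.d. copies of $(X,\widetilde X,Y)\sim P_{X\widetilde XY}=P_X P_{\widetilde XY|X}$. Logarithms, entropies and mutual informations are in nats. A generated-secret (GS) code of blocklength $n$ has finite sets $\mathcal S,\mathcal W$, an encoder $f_1:\widetilde{\mathcal X}^n\to\mathcal W\times\mathcal S$, giving $(W,S)=f_1(\widetilde X^n)$, and a decoder $g:\mathcal W\times\mathcal Y^n\to\mathcal S$, giving $\hat S=g(W,Y^n)$. A chosen-secret (CS) code has instead a key $S\in\mathcal S$ independent of $(X^n,\widetilde X^n,Y^n)$, an encoder $f_2:\widetilde{\mathcal X}^n\times\mathcal S\to\mathcal W$ with $W=f_2(\widetilde X^n,S)$, and a decoder as before. A tuple $(R_s,R_\ell,R_w)\in\mathbb R^3$ is achievable for the GS (CS) model if for every $\delta>0$ there are $n\ge1$ and a GS (CS) code of blocklength $n$ with $R_s=\frac1n\log|\mathcal S|$ and $$\Pr[S\ne\hat S]\le\delta,\quad I(S;W)\le\delta,\quad \tfrac1nI(X^n;W)\le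 R_\ell+\delta,\quad \tfrac1nH(S)\ge R_s-\delta,\quad \tfrac1n\log|\mathcal W|\le R_w+\delta .$$ The key-leakage-storage regions $\mathcal C_{gs}$ and $\mathcal C_{cs}$ are the closures in $\mathbb R^3$ of the sets of achievable tuples. In the CS model the law of $S$ may be chosen with the code. For a conditional distribution $P_{U|\widetilde X}$ with a finite alphabet $\mathcal U$, let $(U,X,\widetilde X,Y)\sim P_{U|\widetilde X}P_{X\widetilde XY}$, so that $U-\widetilde X-(X,Y)$ is a Markov chain. Let $\mathcal R_2$ be the set of all $(R_s,R_\ell,R_w)$ for which there is such a $P_{U|\widetilde X}$ with $\max\{0,I(U;X)-I(U;Y)\}=0$ and $$0\le R_s\le I(U;Y),\qquad R_\ell\ge \max\{0,I(U;X)-I(U;Y)\}=0,\qquad R_w\ge I(U;\widetilde X)-I(U;Y),$$ and let $\mathcal R_4$ be defined in the same way with the last inequality replaced by $R_w\ge I(U;\widetilde X)$. **Theorem 2 (physically-degraded broadcast channels).** Suppose that $\widetilde X-Y-X$ is a Markov chain. Then $$\mathcal C_{gs}=\mathcal R_2,\qquad \mathcal C_{cs}=\mathcal R_4 ,$$ and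 $\mathcal C_{cs}$ is the same set if the key of the CS model is required to be exactly uniform on $\mathcal S$. Moreover, in $\mathcal R_2$ and in $\mathcal R_4$ it suffices to take $|\mathcal U|\le|\widetilde{\mathcal X}|+1$. -/

import Mathlib

namespace KeyAgreement

section Information

variable {Ω α β γ : Type*} [Fintype Ω]

/-- Law of the random variable `f` on the finite probability space with mass function `p`. -/
noncomputable def law (p : Ω → ℝ) (f : Ω → α) (a : α) : ℝ :=
  open scoped Classical in ∑ ω, if f ω = a then p ω else 0

/-- Probability of the event `E`. -/
noncomputable def prob (p : Ω → ℝ) (E : Ω → Prop) : ℝ :=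
  open scoped Classical in ∑ ω, if E ω then p ω else 0

/-- Shannon entropy of the random variable `f`, in nats. -/
noncomputable def entropy [Fintype α] (p : Ω → ℝ) (f : Ω → α) : ℝ :=
  ∑ a, Real.negMulLog (law p f a)

/-- Mutual information `I(f; g) = H(f) + H(g) - H(f, g)`, in nats. -/
noncomputable def mutualInfo [Fintype α] [Fintype β] (p : Ω → ℝ) (f : Ω → α) (g : Ω → β) : ℝ :=
  entropy p f + entropy p g - entropy p (fun ω => (f ω, g ω))

/-- `f - g - h` is a Markov chain: `f` and `h` are conditionally independent given `g`. -/
def IsMarkovChain (p : Ω → ℝ) (f : Ω → α) (g : Ω → β) (h : Ω → γ) : Prop :=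
  ∀ a b c, law p (fun ω => (f ω, g ω, h ω)) (a, b, c) * law p g b =
    law p (fun ω => (f ω, g ω)) (a, b) * law p (fun ω => (g ω, h ω)) (b, c)

end Information

section Model

/- `P` is the joint mass function of `(X, X̃, Y)`, that is `P_X` times the channel `P_{X̃Y|X}`. -/
variable {𝒳 𝒳t 𝒴 : Type*} [Fintype 𝒳] [Fintype 𝒳t] [Fintype 𝒴]

/-- Mass function of `n` i.i.d. copies of `(X, X̃, Y)`. -/
def iid (P : 𝒳 × 𝒳t × 𝒴 → ℝ) (n : ℕ) (ω : Fin n → 𝒳 × 𝒳t × 𝒴) : ℝ :=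
  ∏ i, P (ω i)

/-- The sequence `Xⁿ` of hidden identifier outputs. -/
def seqX {n : ℕ} (ω : Fin n → 𝒳 × 𝒳t × 𝒴) : Fin n → 𝒳 := fun i => (ω i).1

/-- The sequence `X̃ⁿ` of encoder measurements. -/
def seqXt {n : ℕ} (ω : Fin n → 𝒳 × 𝒳t × 𝒴) : Fin n → 𝒳t := fun i => (ω i).2.1

/-- The sequence `Yⁿ` of decoder measurements. -/
def seqY {n : ℕ} (ω : Fin n → 𝒳 × 𝒳t × 𝒴) : Fin n → 𝒴 := fun i => (ω i).2.2

/-- The conditions on key `S`, key estimate `Ŝ`, helper data `W` and identifier sequence `Xⁿ` at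
blocklength `n`, for the rate tuple `R = (R_s, R_ℓ, R_w)` and the tolerance `δ`. -/
structure MeetsConstraints {Ω : Type*} [Fintype Ω] (p : Ω → ℝ) {n s w : ℕ}
    (S Shat : Ω → Fin s) (W : Ω → Fin w) (Xn : Ω → (Fin n → 𝒳))
    (R : ℝ × ℝ × ℝ) (δ : ℝ) : Prop where
  key_rate : R.1 = Real.log s / n
  reliability : prob p (fun ω => S ω ≠ Shat ω) ≤ δ
  secrecy : mutualInfo p S W ≤ δ
  privacy : 1 / (n : ℝ) * mutualInfo p Xn W ≤ R.2.1 + δ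
  uniformity : 1 / (n : ℝ) * entropy p S ≥ R.1 - δ
  storage : 1 / (n : ℝ) * Real.log w ≤ R.2.2 + δ

/-- The generated-secret code `(enc, dec)` meets the constraints: `(W, S) = enc X̃ⁿ` and
`Ŝ = dec (W, Yⁿ)`. -/
def GSFeasible (P : 𝒳 × 𝒳t × 𝒴 → ℝ) {n s w : ℕ}
    (enc : (Fin n → 𝒳t) → Fin w × Fin s) (dec : Fin w × (Fin n → 𝒴) → Fin s)
    (R : ℝ × ℝ × ℝ) (δ : ℝ) : Prop :=
  MeetsConstraints (iid P n)
    (fun ω => (enc (seqXt ω)).2)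
    (fun ω => dec ((enc (seqXt ω)).1, seqY ω))
    (fun ω => (enc (seqXt ω)).1)
    seqX R δ

/-- The chosen-secret code `(enc, dec)` meets the constraints: the key `S` has law `PS` and is
independent of `(Xⁿ, X̃ⁿ, Yⁿ)`, `W = enc (X̃ⁿ, S)` and `Ŝ = dec (W, Yⁿ)`. -/
def CSFeasible (P : 𝒳 × 𝒳t × 𝒴 → ℝ) {n s w : ℕ} (PS : Fin s → ℝ)
    (enc : (Fin n → 𝒳t) × Fin s → Fin w) (dec : Fin w × (Fin n → 𝒴) → Fin s)
    (R : ℝ × ℝ × ℝ) (δ : ℝ) : Prop :=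
  MeetsConstraints (fun ω : (Fin n → 𝒳 × 𝒳t × 𝒴) × Fin s => iid P n ω.1 * PS ω.2)
    (fun ω => ω.2)
    (fun ω => dec (enc (seqXt ω.1, ω.2), seqY ω.1))
    (fun ω => enc (seqXt ω.1, ω.2))
    (fun ω => seqX ω.1) R δ

/-- Achievable rate tuples of the generated-secret model. -/
def GSAchievable (P : 𝒳 × 𝒳t × 𝒴 → ℝ) (R : ℝ × ℝ × ℝ) : Prop :=
  ∀ δ : ℝ, 0 < δ → ∃ n s w : ℕ, 1 ≤ n ∧
    ∃ (enc : (Fin n → 𝒳t) → Fin w × Fin s) (dec : Fin w × (Fin n → 𝒴) → Fin s),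
      GSFeasible P enc dec R δ

/-- Achievable rate tuples of the chosen-secret model; the law of the key is only constrained
through the uniformity condition. -/
def CSAchievable (P : 𝒳 × 𝒳t × 𝒴 → ℝ) (R : ℝ × ℝ × ℝ) : Prop :=
  ∀ δ : ℝ, 0 < δ → ∃ n s w : ℕ, 1 ≤ n ∧
    ∃ PS ∈ stdSimplex ℝ (Fin s),
    ∃ (enc : (Fin n → 𝒳t) × Fin s → Fin w) (dec : Fin w × (Fin n → 𝒴) → Fin s),
      CSFeasible P PS enc dec R δ

/-- Achievable rate tuples of the chosen-secret model with an exactly uniform key. -/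
def CSUniformAchievable (P : 𝒳 × 𝒳t × 𝒴 → ℝ) (R : ℝ × ℝ × ℝ) : Prop :=
  ∀ δ : ℝ, 0 < δ → ∃ n s w : ℕ, 1 ≤ n ∧ 1 ≤ s ∧
    ∃ (enc : (Fin n → 𝒳t) × Fin s → Fin w) (dec : Fin w × (Fin n → 𝒴) → Fin s),
      CSFeasible P (fun _ => 1 / (s : ℝ)) enc dec R δ

/-- Key-leakage-storage region of the generated-secret model. -/
def gsRegion (P : 𝒳 × 𝒳t × 𝒴 → ℝ) : Set (ℝ × ℝ × ℝ) := closure {R | GSAchievable P R}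

/-- Key-leakage-storage region of the chosen-secret model. -/
def csRegion (P : 𝒳 × 𝒳t × 𝒴 → ℝ) : Set (ℝ × ℝ × ℝ) := closure {R | CSAchievable P R}

/-- Key-leakage-storage region of the chosen-secret model with an exactly uniform key. -/
def csUniformRegion (P : 𝒳 × 𝒳t × 𝒴 → ℝ) : Set (ℝ × ℝ × ℝ) :=
  closure {R | CSUniformAchievable P R}

/-- Joint mass function of `(U, X, X̃, Y)` for the test channel `V = P_{U|X̃}`; by construction
`U - X̃ - (X, Y)` is a Markov chain. -/
def auxJoint (P : 𝒳 × 𝒳t × 𝒴 → ℝ) {k : ℕ} (V : 𝒳t → Fin k → ℝ)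
    (ω : Fin k × 𝒳 × 𝒳t × 𝒴) : ℝ :=
  P ω.2 * V ω.2.2.1 ω.1

/-- `I(U; X)` -/
noncomputable def infoUX (P : 𝒳 × 𝒳t × 𝒴 → ℝ) {k : ℕ} (V : 𝒳t → Fin k → ℝ) : ℝ :=
  mutualInfo (auxJoint P V) (fun ω => ω.1) (fun ω => ω.2.1)

/-- `I(U; X̃)` -/
noncomputable def infoUXt (P : 𝒳 × 𝒳t × 𝒴 → ℝ) {k : ℕ} (V : 𝒳t → Fin k → ℝ) : ℝ :=
  mutualInfo (auxJoint P V) (fun ω => ω.1) (fun ω => ω.2.2.1)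

/-- `I(U; Y)` -/
noncomputable def infoUY (P : 𝒳 × 𝒳t × 𝒴 → ℝ) {k : ℕ} (V : 𝒳t → Fin k → ℝ) : ℝ :=
  mutualInfo (auxJoint P V) (fun ω => ω.1) (fun ω => ω.2.2.2)

/-- The part of the region `𝓡₂` that comes from auxiliary alphabets with `k` letters. -/
def regionR2Card (P : 𝒳 × 𝒳t × 𝒴 → ℝ) (k : ℕ) : Set (ℝ × ℝ × ℝ) :=
  {R | ∃ V : 𝒳t → Fin k → ℝ, (∀ x, V x ∈ stdSimplex ℝ (Fin k)) ∧
    max 0 (infoUX P V - infoUY P V) = 0 ∧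
    0 ≤ R.1 ∧ R.1 ≤ infoUY P V ∧
    R.2.1 ≥ max 0 (infoUX P V - infoUY P V) ∧
    R.2.2 ≥ infoUXt P V - infoUY P V}

/-- The part of the region `𝓡₄` that comes from auxiliary alphabets with `k` letters. -/
def regionR4Card (P : 𝒳 × 𝒳t × 𝒴 → ℝ) (k : ℕ) : Set (ℝ × ℝ × ℝ) :=
  {R | ∃ V : 𝒳t → Fin k → ℝ, (∀ x, V x ∈ stdSimplex ℝ (Fin k)) ∧
    max 0 (infoUX P V - infoUY P V) = 0 ∧
    0 ≤ R.1 ∧ R.1 ≤ infoUY P V ∧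
    R.2.1 ≥ max 0 (infoUX P V - infoUY P V) ∧
    R.2.2 ≥ infoUXt P V}

/-- The region `𝓡₂`: the union over all test channels `P_{U|X̃}` with finite `U` alphabet. -/
def regionR2 (P : 𝒳 × 𝒳t × 𝒴 → ℝ) : Set (ℝ × ℝ × ℝ) := ⋃ k, regionR2Card P k

/-- The region `𝓡₄`: the union over all test channels `P_{U|X̃}` with finite `U` alphabet. -/
def regionR4 (P : 𝒳 × 𝒳t × 𝒴 → ℝ) : Set (ℝ × ℝ × ℝ) := ⋃ k, regionR4Card P k

end Model

end KeyAgreement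

namespace KeyAgreement

section Toolkit

variable {Ω α β γ : Type*} [Fintype Ω]

lemma law_apply [DecidableEq α] (p : Ω → ℝ) (f : Ω → α) (a : α) :
    law p f a = ∑ ω, if f ω = a then p ω else 0 := by
  unfold law
  congr!

lemma sum_law_mul [Fintype α] (p : Ω → ℝ) (f : Ω → α) (g : α → ℝ) :
    ∑ a, law p f a * g a = ∑ ω, p ω * g (f ω) := by
  classical
  simp only [law_apply, Finset.sum_mul, ite_mul, zero_mul]
  rw [Finset.sum_comm]
  simp

lemma sum_law [Fintype α] (p : Ω → ℝ) (f : Ω → α) : ∑ a, law p f a = ∑ ω, p ω := by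
  simpa using sum_law_mul p f (fun _ => 1)

lemma law_nonneg {p : Ω → ℝ} (hp : ∀ ω, 0 ≤ p ω) (f : Ω → α) (a : α) : 0 ≤ law p f a := by
  classical
  rw [law_apply]
  exact Finset.sum_nonneg fun ω _ => by split_ifs <;> simp [hp]

lemma law_mem_stdSimplex [Fintype α] {p : Ω → ℝ} (hp : p ∈ stdSimplex ℝ Ω) (f : Ω → α) :
    law p f ∈ stdSimplex ℝ α :=
  ⟨law_nonneg hp.1 f, (sum_law p f).trans hp.2⟩

lemma le_law {p : Ω → ℝ} (hp : ∀ ω, 0 ≤ p ω) (f : Ω → α) (ω : Ω) : p ω ≤ law p f (f ω) := by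
  classical
  rw [law_apply]
  have := Finset.single_le_sum (f := fun ω' => if f ω' = f ω then p ω' else 0)
    (fun ω' _ => by split_ifs <;> simp [hp]) (Finset.mem_univ ω)
  simpa using this

lemma law_pos {p : Ω → ℝ} (hp : ∀ ω, 0 ≤ p ω) (f : Ω → α) {ω : Ω} (h : 0 < p ω) :
    0 < law p f (f ω) :=
  h.trans_le (le_law hp f ω)

lemma law_comp [Fintype α] (p : Ω → ℝ) (f : Ω → α) (g : α → β) :
    law (law p f) g = law p (fun ω => g (f ω)) := by
  classical
  funext b
  have := sum_law_mul p f (fun a => if g a = b then 1 else 0)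
  simpa [law_apply] using this

lemma law_const (p : Ω → ℝ) (b : β) : law p (fun _ => b) b = ∑ ω, p ω := by
  classical
  simp [law_apply]

/-- The mass of `f = a` splits over the values of `g`. -/
lemma sum_law_pair [Fintype β] (p : Ω → ℝ) (f : Ω → α) (g : Ω → β) (a : α) :
    ∑ b, law p (fun ω => (f ω, g ω)) (a, b) = law p f a := by
  classical
  simp only [law_apply, Prod.mk.injEq, ite_and]
  rw [Finset.sum_comm]
  refine Finset.sum_congr rfl fun ω _ => ?_
  split_ifs <;> simp

lemma sum_law_pair_left [Fintype α] (p : Ω → ℝ) (f : Ω → α) (g : Ω → β) (b : β) :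
    ∑ a, law p (fun ω => (f ω, g ω)) (a, b) = law p g b := by
  classical
  simp only [law_apply, Prod.mk.injEq, and_comm (a := f _ = _), ite_and]
  rw [Finset.sum_comm]
  refine Finset.sum_congr rfl fun ω _ => ?_
  split_ifs <;> simp

lemma law_le_of_imp {p : Ω → ℝ} (hp : ∀ ω, 0 ≤ p ω) {f : Ω → α} {g : Ω → β} {a : α} {b : β}
    (h : ∀ ω, f ω = a → g ω = b) : law p f a ≤ law p g b := by
  classical
  rw [law_apply, law_apply]
  refine Finset.sum_le_sum fun ω _ => ?_
  by_cases h1 : f ω = a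
  · simp [h1, h ω h1]
  · simp only [h1, if_false]; split_ifs <;> simp [hp]

lemma law_congr_of_iff (p : Ω → ℝ) {f : Ω → α} {g : Ω → β} {a : α} {b : β}
    (h : ∀ ω, f ω = a ↔ g ω = b) : law p f a = law p g b := by
  classical
  simp only [law_apply, h]

lemma prob_congr (p : Ω → ℝ) {E F : Ω → Prop} (h : ∀ ω, E ω ↔ F ω) : prob p E = prob p F := by
  rw [show E = F from funext fun ω => propext (h ω)]

lemma law_eq_prob (p : Ω → ℝ) (f : Ω → α) (a : α) : law p f a = prob p (fun ω => f ω = a) := rfl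

lemma prob_nonneg {p : Ω → ℝ} (hp : ∀ ω, 0 ≤ p ω) (E : Ω → Prop) : 0 ≤ prob p E := by
  classical
  unfold prob
  exact Finset.sum_nonneg fun ω _ => by split_ifs <;> simp [hp]

lemma prob_mono {p : Ω → ℝ} (hp : ∀ ω, 0 ≤ p ω) {E F : Ω → Prop} (h : ∀ ω, E ω → F ω) :
    prob p E ≤ prob p F := by
  classical
  unfold prob
  refine Finset.sum_le_sum fun ω _ => ?_
  by_cases h1 : E ω
  · simp [h1, h ω h1]
  · simp only [h1, if_false]; split_ifs <;> simp [hp]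

lemma prob_le_one {p : Ω → ℝ} (hp : p ∈ stdSimplex ℝ Ω) (E : Ω → Prop) : prob p E ≤ 1 := by
  refine (prob_mono hp.1 (F := fun _ => True) fun _ _ => trivial).trans ?_
  simp [prob, hp.2]

lemma prob_or_le {p : Ω → ℝ} (hp : ∀ ω, 0 ≤ p ω) (E F : Ω → Prop) :
    prob p (fun ω => E ω ∨ F ω) ≤ prob p E + prob p F := by
  classical
  unfold prob
  rw [← Finset.sum_add_distrib]
  refine Finset.sum_le_sum fun ω _ => ?_
  by_cases h1 : E ω <;> by_cases h2 : F ω <;> simp [h1, h2, hp]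

lemma prob_not {p : Ω → ℝ} (hp : ∑ ω, p ω = 1) (E : Ω → Prop) :
    prob p (fun ω => ¬ E ω) = 1 - prob p E := by
  classical
  unfold prob
  rw [← hp, ← Finset.sum_sub_distrib]
  refine Finset.sum_congr rfl fun ω _ => ?_
  by_cases h1 : E ω <;> simp [h1]

lemma prob_eq_sum_mul (p : Ω → ℝ) (E : Ω → Prop) [DecidablePred E] :
    prob p E = ∑ ω, p ω * (if E ω then 1 else 0) := by
  unfold prob
  refine Finset.sum_congr rfl fun ω _ => ?_
  by_cases h1 : E ω <;> simp [h1]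

lemma prob_law [Fintype α] (p : Ω → ℝ) (f : Ω → α) (E : α → Prop) :
    prob (law p f) E = prob p (fun ω => E (f ω)) := by
  classical
  rw [prob_eq_sum_mul, prob_eq_sum_mul, sum_law_mul]

lemma entropy_eq_neg_sum [Fintype α] (p : Ω → ℝ) (f : Ω → α) :
    entropy p f = -∑ ω, p ω * Real.log (law p f (f ω)) := by
  rw [← sum_law_mul p f (fun a => Real.log (law p f a)), ← Finset.sum_neg_distrib]
  exact Finset.sum_congr rfl fun a _ => by simp [Real.negMulLog]

/-- Entropy depends only on the partition induced by the random variable. -/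
lemma entropy_congr [Fintype α] [Fintype β] (p : Ω → ℝ) {f : Ω → α} {g : Ω → β}
    (h : ∀ ω ω', f ω = f ω' ↔ g ω = g ω') : entropy p f = entropy p g := by
  rw [entropy_eq_neg_sum, entropy_eq_neg_sum]
  congr 1
  refine Finset.sum_congr rfl fun ω _ => ?_
  rw [law_congr_of_iff p fun ω' => h ω' ω]

lemma entropy_mono [Fintype α] [Fintype β] {p : Ω → ℝ} (hp : ∀ ω, 0 ≤ p ω) {f : Ω → α}
    {g : Ω → β} (h : ∀ ω ω', f ω = f ω' → g ω = g ω') : entropy p g ≤ entropy p f := by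
  rw [entropy_eq_neg_sum, entropy_eq_neg_sum]
  refine neg_le_neg (Finset.sum_le_sum fun ω _ => ?_)
  rcases (hp ω).eq_or_lt with h0 | h0
  · simp [← h0]
  · exact mul_le_mul_of_nonneg_left
      (Real.log_le_log (law_pos hp f h0) (law_le_of_imp hp fun ω' => h ω' ω)) (hp ω)

lemma entropy_law [Fintype α] [Fintype β] (p : Ω → ℝ) (f : Ω → α) (g : α → β) :
    entropy (law p f) g = entropy p (fun ω => g (f ω)) := by
  unfold entropy
  rw [law_comp]

lemma mutualInfo_law [Fintype α] [Fintype β] [Fintype γ] (p : Ω → ℝ) (f : Ω → α) (g : α → β)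
    (h : α → γ) :
    mutualInfo (law p f) g h = mutualInfo p (fun ω => g (f ω)) (fun ω => h (f ω)) := by
  simp only [mutualInfo, entropy_law]

/-- **Gibbs' inequality**, conditional form: the conditional entropy of `f` given `h` is at most
the cross entropy with respect to any conditional sub-probability `q`. -/
lemma entropy_pair_le_of_kernel [Fintype α] [Fintype γ] {p : Ω → ℝ} (hp : p ∈ stdSimplex ℝ Ω)
    (f : Ω → α) (h : Ω → γ) (q : α → γ → ℝ) (hq : ∀ a c, 0 ≤ q a c) (hq1 : ∀ c, ∑ a, q a c ≤ 1)
    (hpos : ∀ ω, 0 < p ω → 0 < q (f ω) (h ω)) :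
    entropy p (fun ω => (f ω, h ω)) ≤ entropy p h - ∑ ω, p ω * Real.log (q (f ω) (h ω)) := by
  classical
  set L := law p (fun ω => (f ω, h ω)) with hL
  have key : ∑ ω, p ω * (Real.log (q (f ω) (h ω)) + Real.log (law p h (h ω))
      - Real.log (L (f ω, h ω))) ≤ 0 := by
    have h1 : ∀ ω, p ω * (Real.log (q (f ω) (h ω)) + Real.log (law p h (h ω))
        - Real.log (L (f ω, h ω))) ≤
        p ω * (q (f ω) (h ω) * law p h (h ω) / L (f ω, h ω)) - p ω := by
      intro ω
      rcases (hp.1 ω).eq_or_lt with h0 | h0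
      · simp [← h0]
      · have l1 := hpos ω h0
        have l2 := law_pos hp.1 h h0
        have l3 := law_pos hp.1 (fun ω => (f ω, h ω)) h0
        rw [← Real.log_mul l1.ne' l2.ne', ← Real.log_div (mul_pos l1 l2).ne' l3.ne']
        have := Real.log_le_sub_one_of_pos (div_pos (mul_pos l1 l2) l3)
        nlinarith
    refine (Finset.sum_le_sum fun ω _ => h1 ω).trans ?_
    rw [Finset.sum_sub_distrib, hp.2,
      ← sum_law_mul p (fun ω => (f ω, h ω)) (fun ac => q ac.1 ac.2 * law p h ac.2 / L ac),
      ← hL, Fintype.sum_prod_type_right]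
    have h2 : ∀ c, ∑ a, L (a, c) * (q a c * law p h c / L (a, c)) ≤ law p h c := by
      intro c
      have hl := law_nonneg hp.1 h c
      calc ∑ a, L (a, c) * (q a c * law p h c / L (a, c)) ≤ ∑ a, q a c * law p h c := by
            refine Finset.sum_le_sum fun a _ => ?_
            by_cases h0 : L (a, c) = 0
            · simp only [h0, zero_mul]; exact mul_nonneg (hq a c) hl
            · rw [mul_div_cancel₀ _ h0]
        _ = (∑ a, q a c) * law p h c := by rw [Finset.sum_mul]
        _ ≤ law p h c := by nlinarith [hq1 c]
    have h3 := Finset.sum_le_sum fun c (_ : c ∈ Finset.univ) => h2 c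
    rw [sum_law, hp.2] at h3
    linarith
  rw [entropy_eq_neg_sum, entropy_eq_neg_sum]
  simp only [mul_sub, mul_add, Finset.sum_sub_distrib, Finset.sum_add_distrib] at key
  linarith

/-- Submodularity of entropy. -/
lemma entropy_submodular [Fintype α] [Fintype β] [Fintype γ] {p : Ω → ℝ}
    (hp : p ∈ stdSimplex ℝ Ω) (f : Ω → α) (g : Ω → β) (h : Ω → γ) :
    entropy p (fun ω => (f ω, g ω, h ω)) + entropy p h ≤
      entropy p (fun ω => (f ω, h ω)) + entropy p (fun ω => (g ω, h ω)) := by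
  have := entropy_pair_le_of_kernel hp f (fun ω => (g ω, h ω))
    (fun a bc => law p (fun ω => (f ω, h ω)) (a, bc.2) / law p h bc.2)
    (fun a bc => div_nonneg (law_nonneg hp.1 _ _) (law_nonneg hp.1 _ _))
    (fun bc => by rw [← Finset.sum_div, sum_law_pair_left]; exact div_self_le_one _)
    (fun ω h0 => div_pos (law_pos hp.1 (fun ω => (f ω, h ω)) h0) (law_pos hp.1 h h0))
  have h2 : ∑ ω, p ω * Real.log (law p (fun ω => (f ω, h ω)) (f ω, h ω) / law p h (h ω)) =
      entropy p h - entropy p (fun ω => (f ω, h ω)) := by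
    rw [entropy_eq_neg_sum, entropy_eq_neg_sum, neg_sub_neg, ← Finset.sum_sub_distrib]
    refine Finset.sum_congr rfl fun ω _ => ?_
    rcases (hp.1 ω).eq_or_lt with h0 | h0
    · simp [← h0]
    · rw [Real.log_div (law_pos hp.1 (fun ω => (f ω, h ω)) h0).ne' (law_pos hp.1 h h0).ne']
      ring
  simp only at this
  rw [h2] at this
  linarith

lemma entropy_const {p : Ω → ℝ} (hp : p ∈ stdSimplex ℝ Ω) [Fintype α] (a : α) :
    entropy p (fun _ => a) = 0 := by
  rw [entropy_eq_neg_sum]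
  simp [law_const, hp.2]

lemma mutualInfo_nonneg [Fintype α] [Fintype β] {p : Ω → ℝ} (hp : p ∈ stdSimplex ℝ Ω)
    (f : Ω → α) (g : Ω → β) : 0 ≤ mutualInfo p f g := by
  have h := entropy_submodular hp f g (fun _ => ())
  rw [entropy_const hp, entropy_congr p (f := fun ω => (f ω, ())) (g := f) (by simp),
    entropy_congr p (f := fun ω => (g ω, ())) (g := g) (by simp),
    entropy_congr p (f := fun ω => (f ω, g ω, ())) (g := fun ω => (f ω, g ω)) (by simp)] at h
  unfold mutualInfo
  linarith

lemma entropy_le_log_card [Fintype α] [Nonempty α] {p : Ω → ℝ} (hp : p ∈ stdSimplex ℝ Ω)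
    (f : Ω → α) : entropy p f ≤ Real.log (Fintype.card α) := by
  have hc : (0 : ℝ) < Fintype.card α := by exact_mod_cast Fintype.card_pos
  have := entropy_pair_le_of_kernel hp f (fun _ => ()) (fun _ _ => 1 / (Fintype.card α : ℝ))
    (fun _ _ => by positivity) (fun _ => by simp) (fun _ _ => by positivity)
  rw [entropy_const hp, entropy_congr p (g := f) (by simp), ← Finset.sum_mul, hp.2] at this
  simpa using this

/-- Conditional independence makes submodularity an equality. -/
lemma IsMarkovChain.entropy_eq [Fintype α] [Fintype β] [Fintype γ] {p : Ω → ℝ}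
    (hp : p ∈ stdSimplex ℝ Ω) {f : Ω → α} {g : Ω → β} {h : Ω → γ} (H : IsMarkovChain p f g h) :
    entropy p (fun ω => (f ω, g ω, h ω)) + entropy p g =
      entropy p (fun ω => (f ω, g ω)) + entropy p (fun ω => (g ω, h ω)) := by
  simp only [entropy_eq_neg_sum, ← neg_add, ← Finset.sum_add_distrib, ← mul_add]
  congr 1
  refine Finset.sum_congr rfl fun ω _ => ?_
  rcases (hp.1 ω).eq_or_lt with h0 | h0
  · simp [← h0]
  · rw [← Real.log_mul (law_pos hp.1 (fun ω => (f ω, g ω, h ω)) h0).ne' (law_pos hp.1 g h0).ne',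
      ← Real.log_mul (law_pos hp.1 (fun ω => (f ω, g ω)) h0).ne'
        (ne_of_gt (law_pos hp.1 (fun ω => (g ω, h ω)) h0)), H]

/-- The data processing inequality. -/
lemma IsMarkovChain.mutualInfo_le [Fintype α] [Fintype β] [Fintype γ] {p : Ω → ℝ}
    (hp : p ∈ stdSimplex ℝ Ω) {f : Ω → α} {g : Ω → β} {h : Ω → γ} (H : IsMarkovChain p f g h) :
    mutualInfo p f h ≤ mutualInfo p f g := by
  have h1 := H.entropy_eq hp
  have h2 := entropy_submodular hp g f h
  rw [entropy_congr p (f := fun ω => (g ω, f ω, h ω)) (g := fun ω => (f ω, g ω, h ω))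
    (by simp; tauto)] at h2
  unfold mutualInfo
  linarith

lemma entropy_pair_of_indep [Fintype α] [Fintype β] {p : Ω → ℝ} (hp : p ∈ stdSimplex ℝ Ω)
    {f : Ω → α} {g : Ω → β}
    (H : ∀ a b, law p (fun ω => (f ω, g ω)) (a, b) = law p f a * law p g b) :
    entropy p (fun ω => (f ω, g ω)) = entropy p f + entropy p g := by
  simp only [entropy_eq_neg_sum, ← neg_add, ← Finset.sum_add_distrib, ← mul_add]
  congr 1
  refine Finset.sum_congr rfl fun ω _ => ?_
  rcases (hp.1 ω).eq_or_lt with h0 | h0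
  · simp [← h0]
  · rw [← Real.log_mul (law_pos hp.1 f h0).ne' (ne_of_gt (law_pos hp.1 g h0)), H]

/-- **Fano's inequality**. -/
lemma fano [Fintype α] [Fintype γ] {p : Ω → ℝ} (hp : p ∈ stdSimplex ℝ Ω) (f : Ω → α)
    (h : Ω → γ) (d : γ → α) :
    entropy p (fun ω => (f ω, h ω)) - entropy p h ≤
      Real.binEntropy (prob p fun ω => f ω ≠ d (h ω)) +
        (prob p fun ω => f ω ≠ d (h ω)) * Real.log (Fintype.card α) := by
  classical
  set e := prob p fun ω => f ω ≠ d (h ω) with he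
  have he0 : 0 ≤ e := prob_nonneg hp.1 _
  have he1 : e ≤ 1 := prob_le_one hp _
  have hΩ : Nonempty Ω := by
    by_contra hne
    rw [not_nonempty_iff] at hne
    simpa using hp.2
  have hα : Nonempty α := ⟨f hΩ.some⟩
  set N : ℝ := ((Fintype.card α : ℕ) : ℝ) with hN
  have hN0 : 0 < N := by rw [hN]; exact_mod_cast Fintype.card_pos
  have he' : e = ∑ ω, p ω * (if f ω ≠ d (h ω) then 1 else 0) := prob_eq_sum_mul p _
  have he1' : 1 - e = ∑ ω, p ω * (if f ω = d (h ω) then 1 else 0) := by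
    rw [sub_eq_iff_eq_add, he', ← Finset.sum_add_distrib]
    refine hp.2.symm.trans (Finset.sum_congr rfl fun ω _ => ?_)
    by_cases h1 : f ω = d (h ω) <;> simp [h1]
  have key := entropy_pair_le_of_kernel hp f h
    (fun a c => if a = d c then 1 - e else e / N)
    (fun a c => by
      split_ifs
      · linarith
      · positivity)
    (fun c => by
      have : ∀ a, (if a = d c then 1 - e else e / N) ≤ (if a = d c then 1 - e else 0) + e / N := by
        intro a
        have : 0 ≤ e / N := by positivity
        split_ifs <;> linarith
      refine (Finset.sum_le_sum fun a _ => this a).trans ?_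
      rw [Finset.sum_add_distrib]
      simp only [Finset.sum_ite_eq', Finset.mem_univ, if_true, Finset.sum_const, Finset.card_univ,
        nsmul_eq_mul, ← hN]
      rw [mul_div_cancel₀ _ hN0.ne']
      linarith)
    (fun ω h0 => by
      split_ifs with h1
      · rw [he1']
        refine lt_of_lt_of_le ?_ (Finset.single_le_sum (f := fun ω =>
          p ω * (if f ω = d (h ω) then 1 else 0)) (fun ω _ => ?_) (Finset.mem_univ ω))
        · simpa [h1] using h0
        · exact mul_nonneg (hp.1 ω) (by split_ifs <;> simp)
      · refine div_pos ?_ hN0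
        rw [he']
        refine lt_of_lt_of_le ?_ (Finset.single_le_sum (f := fun ω =>
          p ω * (if f ω ≠ d (h ω) then 1 else 0)) (fun ω _ => ?_) (Finset.mem_univ ω))
        · simpa [h1] using h0
        · exact mul_nonneg (hp.1 ω) (by split_ifs <;> simp))
  have h2 : ∀ A B : ℝ, ∑ ω, p ω * (if f ω = d (h ω) then A else B) =
      (∑ ω, p ω * (if f ω = d (h ω) then 1 else 0)) * A +
        (∑ ω, p ω * (if f ω ≠ d (h ω) then 1 else 0)) * B := by
    intro A B
    rw [Finset.sum_mul, Finset.sum_mul, ← Finset.sum_add_distrib]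
    refine Finset.sum_congr rfl fun ω _ => ?_
    by_cases h1 : f ω = d (h ω) <;> simp [h1]
  simp only [apply_ite Real.log] at key
  rw [h2, ← he1', ← he'] at key
  rw [Real.binEntropy, Real.log_inv, Real.log_inv]
  rcases he0.eq_or_lt with h0 | h0
  · simp only [← h0] at key ⊢
    simp at key ⊢
    linarith
  · rw [Real.log_div h0.ne' hN0.ne'] at key
    linarith

end Toolkit

section Kernel

variable {𝒵 ξ 𝒰 𝒱 β γ : Type*} [Fintype 𝒵] [Fintype 𝒰] [Fintype 𝒱]

/-- Joint mass function of `(U, Z)`, where `U` is obtained from `x Z` through the channel `V`. -/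
def kernelJoint (P : 𝒵 → ℝ) (x : 𝒵 → ξ) (V : ξ → 𝒰 → ℝ) (ω : 𝒰 × 𝒵) : ℝ :=
  P ω.2 * V (x ω.2) ω.1

lemma kernelJoint_mem_stdSimplex {P : 𝒵 → ℝ} (hP : P ∈ stdSimplex ℝ 𝒵) (x : 𝒵 → ξ)
    {V : ξ → 𝒰 → ℝ} (hV : ∀ a, V a ∈ stdSimplex ℝ 𝒰) :
    kernelJoint P x V ∈ stdSimplex ℝ (𝒰 × 𝒵) := by
  refine ⟨fun ω => mul_nonneg (hP.1 _) ((hV _).1 _), ?_⟩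
  rw [Fintype.sum_prod_type_right, ← hP.2]
  refine Finset.sum_congr rfl fun z _ => ?_
  simp only [kernelJoint]
  rw [← Finset.mul_sum, (hV _).2, mul_one]

lemma law_kernelJoint_snd (P : 𝒵 → ℝ) (x : 𝒵 → ξ) {V : ξ → 𝒰 → ℝ}
    (hV : ∀ a, ∑ u, V a u = 1) (f : 𝒵 → β) :
    law (kernelJoint P x V) (fun ω => f ω.2) = law P f := by
  classical
  funext b
  rw [law_apply, law_apply, Fintype.sum_prod_type_right]
  refine Finset.sum_congr rfl fun z _ => ?_
  by_cases h : f z = b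
  · simp only [h, if_true, kernelJoint]
    rw [← Finset.mul_sum, hV, mul_one]
  · simp [h]

lemma law_kernelJoint_fst (P : 𝒵 → ℝ) (x : 𝒵 → ξ) (V : ξ → 𝒰 → ℝ) (u : 𝒰) :
    law (kernelJoint P x V) (fun ω => ω.1) u = ∑ z, P z * V (x z) u := by
  classical
  rw [law_apply, Fintype.sum_prod_type_right]
  simp [kernelJoint]

lemma law_kernelJoint_pair (P : 𝒵 → ℝ) (x : 𝒵 → ξ) (V : ξ → 𝒰 → ℝ) (f : 𝒵 → β) (u : 𝒰) (b : β) :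
    law (kernelJoint P x V) (fun ω => (ω.1, f ω.2)) (u, b) =
      law (fun z => P z * V (x z) u) f b := by
  classical
  rw [law_apply, law_apply, Fintype.sum_prod_type_right]
  refine Finset.sum_congr rfl fun z _ => ?_
  by_cases h : f z = b <;> simp [h, kernelJoint]

/-- A version of `law_kernelJoint_pair` that groups the source letters by their value of `x`. -/
lemma law_kernelJoint_pair_eq_sum [Fintype ξ] (P : 𝒵 → ℝ) (x : 𝒵 → ξ) (V : ξ → 𝒰 → ℝ) (f : 𝒵 → β)
    (u : 𝒰) (b : β) :
    law (kernelJoint P x V) (fun ω => (ω.1, f ω.2)) (u, b) =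
      ∑ a, V a u * law P (fun z => (x z, f z)) (a, b) := by
  classical
  rw [law_kernelJoint_pair, law_apply]
  simp only [law_apply, Finset.mul_sum]
  rw [Finset.sum_comm]
  refine Finset.sum_congr rfl fun z _ => ?_
  by_cases hz : f z = b <;> simp [hz, mul_comm]

variable [Fintype β] [Fintype γ]

/-- The information `I(U; f(Z))` when `U` is obtained from `x Z` through the channel `V`. -/
noncomputable def kernelInfo (P : 𝒵 → ℝ) (x : 𝒵 → ξ) (V : ξ → 𝒰 → ℝ) (f : 𝒵 → β) : ℝ :=
  mutualInfo (kernelJoint P x V) (fun ω => ω.1) (fun ω => f ω.2)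

/-- The contribution of a letter `u` with transition weights `v = V(u | ·)` to `kernelInfo`. -/
noncomputable def columnInfo (P : 𝒵 → ℝ) (x : 𝒵 → ξ) (f : 𝒵 → β) (v : ξ → ℝ) : ℝ :=
  Real.negMulLog (∑ z, P z * v (x z)) -
    ∑ b, Real.negMulLog (law (fun z => P z * v (x z)) f b)

lemma kernelInfo_eq_sum_columnInfo (P : 𝒵 → ℝ) (x : 𝒵 → ξ) {V : ξ → 𝒰 → ℝ}
    (hV : ∀ a, ∑ u, V a u = 1) (f : 𝒵 → β) :
    kernelInfo P x V f = entropy P f + ∑ u, columnInfo P x f (fun a => V a u) := by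
  unfold kernelInfo mutualInfo columnInfo entropy
  rw [law_kernelJoint_snd P x hV, Finset.sum_sub_distrib, Fintype.sum_prod_type]
  simp only [law_kernelJoint_fst, law_kernelJoint_pair]
  ring

lemma columnInfo_smul (P : 𝒵 → ℝ) (x : 𝒵 → ξ) (f : 𝒵 → β) (c : ℝ) (v : ξ → ℝ) :
    columnInfo P x f (fun a => c * v a) = c * columnInfo P x f v := by
  classical
  have h1 : ∀ b, law (fun z => P z * (c * v (x z))) f b =
      c * law (fun z => P z * v (x z)) f b := by
    intro b
    rw [law_apply, law_apply, Finset.mul_sum]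
    refine Finset.sum_congr rfl fun z _ => ?_
    split_ifs <;> ring
  have h2 : ∑ z, P z * (c * v (x z)) = c * ∑ z, P z * v (x z) := by
    rw [Finset.mul_sum]
    exact Finset.sum_congr rfl fun z _ => by ring
  unfold columnInfo
  simp only [h1, h2, Real.negMulLog_mul, Finset.sum_add_distrib]
  rw [← Finset.sum_mul, sum_law, ← Finset.mul_sum]
  ring

lemma columnInfo_zero (P : 𝒵 → ℝ) (x : 𝒵 → ξ) (f : 𝒵 → β) :
    columnInfo P x f (fun _ => 0) = 0 := by
  simpa using columnInfo_smul P x f 0 (fun _ => 0)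

/-- Relabelling the auxiliary alphabet does not change the information. -/
lemma kernelInfo_reindex (P : 𝒵 → ℝ) (x : 𝒵 → ξ) {V : ξ → 𝒰 → ℝ}
    (hV : ∀ a, ∑ u, V a u = 1) (f : 𝒵 → β) (e : 𝒱 ≃ 𝒰) :
    kernelInfo P x (fun a u => V a (e u)) f = kernelInfo P x V f := by
  rw [kernelInfo_eq_sum_columnInfo P x hV, kernelInfo_eq_sum_columnInfo P x
    (fun a => (e.sum_comp (V a)).trans (hV a))]
  rw [e.sum_comp (fun u => columnInfo P x f fun a => V a u)]

/-- Time sharing between two channels. -/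
def mixKernel (t : ℝ) (V : ξ → 𝒰 → ℝ) (V' : ξ → 𝒱 → ℝ) (a : ξ) : 𝒰 ⊕ 𝒱 → ℝ :=
  Sum.elim (fun u => t * V a u) (fun u => (1 - t) * V' a u)

lemma mixKernel_mem_stdSimplex {t : ℝ} (ht0 : 0 ≤ t) (ht1 : t ≤ 1) {V : ξ → 𝒰 → ℝ}
    {V' : ξ → 𝒱 → ℝ} (hV : ∀ a, V a ∈ stdSimplex ℝ 𝒰) (hV' : ∀ a, V' a ∈ stdSimplex ℝ 𝒱)
    (a : ξ) : mixKernel t V V' a ∈ stdSimplex ℝ (𝒰 ⊕ 𝒱) := by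
  refine ⟨?_, ?_⟩
  · rintro (u | u)
    · exact mul_nonneg ht0 ((hV a).1 u)
    · exact mul_nonneg (sub_nonneg.2 ht1) ((hV' a).1 u)
  · simp [mixKernel, ← Finset.mul_sum, (hV a).2, (hV' a).2]

lemma kernelInfo_mixKernel (P : 𝒵 → ℝ) (x : 𝒵 → ξ) {t : ℝ} (ht0 : 0 ≤ t) (ht1 : t ≤ 1)
    {V : ξ → 𝒰 → ℝ} {V' : ξ → 𝒱 → ℝ} (hV : ∀ a, V a ∈ stdSimplex ℝ 𝒰)
    (hV' : ∀ a, V' a ∈ stdSimplex ℝ 𝒱) (f : 𝒵 → β) :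
    kernelInfo P x (mixKernel t V V') f =
      t * kernelInfo P x V f + (1 - t) * kernelInfo P x V' f := by
  rw [kernelInfo_eq_sum_columnInfo P x (fun a => (mixKernel_mem_stdSimplex ht0 ht1 hV hV' a).2),
    kernelInfo_eq_sum_columnInfo P x (fun a => (hV a).2),
    kernelInfo_eq_sum_columnInfo P x (fun a => (hV' a).2)]
  simp only [mixKernel, Fintype.sum_sum_type, Sum.elim_inl, Sum.elim_inr, columnInfo_smul,
    ← Finset.mul_sum]
  ring

/-- Appending a letter of probability zero. -/
lemma exists_kernel_succ {k : ℕ} {V : ξ → Fin k → ℝ} (hV : ∀ a, V a ∈ stdSimplex ℝ (Fin k))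
    (P : 𝒵 → ℝ) (x : 𝒵 → ξ) :
    ∃ V' : ξ → Fin (k + 1) → ℝ, (∀ a, V' a ∈ stdSimplex ℝ (Fin (k + 1))) ∧
      (∀ f : 𝒵 → β, kernelInfo P x V' f = kernelInfo P x V f) ∧
      (∀ f : 𝒵 → γ, kernelInfo P x V' f = kernelInfo P x V f) := by
  have h : ∀ a, (Fin.cons 0 (V a) : Fin (k + 1) → ℝ) ∈ stdSimplex ℝ (Fin (k + 1)) := by
    intro a
    refine ⟨fun u => ?_, ?_⟩
    · refine Fin.cases ?_ (fun j => ?_) u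
      · simp
      · simpa using (hV a).1 j
    · rw [Fin.sum_univ_succ]
      simpa using (hV a).2
  refine ⟨fun a => Fin.cons 0 (V a), h, ?_, ?_⟩ <;>
  · intro f
    rw [kernelInfo_eq_sum_columnInfo P x (fun a => (h a).2),
      kernelInfo_eq_sum_columnInfo P x (fun a => (hV a).2), Fin.sum_univ_succ]
    simp [columnInfo_zero]

/-- A channel into an alphabet with more than `|ξ| + 1` letters can be replaced by one that uses a
letter less, keeps `I(U; f(Z))` and does not increase `I(U; g(Z))`. -/
lemma exists_kernel_pred [Fintype ξ] {k : ℕ} (hk : Fintype.card ξ + 1 ≤ k)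
    {V : ξ → Fin (k + 1) → ℝ} (hV : ∀ a, V a ∈ stdSimplex ℝ (Fin (k + 1)))
    (P : 𝒵 → ℝ) (x : 𝒵 → ξ) (f : 𝒵 → β) (g : 𝒵 → γ) :
    ∃ V' : ξ → Fin k → ℝ, (∀ a, V' a ∈ stdSimplex ℝ (Fin k)) ∧
      kernelInfo P x V' f = kernelInfo P x V f ∧ kernelInfo P x V' g ≤ kernelInfo P x V g := by
  -- it suffices to rescale the columns so that one of them vanishes
  suffices H : ∃ (c : Fin (k + 1) → ℝ) (u₀ : Fin (k + 1)), (∀ u, 0 ≤ c u) ∧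
      (∀ a, c u₀ * V a u₀ = 0) ∧ (∀ a, ∑ u, c u * V a u = 1) ∧
      ∑ u, c u * columnInfo P x f (fun a => V a u) = ∑ u, columnInfo P x f (fun a => V a u) ∧
      ∑ u, c u * columnInfo P x g (fun a => V a u) ≤ ∑ u, columnInfo P x g (fun a => V a u) by
    obtain ⟨c, u₀, hc0, hcu, hc1, hcf, hcg⟩ := H
    have hs : ∀ a, (fun j => c (u₀.succAbove j) * V a (u₀.succAbove j)) ∈ stdSimplex ℝ (Fin k) := by
      intro a
      refine ⟨fun j => mul_nonneg (hc0 _) ((hV a).1 _), ?_⟩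
      have := hc1 a
      rwa [Fin.sum_univ_succAbove _ u₀, hcu, zero_add] at this
    have hz : (fun a => c u₀ * V a u₀) = fun _ => 0 := funext hcu
    refine ⟨_, hs, ?_, ?_⟩
    · rw [kernelInfo_eq_sum_columnInfo P x (fun a => (hs a).2),
        kernelInfo_eq_sum_columnInfo P x (fun a => (hV a).2), ← hcf, Fin.sum_univ_succAbove _ u₀,
        ← columnInfo_smul, hz, columnInfo_zero, zero_add]
      simp only [columnInfo_smul]
    · rw [kernelInfo_eq_sum_columnInfo P x (fun a => (hs a).2),
        kernelInfo_eq_sum_columnInfo P x (fun a => (hV a).2)]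
      rw [Fin.sum_univ_succAbove _ u₀, ← columnInfo_smul, hz, columnInfo_zero, zero_add] at hcg
      simp only [columnInfo_smul]
      linarith
  by_cases hcol : ∃ u, ∀ a, V a u = 0
  · obtain ⟨u, hu⟩ := hcol
    exact ⟨fun _ => 1, u, by simp, by simp [hu], fun a => by simpa using (hV a).2, by simp, by simp⟩
  push Not at hcol
  let φ : (Fin (k + 1) → ℝ) →ₗ[ℝ] (ξ → ℝ) × ℝ :=
    { toFun := fun d => (fun a => ∑ u, d u * V a u,
        ∑ u, d u * columnInfo P x f (fun a => V a u))
      map_add' := fun d d' => by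
        ext <;> simp [add_mul, Finset.sum_add_distrib]
      map_smul' := fun r d => by
        ext <;> simp [mul_assoc, Finset.mul_sum] }
  have hφ : LinearMap.ker φ ≠ ⊥ := by
    apply LinearMap.ker_ne_bot_of_finrank_lt
    simp
    omega
  obtain ⟨d₀, hd₀, hd₀0⟩ := (Submodule.ne_bot_iff _).1 hφ
  obtain ⟨d, hd, hd0, hdg⟩ : ∃ d ∈ LinearMap.ker φ, d ≠ 0 ∧
      ∑ u, d u * columnInfo P x g (fun a => V a u) ≤ 0 := by
    rcases le_total (∑ u, d₀ u * columnInfo P x g (fun a => V a u)) 0 with h | h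
    · exact ⟨d₀, hd₀, hd₀0, h⟩
    · refine ⟨-d₀, neg_mem hd₀, neg_ne_zero.2 hd₀0, ?_⟩
      simpa using h
  have hd' : φ d = 0 := hd
  have hdV : ∀ a, ∑ u, d u * V a u = 0 := fun a => congrFun (congrArg Prod.fst hd') a
  have hdf : ∑ u, d u * columnInfo P x f (fun a => V a u) = 0 := congrArg Prod.snd hd'
  obtain ⟨u₀, hu₀⟩ := Finite.exists_min d
  have hneg : d u₀ < 0 := by
    by_contra hcon
    push Not at hcon
    apply hd0
    funext u
    obtain ⟨a, ha⟩ := hcol u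
    have := (Finset.sum_eq_zero_iff_of_nonneg (fun u _ => mul_nonneg (hcon.trans (hu₀ u))
      ((hV a).1 u))).1 (hdV a) u (Finset.mem_univ u)
    simpa [ha] using this
  have key : ∀ w : Fin (k + 1) → ℝ, ∑ u, (1 + (-1 / d u₀) * d u) * w u =
      ∑ u, w u + (-1 / d u₀) * ∑ u, d u * w u := by
    intro w
    rw [Finset.mul_sum, ← Finset.sum_add_distrib]
    exact Finset.sum_congr rfl fun u _ => by ring
  have ht : 0 ≤ -1 / d u₀ := div_nonneg_of_nonpos (by norm_num) hneg.le
  refine ⟨fun u => 1 + (-1 / d u₀) * d u, u₀, fun u => ?_, fun a => ?_, fun a => ?_, ?_, ?_⟩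
  · have h1 := mul_le_mul_of_nonneg_left (hu₀ u) ht
    rw [div_mul_cancel₀ _ hneg.ne] at h1
    linarith
  · simp only [div_mul_cancel₀ _ hneg.ne]
    ring
  · rw [key, hdV, (hV a).2]; ring
  · rw [key, hdf]; ring
  · rw [key]
    nlinarith

end Kernel

section Regions

variable {𝒳 𝒳t 𝒴 : Type*} [Fintype 𝒳] [Fintype 𝒳t] [Fintype 𝒴]

lemma infoUXt_eq (P : 𝒳 × 𝒳t × 𝒴 → ℝ) {k : ℕ} (V : 𝒳t → Fin k → ℝ) :
    infoUXt P V = kernelInfo P (fun z => z.2.1) V (fun z => z.2.1) := rfl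

lemma infoUY_eq (P : 𝒳 × 𝒳t × 𝒴 → ℝ) {k : ℕ} (V : 𝒳t → Fin k → ℝ) :
    infoUY P V = kernelInfo P (fun z => z.2.1) V (fun z => z.2.2) := rfl

lemma auxJoint_mem_stdSimplex {P : 𝒳 × 𝒳t × 𝒴 → ℝ} (hP : P ∈ stdSimplex ℝ (𝒳 × 𝒳t × 𝒴)) {k : ℕ}
    {V : 𝒳t → Fin k → ℝ} (hV : ∀ x, V x ∈ stdSimplex ℝ (Fin k)) :
    auxJoint P V ∈ stdSimplex ℝ (Fin k × 𝒳 × 𝒳t × 𝒴) :=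
  kernelJoint_mem_stdSimplex hP (fun z => z.2.1) hV

/-- If `U` is generated from `x Z` and `x Z - y Z - g Z` is a Markov chain then so is
`U - y Z - g Z`. -/
lemma IsMarkovChain.kernelJoint {𝒵 ξ 𝒰 β γ : Type*} [Fintype 𝒵] [Fintype ξ] [Fintype 𝒰]
    {P : 𝒵 → ℝ} {x : 𝒵 → ξ} {y : 𝒵 → β} {g : 𝒵 → γ} (H : IsMarkovChain P x y g)
    {V : ξ → 𝒰 → ℝ} (hV : ∀ a, ∑ u, V a u = 1) :
    IsMarkovChain (kernelJoint P x V) (fun ω => ω.1) (fun ω => y ω.2) (fun ω => g ω.2) := by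
  intro u b c
  rw [law_kernelJoint_pair_eq_sum P x V (fun z => (y z, g z)) u (b, c),
    law_kernelJoint_pair_eq_sum P x V y u b,
    law_kernelJoint_snd P x hV y, law_kernelJoint_snd P x hV (fun z => (y z, g z)),
    Finset.sum_mul, Finset.sum_mul]
  refine Finset.sum_congr rfl fun a _ => ?_
  have := H a b c
  rw [mul_assoc, mul_assoc, this]

lemma infoUX_le_infoUY {P : 𝒳 × 𝒳t × 𝒴 → ℝ} (hP : P ∈ stdSimplex ℝ (𝒳 × 𝒳t × 𝒴))
    (hM : IsMarkovChain P (fun ω => ω.2.1) (fun ω => ω.2.2) (fun ω => ω.1)) {k : ℕ}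
    {V : 𝒳t → Fin k → ℝ} (hV : ∀ x, V x ∈ stdSimplex ℝ (Fin k)) :
    infoUX P V ≤ infoUY P V :=
  (hM.kernelJoint fun a => (hV a).2).mutualInfo_le (kernelJoint_mem_stdSimplex hP _ hV)

/-- The tuples with `0 ≤ R_s ≤ I(U; Y)`, `R_ℓ ≥ 0` and `R_w ≥ I(U; X̃) - c I(U; Y)` for a test
channel with `k` letters. -/
def testRegion (P : 𝒳 × 𝒳t × 𝒴 → ℝ) (c : ℝ) (k : ℕ) : Set (ℝ × ℝ × ℝ) :=
  {R | ∃ V : 𝒳t → Fin k → ℝ, (∀ x, V x ∈ stdSimplex ℝ (Fin k)) ∧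
    0 ≤ R.1 ∧ R.1 ≤ infoUY P V ∧ 0 ≤ R.2.1 ∧ infoUXt P V - c * infoUY P V ≤ R.2.2}

lemma regionR2Card_eq_testRegion {P : 𝒳 × 𝒳t × 𝒴 → ℝ} (hP : P ∈ stdSimplex ℝ (𝒳 × 𝒳t × 𝒴))
    (hM : IsMarkovChain P (fun ω => ω.2.1) (fun ω => ω.2.2) (fun ω => ω.1)) (k : ℕ) :
    regionR2Card P k = testRegion P 1 k := by
  ext R
  refine exists_congr fun V => and_congr_right fun hV => ?_
  have := max_eq_left (sub_nonpos.2 (infoUX_le_infoUY hP hM hV))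
  simp [this]

lemma regionR4Card_eq_testRegion {P : 𝒳 × 𝒳t × 𝒴 → ℝ} (hP : P ∈ stdSimplex ℝ (𝒳 × 𝒳t × 𝒴))
    (hM : IsMarkovChain P (fun ω => ω.2.1) (fun ω => ω.2.2) (fun ω => ω.1)) (k : ℕ) :
    regionR4Card P k = testRegion P 0 k := by
  ext R
  refine exists_congr fun V => and_congr_right fun hV => ?_
  have := max_eq_left (sub_nonpos.2 (infoUX_le_infoUY hP hM hV))
  simp [this]

lemma testRegion_mono (P : 𝒳 × 𝒳t × 𝒴 → ℝ) (c : ℝ) : Monotone (testRegion P c) := by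
  refine monotone_nat_of_le_succ fun k => ?_
  rintro R ⟨V, hV, h0, h1, h2, h3⟩
  obtain ⟨V', hV', hf, hg⟩ := exists_kernel_succ (β := 𝒳t) (γ := 𝒴) hV P (fun z => z.2.1)
  refine ⟨V', hV', h0, ?_, h2, ?_⟩
  · rwa [infoUY_eq, hg]
  · rwa [infoUY_eq, infoUXt_eq, hg, hf]

lemma testRegion_succ_subset (P : 𝒳 × 𝒳t × 𝒴 → ℝ) (c : ℝ) {k : ℕ}
    (hk : Fintype.card 𝒳t + 1 ≤ k) : testRegion P c (k + 1) ⊆ testRegion P c k := by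
  rintro R ⟨V, hV, h0, h1, h2, h3⟩
  obtain ⟨V', hV', hf, hg⟩ := exists_kernel_pred hk hV P (fun z => z.2.1) (fun z => z.2.2)
    (fun z => z.2.1)
  rw [← infoUY_eq, ← infoUY_eq] at hf
  rw [← infoUXt_eq, ← infoUXt_eq] at hg
  exact ⟨V', hV', h0, by rwa [hf], h2, by rw [hf]; linarith⟩

/-- The cardinality bound on the auxiliary alphabet. -/
lemma testRegion_subset (P : 𝒳 × 𝒳t × 𝒴 → ℝ) (c : ℝ) (k : ℕ) :
    testRegion P c k ⊆ testRegion P c (Fintype.card 𝒳t + 1) := by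
  rcases le_total k (Fintype.card 𝒳t + 1) with h | h
  · exact testRegion_mono P c h
  · induction k, h using Nat.le_induction with
    | base => exact le_rfl
    | succ k hk ih => exact (testRegion_succ_subset P c hk).trans ih

lemma continuous_law_mul {Ω Θ α : Type*} [Fintype Ω] [TopologicalSpace Θ] {q : Θ → Ω → ℝ}
    (hq : ∀ ω, Continuous fun θ => q θ ω) (f : Ω → α) (a : α) :
    Continuous fun θ => law (q θ) f a := by
  classical
  simp only [law_apply]
  refine continuous_finsetSum _ fun ω _ => ?_
  split_ifs
  · exact hq ω
  · exact continuous_const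

lemma continuous_mutualInfo {Ω Θ α β : Type*} [Fintype Ω] [Fintype α] [Fintype β]
    [TopologicalSpace Θ] {q : Θ → Ω → ℝ} (hq : ∀ ω, Continuous fun θ => q θ ω) (f : Ω → α)
    (g : Ω → β) : Continuous fun θ => mutualInfo (q θ) f g := by
  unfold mutualInfo entropy
  exact ((continuous_finsetSum _ fun a _ =>
      Real.continuous_negMulLog.comp (continuous_law_mul hq f a)).add
    (continuous_finsetSum _ fun a _ =>
      Real.continuous_negMulLog.comp (continuous_law_mul hq g a))).sub
    (continuous_finsetSum _ fun a _ =>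
      Real.continuous_negMulLog.comp (continuous_law_mul hq _ a))

lemma isClosed_testRegion (P : 𝒳 × 𝒳t × 𝒴 → ℝ) (c : ℝ) (k : ℕ) :
    IsClosed (testRegion P c k) := by
  set K : Set (𝒳t → Fin k → ℝ) := Set.univ.pi fun _ => stdSimplex ℝ (Fin k) with hK
  have hKc : IsCompact K := isCompact_univ_pi fun _ => isCompact_stdSimplex ℝ (Fin k)
  have : CompactSpace K := isCompact_iff_compactSpace.1 hKc
  have hc : ∀ ω, Continuous fun V : K => auxJoint P V.1 ω := by
    intro ω
    unfold auxJoint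
    have : Continuous fun V : K => V.1 ω.2.2.1 ω.1 :=
      (continuous_apply_apply ω.2.2.1 ω.1).comp continuous_subtype_val
    exact continuous_const.mul this
  have hY : Continuous fun V : K => infoUY P V.1 := continuous_mutualInfo hc _ _
  have hX : Continuous fun V : K => infoUXt P V.1 := continuous_mutualInfo hc _ _
  let C : Set (K × (ℝ × ℝ × ℝ)) := {q | 0 ≤ q.2.1 ∧ q.2.1 ≤ infoUY P q.1.1 ∧ 0 ≤ q.2.2.1 ∧
    infoUXt P q.1.1 - c * infoUY P q.1.1 ≤ q.2.2.2}
  have hC : IsClosed C := by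
    have hY' : Continuous fun q : K × (ℝ × ℝ × ℝ) => infoUY P q.1.1 := hY.comp continuous_fst
    have hX' : Continuous fun q : K × (ℝ × ℝ × ℝ) => infoUXt P q.1.1 := hX.comp continuous_fst
    have h1 : Continuous fun q : K × (ℝ × ℝ × ℝ) => q.2.1 := by fun_prop
    have h2 : Continuous fun q : K × (ℝ × ℝ × ℝ) => q.2.2.1 := by fun_prop
    have h3 : Continuous fun q : K × (ℝ × ℝ × ℝ) => q.2.2.2 := by fun_prop
    exact (isClosed_le continuous_const h1).inter ((isClosed_le h1 hY').inter
      ((isClosed_le continuous_const h2).inter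
        (isClosed_le (hX'.sub (continuous_const.mul hY')) h3)))
  have himg : testRegion P c k = Prod.snd '' C := by
    ext R
    constructor
    · rintro ⟨V, hV, h⟩
      exact ⟨(⟨V, fun x _ => hV x⟩, R), h, rfl⟩
    · rintro ⟨⟨V, R'⟩, h, rfl⟩
      exact ⟨V.1, fun x => V.2 x (Set.mem_univ x), h⟩
  rw [himg]
  exact isClosedMap_snd_of_compactSpace C hC

end Regions

section ProductMass

variable {ζ β : Type*} [Fintype ζ]

/-- Mass function of `n` i.i.d. copies of a variable with mass function `P`. -/
def prodMass (P : ζ → ℝ) (n : ℕ) (ω : Fin n → ζ) : ℝ := ∏ i, P (ω i)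

lemma prodMass_mem_stdSimplex {P : ζ → ℝ} (hP : P ∈ stdSimplex ℝ ζ) (n : ℕ) :
    prodMass P n ∈ stdSimplex ℝ (Fin n → ζ) := by
  classical
  refine ⟨fun ω => Finset.prod_nonneg fun i _ => hP.1 _, ?_⟩
  unfold prodMass
  rw [← Fintype.sum_pow, hP.2, one_pow]

lemma law_prodMass [Fintype β] (P : ζ → ℝ) (n : ℕ) (f : ζ → β) :
    law (prodMass P n) (fun ω i => f (ω i)) = prodMass (law P f) n := by
  classical
  funext b
  simp only [law_apply, prodMass]
  rw [Finset.prod_univ_sum, Fintype.piFinset_univ]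
  refine Finset.sum_congr rfl fun ω _ => ?_
  by_cases h : (fun i => f (ω i)) = b
  · simp [← h]
  · rw [if_neg h]
    obtain ⟨i, hi⟩ := Function.ne_iff.1 h
    exact (Finset.prod_eq_zero (Finset.mem_univ i) (by simp [hi])).symm

end ProductMass

section Transport

variable {𝒵 𝒵' ξ ξ' 𝒰 β β' : Type*} [Fintype 𝒵] [Fintype 𝒵'] [Fintype 𝒰] [Fintype β] [Fintype β']

lemma kernelInfo_equiv (e : 𝒵' ≃ 𝒵) {P : 𝒵 → ℝ} {P' : 𝒵' → ℝ} {x : 𝒵 → ξ} {x' : 𝒵' → ξ'}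
    {V : ξ → 𝒰 → ℝ} {V' : ξ' → 𝒰 → ℝ} {f : 𝒵 → β} {f' : 𝒵' → β'} (hP : ∀ z, P' z = P (e z))
    (hV : ∀ z u, V' (x' z) u = V (x (e z)) u)
    (hf : ∀ z z', f' z = f' z' ↔ f (e z) = f (e z')) :
    kernelInfo P' x' V' f' = kernelInfo P x V f := by
  classical
  have h : law (kernelJoint P' x' V') (fun ω => (ω.1, e ω.2)) = kernelJoint P x V := by
    funext ⟨u, z⟩
    rw [law_kernelJoint_pair P' x' V' e, law_apply, Finset.sum_eq_single (e.symm z)]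
    · simp [kernelJoint, hP, hV]
    · intro z' _ hz'
      rw [if_neg]
      rintro rfl
      simp at hz'
    · simp
  unfold kernelInfo mutualInfo
  rw [← h]
  simp only [entropy_law]
  rw [entropy_congr _ (f := fun ω : 𝒰 × 𝒵' => f' ω.2) (g := fun ω => f (e ω.2)) fun ω ω' => hf _ _,
    entropy_congr _ (f := fun ω : 𝒰 × 𝒵' => (ω.1, f' ω.2)) (g := fun ω => (ω.1, f (e ω.2)))]
  intro ω ω'
  simp [hf]

end Transport

section TwoSources

variable {𝒵₁ 𝒵₂ ξ₁ ξ₂ α β₁ β₂ : Type*} [Fintype 𝒵₁] [Fintype 𝒵₂] [Fintype α]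

/-- The channel from the second of two independent sources, the first being averaged out. -/
noncomputable def averageKernel (P₁ : 𝒵₁ → ℝ) (x₁ : 𝒵₁ → ξ₁) (T : ξ₁ × ξ₂ → α → ℝ) (a₂ : ξ₂)
    (a : α) : ℝ := ∑ z₁, P₁ z₁ * T (x₁ z₁, a₂) a

/-- The channel from the first of two independent sources whose output contains in addition the
side information `y₂` on the second source. -/
noncomputable def sideInfoKernel (P₂ : 𝒵₂ → ℝ) (x₂ : 𝒵₂ → ξ₂) (y₂ : 𝒵₂ → β₂) (T : ξ₁ × ξ₂ → α → ℝ)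
    (a₁ : ξ₁) (ab : α × β₂) : ℝ := law (fun z₂ => P₂ z₂ * T (a₁, x₂ z₂) ab.1) y₂ ab.2

lemma averageKernel_mem_stdSimplex {P₁ : 𝒵₁ → ℝ} (hP₁ : P₁ ∈ stdSimplex ℝ 𝒵₁) (x₁ : 𝒵₁ → ξ₁)
    {T : ξ₁ × ξ₂ → α → ℝ} (hT : ∀ a, T a ∈ stdSimplex ℝ α) (a₂ : ξ₂) :
    averageKernel P₁ x₁ T a₂ ∈ stdSimplex ℝ α := by
  refine ⟨fun a => Finset.sum_nonneg fun z _ => mul_nonneg (hP₁.1 z) ((hT _).1 a), ?_⟩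
  unfold averageKernel
  rw [Finset.sum_comm]
  simp only [← Finset.mul_sum, (hT _).2, mul_one, hP₁.2]

lemma sideInfoKernel_mem_stdSimplex [Fintype β₂] {P₂ : 𝒵₂ → ℝ}
    (hP₂ : P₂ ∈ stdSimplex ℝ 𝒵₂) (x₂ : 𝒵₂ → ξ₂)
    (y₂ : 𝒵₂ → β₂) {T : ξ₁ × ξ₂ → α → ℝ} (hT : ∀ a, T a ∈ stdSimplex ℝ α) (a₁ : ξ₁) :
    sideInfoKernel P₂ x₂ y₂ T a₁ ∈ stdSimplex ℝ (α × β₂) := by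
  refine ⟨fun a => law_nonneg (fun z => mul_nonneg (hP₂.1 z) ((hT _).1 _)) _ _, ?_⟩
  unfold sideInfoKernel
  rw [Fintype.sum_prod_type]
  simp only [sum_law]
  rw [Finset.sum_comm]
  simp only [← Finset.mul_sum, (hT _).2, mul_one, hP₂.2]

lemma law_mul_pair (P₁ : 𝒵₁ → ℝ) (P₂ : 𝒵₂ → ℝ) (g₁ : 𝒵₁ → β₁) (g₂ : 𝒵₂ → β₂) (b₁ : β₁) (b₂ : β₂) :
    law (fun z : 𝒵₁ × 𝒵₂ => P₁ z.1 * P₂ z.2) (fun z => (g₁ z.1, g₂ z.2)) (b₁, b₂) =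
      law P₁ g₁ b₁ * law P₂ g₂ b₂ := by
  classical
  rw [law_apply, law_apply, law_apply, Fintype.sum_prod_type, Finset.sum_mul]
  refine Finset.sum_congr rfl fun z₁ _ => ?_
  rw [Finset.mul_sum]
  refine Finset.sum_congr rfl fun z₂ _ => ?_
  by_cases h₁ : g₁ z₁ = b₁ <;> by_cases h₂ : g₂ z₂ = b₂ <;> simp [h₁, h₂]

lemma mul_mem_stdSimplex {P₁ : 𝒵₁ → ℝ} (hP₁ : P₁ ∈ stdSimplex ℝ 𝒵₁) {P₂ : 𝒵₂ → ℝ}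
    (hP₂ : P₂ ∈ stdSimplex ℝ 𝒵₂) :
    (fun z : 𝒵₁ × 𝒵₂ => P₁ z.1 * P₂ z.2) ∈ stdSimplex ℝ (𝒵₁ × 𝒵₂) := by
  refine ⟨fun z => mul_nonneg (hP₁.1 _) (hP₂.1 _), ?_⟩
  rw [Fintype.sum_prod_type]
  simp [← Finset.mul_sum, hP₁.2, hP₂.2]

lemma law_mul_fst (P₁ : 𝒵₁ → ℝ) {P₂ : 𝒵₂ → ℝ} (hP₂ : ∑ z, P₂ z = 1) (g : 𝒵₁ → β₁) :
    law (fun z : 𝒵₁ × 𝒵₂ => P₁ z.1 * P₂ z.2) (fun z => g z.1) = law P₁ g := by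
  funext b
  have := law_mul_pair P₁ P₂ g (fun _ => ()) b ()
  rwa [law_const, hP₂, mul_one, law_congr_of_iff (g := fun z => g z.1) (b := b) _ (by simp)] at this

lemma law_mul_snd {P₁ : 𝒵₁ → ℝ} (hP₁ : ∑ z, P₁ z = 1) (P₂ : 𝒵₂ → ℝ) (g : 𝒵₂ → β₂) :
    law (fun z : 𝒵₁ × 𝒵₂ => P₁ z.1 * P₂ z.2) (fun z => g z.2) = law P₂ g := by
  funext b
  have := law_mul_pair P₁ P₂ (fun _ => ()) g () b
  rwa [law_const, hP₁, one_mul, law_congr_of_iff (g := fun z => g z.2) (b := b) _ (by simp)] at this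

lemma entropy_mul_pair [Fintype β₁] [Fintype β₂] {P₁ : 𝒵₁ → ℝ}
    (hP₁ : P₁ ∈ stdSimplex ℝ 𝒵₁) {P₂ : 𝒵₂ → ℝ} (hP₂ : P₂ ∈ stdSimplex ℝ 𝒵₂) (g₁ : 𝒵₁ → β₁) (g₂ : 𝒵₂ → β₂) :
    entropy (fun z : 𝒵₁ × 𝒵₂ => P₁ z.1 * P₂ z.2) (fun z => (g₁ z.1, g₂ z.2)) =
      entropy P₁ g₁ + entropy P₂ g₂ := by
  rw [entropy_pair_of_indep (mul_mem_stdSimplex hP₁ hP₂)]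
  · unfold entropy
    rw [law_mul_fst _ hP₂.2, law_mul_snd hP₁.2]
  · intro a b
    rw [law_mul_pair, law_mul_fst _ hP₂.2, law_mul_snd hP₁.2]

lemma law_kernelJoint_mul (P₁ : 𝒵₁ → ℝ) (P₂ : 𝒵₂ → ℝ) (x₁ : 𝒵₁ → ξ₁) (x₂ : 𝒵₂ → ξ₂)
    (T : ξ₁ × ξ₂ → α → ℝ) (g : 𝒵₂ → β₂) (a : α) (a₁ : ξ₁) (a₂ : ξ₂) (b : β₂) :
    law (kernelJoint (fun z : 𝒵₁ × 𝒵₂ => P₁ z.1 * P₂ z.2) (fun z => (x₁ z.1, x₂ z.2)) T)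
        (fun ω => (ω.1, x₁ ω.2.1, g ω.2.2, x₂ ω.2.2)) (a, a₁, b, a₂) =
      T (a₁, a₂) a * (law P₁ x₁ a₁ * law P₂ (fun z => (g z, x₂ z)) (b, a₂)) := by
  classical
  rw [law_kernelJoint_pair (fun z : 𝒵₁ × 𝒵₂ => P₁ z.1 * P₂ z.2) _ T
    (fun z => (x₁ z.1, g z.2, x₂ z.2))]
  simp only [law_apply]
  rw [Fintype.sum_prod_type, Finset.sum_mul, Finset.mul_sum]
  refine Finset.sum_congr rfl fun z₁ _ => ?_
  rw [Finset.mul_sum, Finset.mul_sum]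
  refine Finset.sum_congr rfl fun z₂ _ => ?_
  by_cases h₁ : x₁ z₁ = a₁ <;> by_cases h₂ : x₂ z₂ = a₂ <;> by_cases h₃ : g z₂ = b <;>
    simp [h₁, h₂, h₃]
  ring

/-- Chain rules for a channel with two independent source components. -/
lemma kernelInfo_two_sources [Fintype ξ₁] [Fintype ξ₂] [Fintype β₁] [Fintype β₂] {P₁ : 𝒵₁ → ℝ}
    (hP₁ : P₁ ∈ stdSimplex ℝ 𝒵₁) {P₂ : 𝒵₂ → ℝ}
    (hP₂ : P₂ ∈ stdSimplex ℝ 𝒵₂) (x₁ : 𝒵₁ → ξ₁) (x₂ : 𝒵₂ → ξ₂) (y₁ : 𝒵₁ → β₁) (y₂ : 𝒵₂ → β₂)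
    {T : ξ₁ × ξ₂ → α → ℝ} (hT : ∀ a, T a ∈ stdSimplex ℝ α) :
    kernelInfo (fun z : 𝒵₁ × 𝒵₂ => P₁ z.1 * P₂ z.2) (fun z => (x₁ z.1, x₂ z.2)) T
        (fun z => (y₁ z.1, y₂ z.2)) =
      kernelInfo P₂ x₂ (averageKernel P₁ x₁ T) y₂ +
        kernelInfo P₁ x₁ (sideInfoKernel P₂ x₂ y₂ T) y₁ ∧
    kernelInfo P₂ x₂ (averageKernel P₁ x₁ T) x₂ +
        kernelInfo P₁ x₁ (sideInfoKernel P₂ x₂ y₂ T) x₁ ≤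
      kernelInfo (fun z : 𝒵₁ × 𝒵₂ => P₁ z.1 * P₂ z.2) (fun z => (x₁ z.1, x₂ z.2)) T
        (fun z => (x₁ z.1, x₂ z.2)) := by
  classical
  set P : 𝒵₁ × 𝒵₂ → ℝ := fun z => P₁ z.1 * P₂ z.2 with hPdef
  have hP : P ∈ stdSimplex ℝ (𝒵₁ × 𝒵₂) := mul_mem_stdSimplex hP₁ hP₂
  set p := kernelJoint P (fun z => (x₁ z.1, x₂ z.2)) T with hpdef
  have hp : p ∈ stdSimplex ℝ _ := kernelJoint_mem_stdSimplex hP _ hT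
  have hlaw₂ : law p (fun ω => (ω.1, ω.2.2)) = kernelJoint P₂ x₂ (averageKernel P₁ x₁ T) := by
    funext ⟨a, z₂⟩
    rw [hpdef, law_kernelJoint_pair P _ T (fun z => z.2), law_apply, Fintype.sum_prod_type]
    simp only [Finset.sum_ite_eq', Finset.mem_univ, if_true, kernelJoint, averageKernel,
      Finset.mul_sum, hPdef]
    exact Finset.sum_congr rfl fun z _ => by ring
  have hlaw₁ : law p (fun ω => ((ω.1, y₂ ω.2.2), ω.2.1)) =
      kernelJoint P₁ x₁ (sideInfoKernel P₂ x₂ y₂ T) := by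
    funext ⟨⟨a, b⟩, z₁⟩
    rw [law_congr_of_iff (g := fun ω => (ω.1, y₂ ω.2.2, ω.2.1)) (b := (a, b, z₁)) p
      (by intro ω; simp [and_assoc]), hpdef,
      law_kernelJoint_pair P _ T (fun z => (y₂ z.2, z.1)), law_apply, Fintype.sum_prod_type]
    rw [Finset.sum_eq_single z₁ (by intro z _ hz; simp [hz]) (by simp)]
    simp only [kernelJoint, sideInfoKernel, law_apply, Finset.mul_sum, hPdef, Prod.mk.injEq,
      and_true]
    refine Finset.sum_congr rfl fun z _ => ?_
    split_ifs <;> ring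
  have hmarkov : IsMarkovChain p (fun ω => y₂ ω.2.2) (fun ω => x₂ ω.2.2)
      (fun ω => (ω.1, x₁ ω.2.1)) := by
    rintro b a₂ ⟨a, a₁⟩
    have h1 : law p (fun ω => x₂ ω.2.2) a₂ = law P₂ x₂ a₂ := by
      rw [hpdef, law_kernelJoint_snd P _ (fun a => (hT a).2) (fun z => x₂ z.2),
        law_mul_snd hP₁.2]
    have h2 : law p (fun ω => (y₂ ω.2.2, x₂ ω.2.2)) (b, a₂) =
        law P₂ (fun z => (y₂ z, x₂ z)) (b, a₂) := by
      rw [hpdef, law_kernelJoint_snd P _ (fun a => (hT a).2) (fun z => (y₂ z.2, x₂ z.2)),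
        law_mul_snd hP₁.2 P₂ (fun z => (y₂ z, x₂ z))]
    rw [h1, h2, law_congr_of_iff (g := fun ω => (ω.1, x₁ ω.2.1, y₂ ω.2.2, x₂ ω.2.2))
        (b := (a, a₁, b, a₂)) p (by intro ω; simp; tauto),
      law_congr_of_iff (f := fun ω => (x₂ ω.2.2, ω.1, x₁ ω.2.1))
        (g := fun ω => (ω.1, x₁ ω.2.1, (), x₂ ω.2.2)) (b := (a, a₁, (), a₂)) p
        (by intro ω; simp; tauto),
      law_kernelJoint_mul, law_kernelJoint_mul P₁ P₂ x₁ x₂ T (fun _ => ()),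
      law_congr_of_iff (f := fun z => ((), x₂ z)) (g := x₂) (b := a₂) P₂ (by simp)]
    ring
  have e1 : entropy p (fun ω => (y₁ ω.2.1, y₂ ω.2.2)) =
      entropy p (fun ω => y₁ ω.2.1) + entropy p (fun ω => y₂ ω.2.2) := by
    refine entropy_pair_of_indep hp fun b₁ b₂ => ?_
    rw [hpdef, law_kernelJoint_snd P _ (fun a => (hT a).2) (fun z => (y₁ z.1, y₂ z.2)),
      law_kernelJoint_snd P _ (fun a => (hT a).2) (fun z => y₁ z.1),
      law_kernelJoint_snd P _ (fun a => (hT a).2) (fun z => y₂ z.2),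
      law_mul_pair, law_mul_fst _ hP₂.2, law_mul_snd hP₁.2]
  have e2 : entropy p (fun ω => (x₁ ω.2.1, x₂ ω.2.2)) =
      entropy p (fun ω => x₁ ω.2.1) + entropy p (fun ω => x₂ ω.2.2) := by
    refine entropy_pair_of_indep hp fun b₁ b₂ => ?_
    rw [hpdef, law_kernelJoint_snd P _ (fun a => (hT a).2) (fun z => (x₁ z.1, x₂ z.2)),
      law_kernelJoint_snd P _ (fun a => (hT a).2) (fun z => x₁ z.1),
      law_kernelJoint_snd P _ (fun a => (hT a).2) (fun z => x₂ z.2),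
      law_mul_pair, law_mul_fst _ hP₂.2, law_mul_snd hP₁.2]
  simp only [kernelInfo, ← hlaw₁, ← hlaw₂, ← hpdef, mutualInfo_law]
  unfold mutualInfo
  refine ⟨?_, ?_⟩
  · rw [e1, entropy_congr p (f := fun ω => (ω.1, y₁ ω.2.1, y₂ ω.2.2))
      (g := fun ω => ((ω.1, y₂ ω.2.2), y₁ ω.2.1)) (by simp; tauto)]
    ring
  · have m1 := hmarkov.entropy_eq hp
    have m2 : IsMarkovChain p (fun ω => y₂ ω.2.2) (fun ω => x₂ ω.2.2) (fun ω => ω.1) := by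
      intro b a₂ a
      have := Finset.sum_congr rfl fun a₁ (_ : a₁ ∈ Finset.univ) => hmarkov b a₂ (a, a₁)
      rw [← Finset.sum_mul, ← Finset.mul_sum] at this
      convert this using 2
      · rw [← sum_law_pair p (fun ω => (y₂ ω.2.2, x₂ ω.2.2, ω.1)) (fun ω => x₁ ω.2.1)]
        exact Finset.sum_congr rfl fun a₁ _ => law_congr_of_iff p (by intro ω; simp; tauto)
      · rw [← sum_law_pair p (fun ω => (x₂ ω.2.2, ω.1)) (fun ω => x₁ ω.2.1)]
        exact Finset.sum_congr rfl fun a₁ _ => law_congr_of_iff p (by intro ω; simp; tauto)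
    have m3 := m2.entropy_eq hp
    have m4 := entropy_submodular hp (fun ω => x₁ ω.2.1) (fun ω => x₂ ω.2.2)
      (fun ω => (ω.1, y₂ ω.2.2))
    rw [entropy_congr p (f := fun ω => (x₁ ω.2.1, x₂ ω.2.2, ω.1, y₂ ω.2.2))
        (g := fun ω => (y₂ ω.2.2, x₂ ω.2.2, ω.1, x₁ ω.2.1)) (by simp; tauto),
      entropy_congr p (f := fun ω => (x₁ ω.2.1, ω.1, y₂ ω.2.2))
        (g := fun ω => ((ω.1, y₂ ω.2.2), x₁ ω.2.1)) (by simp; tauto),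
      entropy_congr p (f := fun ω => (x₂ ω.2.2, ω.1, y₂ ω.2.2))
        (g := fun ω => (y₂ ω.2.2, x₂ ω.2.2, ω.1)) (by simp; tauto)] at m4
    rw [entropy_congr p (f := fun ω => (x₂ ω.2.2, ω.1, x₁ ω.2.1))
        (g := fun ω => (ω.1, x₁ ω.2.1, x₂ ω.2.2)) (by simp; tauto)] at m1
    rw [entropy_congr p (f := fun ω => (x₂ ω.2.2, ω.1))
        (g := fun ω => (ω.1, x₂ ω.2.2)) (by simp; tauto)] at m3
    linarith

end TwoSources

section SingleLetter

variable {𝒵 ξ β : Type*} [Fintype 𝒵]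

lemma kernelInfo_prodMass_succ (P : 𝒵 → ℝ) (x : 𝒵 → ξ) {α : Type*} [Fintype α] {n : ℕ}
    (T : (Fin (n + 1) → ξ) → α → ℝ) {κ : Type*} [Fintype κ] (f : 𝒵 → κ) :
    kernelInfo (fun z : 𝒵 × (Fin n → 𝒵) => P z.1 * prodMass P n z.2)
      (fun z => (x z.1, fun i => x (z.2 i))) (fun a => T (Fin.cons a.1 a.2))
      (fun z => (f z.1, fun i => f (z.2 i))) =
    kernelInfo (prodMass P (n + 1)) (fun z i => x (z i)) T (fun z i => f (z i)) := by
  have hcons : ∀ {κ : Type _} (f : 𝒵 → κ) (z : 𝒵 × (Fin n → 𝒵)),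
      (fun i => f ((Fin.consEquiv (fun _ => 𝒵)) z i)) =
        (Fin.cons (f z.1) (fun i => f (z.2 i)) : Fin (n + 1) → κ) := by
    intro κ f z
    funext i
    refine Fin.cases ?_ (fun j => ?_) i <;> simp [Fin.consEquiv]
  refine kernelInfo_equiv (Fin.consEquiv (fun _ => 𝒵)) ?_ ?_ ?_
  · intro z
    simp [prodMass, Fin.prod_univ_succ, Fin.consEquiv]
  · intro z u
    refine congrArg (fun a => T a u) ?_
    funext i
    refine Fin.cases ?_ (fun j => ?_) i <;> simp [Fin.consEquiv]
  · intro z z'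
    rw [hcons, hcons, Fin.cons_inj, Prod.mk.injEq]

/-- Single-letterization: every channel from the `n`-letter source is dominated by a test channel
on a single letter. -/
lemma exists_single_letter_kernel [Fintype ξ] [Fintype β] {P : 𝒵 → ℝ}
    (hP : P ∈ stdSimplex ℝ 𝒵) (x : 𝒵 → ξ) (y : 𝒵 → β) {α : Type*} [Fintype α] :
    ∀ (n : ℕ) (T : (Fin n → ξ) → α → ℝ),
    (∀ a, T a ∈ stdSimplex ℝ α) →
    ∃ (k : ℕ) (V : ξ → Fin k → ℝ), (∀ a, V a ∈ stdSimplex ℝ (Fin k)) ∧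
      n * kernelInfo P x V y =
        kernelInfo (prodMass P n) (fun z i => x (z i)) T (fun z i => y (z i)) ∧
      n * kernelInfo P x V x ≤
        kernelInfo (prodMass P n) (fun z i => x (z i)) T (fun z i => x (z i)) := by
  intro n
  induction n with
  | zero =>
    intro T hT
    have hp := kernelJoint_mem_stdSimplex (prodMass_mem_stdSimplex hP 0) (fun z i => x (z i)) hT
    refine ⟨1, fun _ _ => 1, fun a => ⟨by simp, by simp⟩, ?_, ?_⟩
    · simp only [kernelInfo, mutualInfo]
      rw [entropy_congr _ (f := fun ω : α × (Fin 0 → 𝒵) => fun i => y (ω.2 i)) (g := fun _ => ())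
        (by simp [Subsingleton.elim (α := Fin 0 → β) _ (fun i => i.elim0)]), entropy_const hp,
        entropy_congr _ (f := fun ω : α × (Fin 0 → 𝒵) => (ω.1, fun i => y (ω.2 i)))
          (g := fun ω => ω.1) (by
            simp [Subsingleton.elim (α := Fin 0 → β) _ (fun i => i.elim0)])]
      simp
    · simp only [Nat.cast_zero, zero_mul]
      exact mutualInfo_nonneg hp _ _
  | succ n ih =>
    intro T hT
    let T' : ξ × (Fin n → ξ) → α → ℝ := fun a => T (Fin.cons a.1 a.2)
    have hT' : ∀ a, T' a ∈ stdSimplex ℝ α := fun a => hT _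
    have hPn := prodMass_mem_stdSimplex hP n
    obtain ⟨h1, h2⟩ := kernelInfo_two_sources hP hPn x (fun z i => x (z i)) y
      (fun z i => y (z i)) hT'
    have hA := averageKernel_mem_stdSimplex hP x hT'
    have hS := sideInfoKernel_mem_stdSimplex hPn (fun z i => x (z i)) (fun z i => y (z i)) hT'
    obtain ⟨k, V, hV, hVy, hVx⟩ := ih _ hA
    set V₁ := sideInfoKernel (prodMass P n) (fun z i => x (z i)) (fun z i => y (z i)) T' with hV₁
    rw [kernelInfo_prodMass_succ P x T y] at h1
    rw [kernelInfo_prodMass_succ P x T x] at h2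
    have hn : (0 : ℝ) < n + 1 := by positivity
    have ht0 : (0 : ℝ) ≤ n / (n + 1) := by positivity
    have ht1 : (n : ℝ) / (n + 1) ≤ 1 := by rw [div_le_one hn]; linarith
    have hmix := mixKernel_mem_stdSimplex ht0 ht1 hV hS
    let e := (Fintype.equivFin (Fin k ⊕ (α × (Fin n → β)))).symm
    have key : ∀ a b : ℝ, ((n + 1 : ℕ) : ℝ) * (n / (n + 1) * a + (1 - n / (n + 1)) * b) =
        n * a + b := by
      intro a b
      push_cast
      field_simp
      ring
    refine ⟨_, fun a u => mixKernel (n / (n + 1)) V V₁ a (e u), fun a => ⟨fun u => (hmix a).1 _,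
      (e.sum_comp _).trans (hmix a).2⟩, ?_, ?_⟩
    · rw [kernelInfo_reindex P x (fun a => (hmix a).2), kernelInfo_mixKernel P x ht0 ht1 hV hS,
        key, hVy, h1]
    · rw [kernelInfo_reindex P x (fun a => (hmix a).2), kernelInfo_mixKernel P x ht0 ht1 hV hS, key]
      linarith

end SingleLetter

section Converse

variable {𝒳 𝒳t 𝒴 : Type*} [Fintype 𝒳] [Fintype 𝒳t] [Fintype 𝒴]

lemma iid_mem_stdSimplex {P : 𝒳 × 𝒳t × 𝒴 → ℝ} (hP : P ∈ stdSimplex ℝ (𝒳 × 𝒳t × 𝒴)) (n : ℕ) :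
    iid P n ∈ stdSimplex ℝ (Fin n → 𝒳 × 𝒳t × 𝒴) :=
  prodMass_mem_stdSimplex hP n

/-- The loss in the converse bounds at tolerance `δ` and key rate `r`. -/
noncomputable def converseLoss (r δ : ℝ) : ℝ := 2 * δ + Real.binEntropy δ + δ * r

/-- A code that meets the constraints with tolerance `δ` has a rate tuple close to the region. -/
lemma MeetsConstraints.mem_testRegion {P : 𝒳 × 𝒳t × 𝒴 → ℝ}
    (hP : P ∈ stdSimplex ℝ (𝒳 × 𝒳t × 𝒴)) {Ω : Type*} [Fintype Ω] {p : Ω → ℝ}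
    (hp : p ∈ stdSimplex ℝ Ω) {n s w : ℕ} (hn : 1 ≤ n) {S : Ω → Fin s} {W : Ω → Fin w}
    {Z : Ω → Fin n → 𝒳 × 𝒳t × 𝒴} {T : (Fin n → 𝒳t) → Fin s × Fin w → ℝ}
    (hT : ∀ a, T a ∈ stdSimplex ℝ (Fin s × Fin w))
    (hlaw : law p (fun ω => ((S ω, W ω), Z ω)) = kernelJoint (iid P n) seqXt T)
    {dec : Fin w × (Fin n → 𝒴) → Fin s} {R : ℝ × ℝ × ℝ} {δ : ℝ} (hδ : 0 < δ) (hδ' : δ ≤ 1 / 2)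
    (H : MeetsConstraints p S (fun ω => dec (W ω, seqY (Z ω))) W (fun ω => seqX (Z ω)) R δ)
    {c : ℝ} (hc0 : 0 ≤ c) (hc1 : c ≤ 1)
    (hstore : mutualInfo p (fun ω => (S ω, W ω)) (fun ω => seqXt (Z ω)) -
        c * mutualInfo p (fun ω => (S ω, W ω)) (fun ω => seqY (Z ω)) ≤
      entropy p W + c * (entropy p (fun ω => (S ω, W ω, seqY (Z ω))) -
        entropy p (fun ω => (W ω, seqY (Z ω))))) :
    0 ≤ R.1 ∧ (max 0 (R.1 - converseLoss R.1 δ), R.2.1 + δ, R.2.2 + converseLoss R.1 δ) ∈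
      testRegion P c (Fintype.card 𝒳t + 1) := by
  obtain ⟨k, V, hV, hVy, hVx⟩ := exists_single_letter_kernel hP (fun z => z.2.1)
    (fun z => z.2.2) n T hT
  have hΩ : Nonempty Ω := by
    by_contra hne
    rw [not_nonempty_iff] at hne
    simpa using hp.2
  have hw : Nonempty (Fin w) := ⟨W hΩ.some⟩
  have hIY : n * infoUY P V = mutualInfo p (fun ω => (S ω, W ω)) (fun ω => seqY (Z ω)) := by
    rw [infoUY_eq, hVy, kernelInfo]
    change mutualInfo (kernelJoint (iid P n) seqXt T) (fun ω => ω.1) (fun ω => seqY ω.2) = _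
    rw [← hlaw, mutualInfo_law]
  have hIX : n * infoUXt P V ≤ mutualInfo p (fun ω => (S ω, W ω)) (fun ω => seqXt (Z ω)) := by
    refine hVx.trans (le_of_eq ?_)
    rw [kernelInfo]
    change mutualInfo (kernelJoint (iid P n) seqXt T) (fun ω => ω.1) (fun ω => seqXt ω.2) = _
    rw [← hlaw, mutualInfo_law]
  have hn' : (1 : ℝ) ≤ n := by exact_mod_cast hn
  have hn0 : (0 : ℝ) < n := by linarith
  have hlogs : Real.log s = n * R.1 := by rw [H.key_rate]; field_simp
  have hR0 : 0 ≤ R.1 := by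
    rw [H.key_rate]
    exact div_nonneg (Real.log_natCast_nonneg s) hn0.le
  have hfano := fano hp S (fun ω => (W ω, seqY (Z ω))) dec
  rw [Fintype.card_fin, hlogs] at hfano
  have hb0 : 0 ≤ Real.binEntropy δ := Real.binEntropy_nonneg hδ.le (by linarith)
  have hfano' : entropy p (fun ω => (S ω, W ω, seqY (Z ω))) -
      entropy p (fun ω => (W ω, seqY (Z ω))) ≤ n * (Real.binEntropy δ + δ * R.1) := by
    have h1 := H.reliability
    have h2 := prob_nonneg hp.1 (fun ω => S ω ≠ dec (W ω, seqY (Z ω)))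
    have h3 := Real.binEntropy_strictMonoOn.monotoneOn (a := prob p fun ω =>
      S ω ≠ dec (W ω, seqY (Z ω))) (b := δ) ⟨h2, by norm_num; linarith⟩
      ⟨hδ.le, by norm_num; linarith⟩ h1
    have h4 := mul_le_mul_of_nonneg_right h1 (mul_nonneg hn0.le hR0)
    nlinarith
  have hWY := mutualInfo_nonneg hp W (fun ω => seqY (Z ω))
  have hkey : R.1 ≤ infoUY P V + converseLoss R.1 δ := by
    have h1 := H.uniformity
    have h2 := H.secrecy
    rw [ge_iff_le, one_div, ← div_eq_inv_mul, le_div_iff₀ hn0] at h1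
    have h3 : n * R.1 ≤ n * (infoUY P V + converseLoss R.1 δ) := by
      rw [mul_add, hIY, converseLoss]
      unfold mutualInfo at h2 hWY ⊢
      rw [entropy_congr p (f := fun ω => ((S ω, W ω), seqY (Z ω)))
        (g := fun ω => (S ω, W ω, seqY (Z ω))) (by simp; tauto)]
      nlinarith
    exact le_of_mul_le_mul_left h3 hn0
  have hst : infoUXt P V - c * infoUY P V ≤ R.2.2 + converseLoss R.1 δ := by
    have h1 := H.storage
    have h2 := entropy_le_log_card hp W
    rw [Fintype.card_fin] at h2
    rw [one_div, ← div_eq_inv_mul, div_le_iff₀ hn0] at h1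
    have h3 : n * (infoUXt P V - c * infoUY P V) ≤ n * (R.2.2 + converseLoss R.1 δ) := by
      have h4 : n * (infoUXt P V - c * infoUY P V) = n * infoUXt P V - c * (n * infoUY P V) := by
        ring
      have hF0 : 0 ≤ n * (Real.binEntropy δ + δ * R.1) := by positivity
      have h5 := mul_le_mul_of_nonneg_left hfano' hc0
      have h6 := mul_le_mul_of_nonneg_right hc1 hF0
      have h7 : 0 < n * δ := by positivity
      rw [h4, hIY, converseLoss]
      nlinarith
    exact le_of_mul_le_mul_left h3 hn0
  have hleak : 0 ≤ R.2.1 + δ :=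
    (mul_nonneg (by positivity) (mutualInfo_nonneg hp _ W)).trans H.privacy
  refine ⟨hR0, testRegion_subset P c k ⟨V, hV, le_max_left _ _, max_le ?_ ?_, hleak, hst⟩⟩
  · exact mutualInfo_nonneg (auxJoint_mem_stdSimplex hP hV) _ _
  · linarith

lemma mem_testRegion_of_forall_loss {P : 𝒳 × 𝒳t × 𝒴 → ℝ} {c : ℝ} {k : ℕ} {R : ℝ × ℝ × ℝ}
    (h : ∀ δ : ℝ, 0 < δ → δ ≤ 1 / 2 → 0 ≤ R.1 ∧
      (max 0 (R.1 - converseLoss R.1 δ), R.2.1 + δ, R.2.2 + converseLoss R.1 δ) ∈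
        testRegion P c k) : R ∈ testRegion P c k := by
  have hR0 := (h (1 / 2) (by norm_num) le_rfl).1
  have hloss : Continuous (converseLoss R.1) := by
    unfold converseLoss
    have := Real.binEntropy_continuous
    fun_prop
  have hcont : Continuous fun δ : ℝ =>
      (max 0 (R.1 - converseLoss R.1 δ), R.2.1 + δ, R.2.2 + converseLoss R.1 δ) := by
    fun_prop
  have hlim := (hcont.tendsto 0).mono_left (nhdsWithin_le_nhds (s := Set.Ioi 0))
  have h0 : converseLoss R.1 0 = 0 := by simp [converseLoss]
  simp only [h0, sub_zero, add_zero, max_eq_right hR0] at hlim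
  refine (isClosed_testRegion P c k).mem_of_tendsto hlim ?_
  have : Set.Ioc (0 : ℝ) (1 / 2) ∈ nhdsWithin (0 : ℝ) (Set.Ioi 0) :=
    Ioc_mem_nhdsGT (by norm_num)
  filter_upwards [this] with δ hδ using (h δ hδ.1 hδ.2).2

/-- Converse for the generated-secret model. -/
lemma GSAchievable.mem_testRegion {P : 𝒳 × 𝒳t × 𝒴 → ℝ} (hP : P ∈ stdSimplex ℝ (𝒳 × 𝒳t × 𝒴))
    {R : ℝ × ℝ × ℝ} (H : GSAchievable P R) : R ∈ testRegion P 1 (Fintype.card 𝒳t + 1) := by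
  classical
  refine mem_testRegion_of_forall_loss fun δ hδ hδ' => ?_
  obtain ⟨n, s, w, hn, enc, dec, h⟩ := H δ hδ
  have hp := iid_mem_stdSimplex hP n
  refine h.mem_testRegion (Z := fun ω => ω) hP hp hn
    (T := fun a b => if ((enc a).2, (enc a).1) = b then 1 else 0) ?_ ?_ hδ hδ' zero_le_one le_rfl ?_
  · exact fun a => ⟨fun b => by dsimp only; split_ifs <;> simp, by simp⟩
  · funext ⟨b, z⟩
    rw [law_apply, Finset.sum_eq_single z (by intro z' _ hz'; simp [hz']) (by simp)]
    simp [kernelJoint]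
  · unfold mutualInfo
    rw [entropy_congr (iid P n) (f := fun ω => (((enc (seqXt ω)).2, (enc (seqXt ω)).1), seqY ω))
      (g := fun ω => ((enc (seqXt ω)).2, (enc (seqXt ω)).1, seqY ω)) (by simp; tauto)]
    have h1 := mutualInfo_nonneg hp (fun ω => (enc (seqXt ω)).1) seqY
    have h2 : entropy (iid P n) seqXt ≤ entropy (iid P n) (fun ω =>
      (((enc (seqXt ω)).2, (enc (seqXt ω)).1), seqXt ω)) := entropy_mono hp.1 (by simp)
    unfold mutualInfo at h1
    linarith

/-- Converse for the chosen-secret model. -/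
lemma CSAchievable.mem_testRegion {P : 𝒳 × 𝒳t × 𝒴 → ℝ} (hP : P ∈ stdSimplex ℝ (𝒳 × 𝒳t × 𝒴))
    {R : ℝ × ℝ × ℝ} (H : CSAchievable P R) : R ∈ testRegion P 0 (Fintype.card 𝒳t + 1) := by
  classical
  refine mem_testRegion_of_forall_loss fun δ hδ hδ' => ?_
  obtain ⟨n, s, w, hn, PS, hPS, enc, dec, h⟩ := H δ hδ
  have hiid := iid_mem_stdSimplex hP n
  have hp := mul_mem_stdSimplex hiid hPS
  refine h.mem_testRegion (Z := fun ω => ω.1) hP hp hn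
    (T := fun a => law PS (fun k => (k, enc (a, k)))) ?_ ?_ hδ hδ' le_rfl zero_le_one ?_
  · exact fun a => law_mem_stdSimplex hPS _
  · funext ⟨b, z⟩
    rw [law_apply, Fintype.sum_prod_type,
      Finset.sum_eq_single z (by intro z' _ hz'; simp [hz']) (by simp)]
    simp only [kernelJoint, law_apply, Finset.mul_sum, Prod.mk.injEq, and_true]
    refine Finset.sum_congr rfl fun k _ => ?_
    split_ifs <;> simp
  · set p : (Fin n → 𝒳 × 𝒳t × 𝒴) × Fin s → ℝ := fun ω => iid P n ω.1 * PS ω.2 with hpdef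
    unfold mutualInfo
    have h1 := mutualInfo_nonneg hp (fun ω => ω.2) (fun ω => enc (seqXt ω.1, ω.2))
    have h2 : entropy p (fun ω => (seqXt ω.1, ω.2)) ≤ entropy p (fun ω =>
      ((ω.2, enc (seqXt ω.1, ω.2)), seqXt ω.1)) :=
      entropy_mono hp.1 (by rintro ⟨z, k⟩ ⟨z', k'⟩; simp; tauto)
    have h3 : entropy p (fun ω => (seqXt ω.1, ω.2)) =
        entropy p (fun ω => seqXt ω.1) + entropy p (fun ω => ω.2) := by
      refine entropy_pair_of_indep hp fun a b => ?_
      have := law_mul_pair (iid P n) PS seqXt (fun k => k) a b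
      rw [← law_mul_fst (iid P n) hPS.2 seqXt, ← law_mul_snd hiid.2 PS (fun k => k)] at this
      exact this
    unfold mutualInfo at h1
    linarith

end Converse

section RandomSelection

variable {ι κ : Type*} [Fintype ι] [Fintype κ]

lemma exists_le_of_average_le {μ F : κ → ℝ} (hμ : μ ∈ stdSimplex ℝ κ) {B : ℝ}
    (h : ∑ c, μ c * F c ≤ B) : ∃ c, F c ≤ B := by
  by_contra hcon
  push Not at hcon
  have h1 : ∑ c, μ c * B < ∑ c, μ c * F c := by
    obtain ⟨c, hc⟩ : ∃ c, 0 < μ c := by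
      by_contra h0
      push Not at h0
      have := Finset.sum_nonpos fun c (_ : c ∈ Finset.univ) => h0 c
      rw [hμ.2] at this
      linarith
    exact Finset.sum_lt_sum (fun c _ => mul_le_mul_of_nonneg_left (hcon c).le (hμ.1 c))
      ⟨c, Finset.mem_univ c, mul_lt_mul_of_pos_left (hcon c) hc⟩
  rw [← Finset.sum_mul, hμ.2, one_mul] at h1
  linarith

/-- Three nonnegative quantities with small averages can be made small simultaneously. -/
lemma exists_le_three_of_average_le {μ F₁ F₂ F₃ : κ → ℝ} (hμ : μ ∈ stdSimplex ℝ κ) {A B C : ℝ}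
    (hA0 : 0 < A) (hB0 : 0 < B) (hC0 : 0 < C) (hF₁ : ∀ c, 0 ≤ F₁ c) (hF₂ : ∀ c, 0 ≤ F₂ c)
    (hF₃ : ∀ c, 0 ≤ F₃ c) (hA : ∑ c, μ c * F₁ c ≤ A) (hB : ∑ c, μ c * F₂ c ≤ B)
    (hC : ∑ c, μ c * F₃ c ≤ C) : ∃ c, F₁ c ≤ 3 * A ∧ F₂ c ≤ 3 * B ∧ F₃ c ≤ 3 * C := by
  have h : ∑ c, μ c * (F₁ c / A + F₂ c / B + F₃ c / C) ≤ 3 := by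
    simp only [mul_add, Finset.sum_add_distrib, ← mul_div_assoc, ← Finset.sum_div]
    have := (div_le_one hA0).2 hA
    have := (div_le_one hB0).2 hB
    have := (div_le_one hC0).2 hC
    linarith
  obtain ⟨c, hc⟩ := exists_le_of_average_le hμ h
  have n1 : 0 ≤ F₁ c / A := div_nonneg (hF₁ c) hA0.le
  have n2 : 0 ≤ F₂ c / B := div_nonneg (hF₂ c) hB0.le
  have n3 : 0 ≤ F₃ c / C := div_nonneg (hF₃ c) hC0.le
  refine ⟨c, ?_, ?_, ?_⟩
  · rw [← div_le_iff₀ hA0]; linarith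
  · rw [← div_le_iff₀ hB0]; linarith
  · rw [← div_le_iff₀ hC0]; linarith

lemma one_sub_sum_mul_ite {r : κ → ℝ} (hr : ∑ u, r u = 1) (E : κ → Prop) [DecidablePred E] :
    1 - ∑ u, r u * (if E u then 1 else 0) = ∑ u, r u * (if E u then 0 else 1) := by
  rw [sub_eq_iff_eq_add, ← Finset.sum_add_distrib]
  refine hr.symm.trans (Finset.sum_congr rfl fun u _ => ?_)
  split_ifs <;> simp

variable [DecidableEq ι]

/-- Expectation of a product of functions of the independent components of a random map. -/
lemma sum_prod_mul_prod (q : κ → ℝ) (g : ι → κ → ℝ) :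
    ∑ c : ι → κ, (∏ i, q (c i)) * ∏ i, g i (c i) = ∏ i, ∑ u, q u * g i u := by
  classical
  rw [Finset.prod_univ_sum, Fintype.piFinset_univ]
  exact Finset.sum_congr rfl fun c _ => Finset.prod_mul_distrib.symm

lemma prod_mem_stdSimplex {q : κ → ℝ} (hq : q ∈ stdSimplex ℝ κ) :
    (fun c : ι → κ => ∏ i, q (c i)) ∈ stdSimplex ℝ (ι → κ) := by
  refine ⟨fun c => Finset.prod_nonneg fun i _ => hq.1 _, ?_⟩
  simpa [hq.2] using sum_prod_mul_prod (ι := ι) q (fun _ _ => 1)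

lemma sum_prod_mul_eval {q : κ → ℝ} (hq : ∑ u, q u = 1) (m : ι) (F : κ → ℝ) :
    ∑ c : ι → κ, (∏ i, q (c i)) * F (c m) = ∑ u, q u * F u := by
  have h := sum_prod_mul_prod q (fun i u => if i = m then F u else 1)
  simp only [Finset.prod_ite_eq', Finset.mem_univ, if_true] at h
  rw [h, Finset.prod_eq_single m]
  · simp
  · intro i _ hi
    simp [hi, hq]
  · simp

lemma sum_prod_mul_eval_mul_eval {q : κ → ℝ} (hq : ∑ u, q u = 1) {m m' : ι} (hm : m ≠ m')
    (F G : κ → ℝ) :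
    ∑ c : ι → κ, (∏ i, q (c i)) * (F (c m) * G (c m')) =
      (∑ u, q u * F u) * ∑ u, q u * G u := by
  have h := sum_prod_mul_prod q
    (fun i u => (if i = m then F u else 1) * (if i = m' then G u else 1))
  simp only [Finset.prod_mul_distrib, Finset.prod_ite_eq', Finset.mem_univ, if_true] at h
  rw [h, ← Finset.prod_subset (Finset.subset_univ {m, m'}), Finset.prod_pair hm]
  · simp [hm, hm.symm]
  · intro i _ hi
    simp only [Finset.mem_insert, Finset.mem_singleton, not_or] at hi
    simp [hi.1, hi.2, hq]

/-- Collision probability of two components of a uniformly random map, after applying `h`. -/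
lemma sum_prod_mul_collision {κ' : Type*} [Fintype κ'] [DecidableEq κ'] {q : κ → ℝ}
    (hq : ∑ u, q u = 1) (h : κ → κ') {r : ℝ} (hr : ∀ k, law q h k = r) {m m' : ι} (hm : m ≠ m') :
    ∑ c : ι → κ, (∏ i, q (c i)) * (if h (c m) = h (c m') then 1 else 0) = r := by
  have h1 : ∀ c : ι → κ, (if h (c m) = h (c m') then (1 : ℝ) else 0) =
      ∑ k, (if h (c m) = k then 1 else 0) * (if h (c m') = k then 1 else 0) := by
    intro c
    simp [eq_comm]
  simp only [h1, Finset.mul_sum]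
  rw [Finset.sum_comm]
  have h2 : ∀ k, ∑ u, q u * (if h u = k then 1 else 0) = r := by
    intro k
    rw [← hr k, law_apply]
    simp
  have h3 : ∑ _k : κ', r = 1 := by
    rw [← hq, ← sum_law q h]
    simp [hr]
  calc ∑ k, ∑ c : ι → κ, (∏ i, q (c i)) *
        ((if h (c m) = k then (1 : ℝ) else 0) * (if h (c m') = k then 1 else 0))
      = ∑ _k : κ', r * r := by
        refine Finset.sum_congr rfl fun k _ => ?_
        rw [sum_prod_mul_eval_mul_eval hq hm (fun u => if h u = k then 1 else 0)
          (fun u => if h u = k then 1 else 0), h2]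
    _ = r := by rw [← Finset.sum_mul, h3, one_mul]

end RandomSelection

section Codebook

variable {Z X Y 𝒰 : Type*} [Fintype Z] [Fintype Y] [Fintype 𝒰]

lemma one_sub_pow_le_of_le {t v a' : ℝ} (ht1 : t ≤ 1) (hv0 : 0 ≤ v) (hv1 : v ≤ 1)
    (ha' : 0 < a') (h : v ≤ a' * t) (M : ℕ) :
    (1 - t) ^ M ≤ 1 - v + Real.exp (-(M / a')) := by
  have h1 : (1 - t) ^ M ≤ Real.exp (-(M / a') * v) := by
    have h2 : 1 - t ≤ Real.exp (-(v / a')) := by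
      have h3 : v / a' ≤ t := by rw [div_le_iff₀ ha']; linarith
      have h4 := Real.add_one_le_exp (-(v / a'))
      linarith
    calc (1 - t) ^ M ≤ Real.exp (-(v / a')) ^ M := pow_le_pow_left₀ (by linarith) h2 M
      _ = Real.exp (-(M / a') * v) := by rw [← Real.exp_nat_mul]; congr 1; ring
  have h5 := convexOn_exp.2 (Set.mem_univ 0) (Set.mem_univ (-(M / a')))
    (sub_nonneg.2 hv1) hv0 (by ring)
  simp only [smul_eq_mul, mul_zero, zero_add, Real.exp_zero, mul_one] at h5
  have h6 : v * Real.exp (-(M / a')) ≤ Real.exp (-(M / a')) :=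
    mul_le_of_le_one_left (Real.exp_pos _).le hv1
  rw [mul_comm v] at h5
  linarith

/-- Random codebooks: covering of the source, few false candidates for the decoder, and few
candidates that violate the decoding rule. -/
lemma exists_codebook {p : Z → ℝ} (hp : p ∈ stdSimplex ℝ Z) (x : Z → X) (y : Z → Y)
    {V : X → 𝒰 → ℝ} (hV : ∀ a, V a ∈ stdSimplex ℝ 𝒰) (T : 𝒰 → X → Prop) (G : 𝒰 → Y → Prop)
    {a a' b : ℝ} (ha : 0 ≤ a) (ha' : 0 < a') (hb : 0 ≤ b)
    (hT : ∀ u ξ, T u ξ → V ξ u ≤ a' * ∑ z, p z * V (x z) u)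
    (hG : ∀ u β, G u β → (∑ z, p z * V (x z) u) * law p y β ≤
      b * law (fun z => p z * V (x z) u) y β)
    (M : ℕ) {A B C : ℝ} (hA0 : 0 < A) (hB0 : 0 < B) (hC0 : 0 < C)
    (hA : prob (kernelJoint p x V) (fun ω => ¬ T ω.1 (x ω.2)) + Real.exp (-(M / a')) ≤ A)
    (hB : M * b ≤ B)
    (hC : M * (a * prob (kernelJoint p x V) (fun ω => ¬ G ω.1 (y ω.2))) ≤ C) :
    ∃ c : Fin M → 𝒰, prob p (fun z => ∀ m, ¬ T (c m) (x z)) ≤ 3 * A ∧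
      ∑ m, prob p (fun z => G (c m) (y z)) ≤ 3 * B ∧
      ∑ m, a * (prob (fun z => p z * V (x z) (c m)) (fun z => ¬ G (c m) (y z)) /
        ∑ z, p z * V (x z) (c m)) ≤ 3 * C := by
  classical
  set q : 𝒰 → ℝ := fun u => ∑ z, p z * V (x z) u with hqdef
  have hq : q ∈ stdSimplex ℝ 𝒰 := by
    have := law_mem_stdSimplex (kernelJoint_mem_stdSimplex hp x hV) (fun ω => ω.1)
    rwa [show law (kernelJoint p x V) (fun ω => ω.1) = q from
      funext fun u => law_kernelJoint_fst p x V u] at this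
  set μ : (Fin M → 𝒰) → ℝ := fun c => ∏ i, q (c i) with hμdef
  have hμ : μ ∈ stdSimplex ℝ (Fin M → 𝒰) := prod_mem_stdSimplex hq
  -- the source is covered
  have h1 : ∑ c, μ c * prob p (fun z => ∀ m, ¬ T (c m) (x z)) ≤ A := by
    refine le_trans ?_ hA
    have e1 : ∑ c, μ c * prob p (fun z => ∀ m, ¬ T (c m) (x z)) =
        ∑ z, p z * (1 - ∑ u, q u * if T u (x z) then 1 else 0) ^ M := by
      simp only [prob_eq_sum_mul, Finset.mul_sum]
      rw [Finset.sum_comm]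
      refine Finset.sum_congr rfl fun z _ => ?_
      have e2 := sum_prod_mul_prod (ι := Fin M) q (fun _ u => if T u (x z) then 0 else 1)
      rw [Finset.prod_const, Finset.card_univ, Fintype.card_fin] at e2
      rw [one_sub_sum_mul_ite hq.2 (fun u => T u (x z)), ← e2, Finset.mul_sum]
      refine Finset.sum_congr rfl fun c _ => ?_
      have e3 : (∏ i, if T (c i) (x z) then (0 : ℝ) else 1) =
          if ∀ m, ¬ T (c m) (x z) then 1 else 0 := by
        split_ifs with h
        · exact Finset.prod_eq_one fun i _ => by simp [h i]
        · push Not at h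
          obtain ⟨m, hm⟩ := h
          exact Finset.prod_eq_zero (Finset.mem_univ m) (by simp [hm])
      rw [e3]
      ring
    have e4 : prob (kernelJoint p x V) (fun ω => ¬ T ω.1 (x ω.2)) =
        ∑ z, p z * (1 - ∑ u, V (x z) u * if T u (x z) then 1 else 0) := by
      rw [prob_eq_sum_mul, Fintype.sum_prod_type_right]
      refine Finset.sum_congr rfl fun z _ => ?_
      rw [one_sub_sum_mul_ite (hV (x z)).2 (fun u => T u (x z)), Finset.mul_sum]
      refine Finset.sum_congr rfl fun u _ => ?_
      by_cases h : T u (x z) <;> simp [h, kernelJoint]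
    have e5 : Real.exp (-(M / a')) = ∑ z, p z * Real.exp (-(M / a')) := by
      rw [← Finset.sum_mul, hp.2, one_mul]
    rw [e1, e4, e5, ← Finset.sum_add_distrib]
    refine Finset.sum_le_sum fun z _ => ?_
    rw [← mul_add]
    refine mul_le_mul_of_nonneg_left ?_ (hp.1 z)
    have hite : ∀ {r : 𝒰 → ℝ}, r ∈ stdSimplex ℝ 𝒰 →
        0 ≤ ∑ u, r u * (if T u (x z) then 1 else 0) ∧
          ∑ u, r u * (if T u (x z) then 1 else 0) ≤ 1 := by
      intro r hr
      refine ⟨Finset.sum_nonneg fun u _ => mul_nonneg (hr.1 u) (by split_ifs <;> simp), ?_⟩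
      refine le_trans (Finset.sum_le_sum fun u _ => ?_) hr.2.le
      split_ifs <;> simp [hr.1]
    refine one_sub_pow_le_of_le (hite hq).2 (hite (hV _)).1 (hite (hV _)).2 ha' ?_ M
    rw [Finset.mul_sum]
    refine Finset.sum_le_sum fun u _ => ?_
    by_cases h : T u (x z)
    · simpa [h] using hT u (x z) h
    · simp [h]
  -- few false candidates
  have h2 : ∑ c, μ c * ∑ m, prob p (fun z => G (c m) (y z)) ≤ B := by
    refine le_trans ?_ hB
    simp only [Finset.mul_sum]
    rw [Finset.sum_comm]
    have e1 : ∀ m : Fin M, ∑ c, μ c * prob p (fun z => G (c m) (y z)) ≤ b := by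
      intro m
      rw [sum_prod_mul_eval hq.2 m (fun u => prob p (fun z => G u (y z)))]
      calc ∑ u, q u * prob p (fun z => G u (y z))
          ≤ ∑ u, b * ∑ β, law (fun z => p z * V (x z) u) y β := by
            refine Finset.sum_le_sum fun u _ => ?_
            rw [← prob_law p y (G u), prob_eq_sum_mul, Finset.mul_sum, Finset.mul_sum]
            refine Finset.sum_le_sum fun β _ => ?_
            by_cases h : G u β
            · simpa [h] using hG u β h
            · simp only [h, if_false, mul_zero]
              exact mul_nonneg hb (law_nonneg (fun z => mul_nonneg (hp.1 z) ((hV _).1 u)) _ _)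
        _ = b := by
            simp only [sum_law]
            rw [← Finset.mul_sum, show ∑ u, ∑ z, p z * V (x z) u = 1 from hq.2, mul_one]
    refine (Finset.sum_le_sum fun m _ => e1 m).trans ?_
    simp
  -- few candidates that violate the decoding rule
  have h3 : ∑ c, μ c * ∑ m, a * (prob (fun z => p z * V (x z) (c m)) (fun z => ¬ G (c m) (y z)) /
        q (c m)) ≤ C := by
    refine le_trans ?_ hC
    simp only [Finset.mul_sum]
    rw [Finset.sum_comm]
    have e1 : ∀ m : Fin M, ∑ c, μ c * (a * (prob (fun z => p z * V (x z) (c m))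
        (fun z => ¬ G (c m) (y z)) / q (c m))) ≤
          a * prob (kernelJoint p x V) (fun ω => ¬ G ω.1 (y ω.2)) := by
      intro m
      rw [sum_prod_mul_eval hq.2 m (fun u => a * (prob (fun z => p z * V (x z) u)
        (fun z => ¬ G u (y z)) / q u)), prob_eq_sum_mul, Fintype.sum_prod_type, Finset.mul_sum]
      refine Finset.sum_le_sum fun u _ => ?_
      have hnn : 0 ≤ prob (fun z => p z * V (x z) u) (fun z => ¬ G u (y z)) :=
        prob_nonneg (fun z => mul_nonneg (hp.1 z) ((hV _).1 u)) _
      have e2 : prob (fun z => p z * V (x z) u) (fun z => ¬ G u (y z)) =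
          ∑ z, kernelJoint p x V (u, z) * (if ¬ G u (y z) then 1 else 0) := by
        rw [prob_eq_sum_mul]
        rfl
      simp only [← e2]
      by_cases h : q u = 0
      · simp only [h, zero_mul]
        positivity
      · apply le_of_eq
        field_simp
    refine (Finset.sum_le_sum fun m _ => e1 m).trans ?_
    simp
  exact exists_le_three_of_average_le hμ hA0 hB0 hC0 (fun c => prob_nonneg hp.1 _)
    (fun c => Finset.sum_nonneg fun m _ => prob_nonneg hp.1 _)
    (fun c => Finset.sum_nonneg fun m _ => mul_nonneg ha (div_nonneg
      (prob_nonneg (fun z => mul_nonneg (hp.1 z) ((hV _).1 _)) _) (hq.1 _))) h1 h2 h3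

end Codebook

section Binning

variable {Z Y ι : Type*} [Fintype Z] [Fintype ι]

/-- The entropy deficit of a variable `f` with `K` values, in terms of collision probabilities on
a good event. -/
lemma log_card_sub_entropy_le {κ : Type*} [Fintype κ] {p : Z → ℝ} (hp : p ∈ stdSimplex ℝ Z)
    (f : Z → κ) {K : ℝ} (hK : 0 < K) (E : Z → Prop) [DecidablePred E] :
    Real.log K - entropy p f ≤
      K * (∑ z, p z * (if E z then law p f (f z) else 0)) - (1 - prob p (fun z => ¬ E z)) +
        prob p (fun z => ¬ E z) * Real.log K := by
  have h1 : Real.log K - entropy p f = ∑ z, p z * (Real.log K + Real.log (law p f (f z))) := by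
    simp only [mul_add, Finset.sum_add_distrib]
    rw [← Finset.sum_mul, hp.2, entropy_eq_neg_sum]
    ring
  have h2 : 1 - prob p (fun z => ¬ E z) = ∑ z, p z * (if E z then 1 else 0) := by
    rw [prob_not hp.2, prob_eq_sum_mul]; ring
  have h3 : prob p (fun z => ¬ E z) = ∑ z, p z * (if E z then 0 else 1) := by
    rw [prob_eq_sum_mul]
    simp [ite_not]
  rw [h1, h2, h3, Finset.mul_sum, Finset.sum_mul, ← Finset.sum_sub_distrib,
    ← Finset.sum_add_distrib]
  refine Finset.sum_le_sum fun z _ => ?_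
  rcases (hp.1 z).eq_or_lt with h0 | h0
  · simp [← h0]
  have hl := law_pos hp.1 f h0
  by_cases hE : E z
  · simp only [hE, if_true, mul_one, mul_zero, zero_mul, add_zero]
    rw [← Real.log_mul hK.ne' hl.ne']
    have := Real.log_le_sub_one_of_pos (mul_pos hK hl)
    nlinarith
  · simp only [hE, if_false, mul_one, mul_zero, zero_sub, neg_zero, zero_add]
    have hl1 : law p f (f z) ≤ 1 := by
      have := prob_le_one hp (fun ω => f ω = f z)
      exact this
    have := Real.log_nonpos hl.le hl1
    nlinarith

/-- Random binning of an index of large min-entropy: the bin is almost uniform, and few wrong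
indices in the bin of the true one are compatible with the side information. -/
lemma exists_binning {p : Z → ℝ} (hp : p ∈ stdSimplex ℝ Z) (I : Z → ι) (y : Z → Y)
    (good : ι → Prop) (L : ι → Y → Prop) {a : ℝ} (ha : ∀ i, good i → law p I i ≤ a)
    {w s : ℕ} (hw : 0 < w) (hs : 0 < s) {D B : ℝ} (hD0 : 0 < D) (hB0 : 0 < B) (ha0 : 0 ≤ a)
    (hD : (w * s : ℝ) * a + prob p (fun z => ¬ good (I z)) * Real.log (w * s) ≤ D)
    (hB : (∑ i, prob p (fun z => L i (y z))) / w ≤ B) :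
    ∃ bin : ι → Fin w × Fin s,
      Real.log (w * s) - entropy p (fun z => bin (I z)) ≤ 3 * D ∧
      prob p (fun z => ∃ i, i ≠ I z ∧ (bin i).1 = (bin (I z)).1 ∧ L i (y z)) ≤ 3 * B := by
  classical
  have hw' : (0 : ℝ) < w := by exact_mod_cast hw
  have hs' : (0 : ℝ) < s := by exact_mod_cast hs
  have hK : (0 : ℝ) < w * s := by positivity
  have : Nonempty (Fin w × Fin s) := ⟨(⟨0, hw⟩, ⟨0, hs⟩)⟩
  set q : Fin w × Fin s → ℝ := fun _ => 1 / (w * s) with hqdef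
  have hq : q ∈ stdSimplex ℝ (Fin w × Fin s) := by
    refine ⟨fun _ => by positivity, ?_⟩
    simp [hqdef]
    field_simp
  have hμ := prod_mem_stdSimplex (ι := ι) hq
  set μ : (ι → Fin w × Fin s) → ℝ := fun c => ∏ i, q (c i) with hμdef
  have hcoll : ∀ i j : ι, i ≠ j →
      ∑ c, μ c * (if c i = c j then 1 else 0) = 1 / (w * s) := by
    intro i j hij
    refine sum_prod_mul_collision hq.2 (fun u => u) (fun k => ?_) hij
    rw [law_apply]
    simp [hqdef]
  have hcoll' : ∀ i j : ι, i ≠ j →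
      ∑ c, μ c * (if (c i).1 = (c j).1 then 1 else 0) = 1 / w := by
    intro i j hij
    refine sum_prod_mul_collision hq.2 (fun u => u.1) (fun k => ?_) hij
    rw [law_apply, Fintype.sum_prod_type]
    simp [hqdef]
    field_simp
  have h1 : ∑ c, μ c * (Real.log (w * s) - entropy p (fun z => c (I z))) ≤ D := by
    refine le_trans ?_ hD
    set e := prob p (fun z => ¬ good (I z)) with he
    have hcol1 : ∑ c, μ c * ∑ z, p z * (if good (I z) then
        law p (fun z => c (I z)) (c (I z)) else 0) ≤ (1 - e) * (a + 1 / (w * s)) := by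
      have e1 : 1 - e = ∑ z, p z * (if good (I z) then 1 else 0) := by
        rw [he, prob_not hp.2, prob_eq_sum_mul]; ring
      rw [e1, Finset.sum_mul]
      simp only [Finset.mul_sum]
      rw [Finset.sum_comm]
      refine Finset.sum_le_sum fun z _ => ?_
      by_cases hz : good (I z)
      · simp only [hz, if_true, mul_one]
        have e2 : ∑ c, μ c * (p z * law p (fun z => c (I z)) (c (I z))) =
            p z * ∑ z', p z' * ∑ c, μ c * (if c (I z') = c (I z) then 1 else 0) := by
          simp only [law_apply, Finset.mul_sum]
          rw [Finset.sum_comm]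
          refine Finset.sum_congr rfl fun z' _ => Finset.sum_congr rfl fun c _ => ?_
          split_ifs <;> ring
        rw [e2]
        refine mul_le_mul_of_nonneg_left ?_ (hp.1 z)
        calc ∑ z', p z' * ∑ c, μ c * (if c (I z') = c (I z) then 1 else 0)
            ≤ ∑ z', ((if I z' = I z then p z' else 0) + p z' * (1 / (w * s))) := by
              refine Finset.sum_le_sum fun z' _ => ?_
              have hnn : 0 ≤ p z' * (1 / ((w : ℝ) * s)) := mul_nonneg (hp.1 z') (by positivity)
              by_cases h : I z' = I z
              · simp only [h, if_true, mul_one, hμ.2]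
                linarith
              · rw [hcoll _ _ h]
                simp [h]
          _ = law p I (I z) + 1 / (w * s) := by
              rw [Finset.sum_add_distrib, ← Finset.sum_mul, hp.2, law_apply, one_mul]
          _ ≤ a + 1 / (w * s) := by linarith [ha (I z) hz]
      · simp [hz]
    have he0 : 0 ≤ e := prob_nonneg hp.1 _
    calc ∑ c, μ c * (Real.log (w * s) - entropy p (fun z => c (I z)))
        ≤ ∑ c, μ c * ((w * s) * (∑ z, p z * (if good (I z) then
          law p (fun z => c (I z)) (c (I z)) else 0)) - (1 - e) + e * Real.log (w * s)) :=
          Finset.sum_le_sum fun c _ => mul_le_mul_of_nonneg_left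
            (log_card_sub_entropy_le hp (fun z => c (I z)) hK (fun z => good (I z))) (hμ.1 c)
      _ = (w * s) * (∑ c, μ c * ∑ z, p z * (if good (I z) then
          law p (fun z => c (I z)) (c (I z)) else 0)) - (1 - e) + e * Real.log (w * s) := by
          have : ∀ F : (ι → Fin w × Fin s) → ℝ, ∀ r t K : ℝ,
              ∑ c, μ c * (K * F c - r + t) = K * (∑ c, μ c * F c) - r + t := by
            intro F r t K
            have e3 : ∀ c, μ c * (K * F c - r + t) = K * (μ c * F c) + μ c * (t - r) :=
              fun c => by ring
            simp only [e3, Finset.sum_add_distrib]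
            rw [← Finset.mul_sum, ← Finset.sum_mul, hμ.2]
            ring
          exact this _ _ _ _
      _ ≤ (w * s) * ((1 - e) * (a + 1 / (w * s))) - (1 - e) + e * Real.log (w * s) := by
          gcongr
      _ = (w * s) * a * (1 - e) + e * Real.log (w * s) := by
          field_simp
          ring
      _ ≤ (w * s) * a + e * Real.log (w * s) := by
          have : 0 ≤ (w * s) * a * e := by positivity
          linarith
  have h2 : ∑ c, μ c * prob p (fun z => ∃ i, i ≠ I z ∧ (c i).1 = (c (I z)).1 ∧ L i (y z)) ≤ B := by
    refine le_trans ?_ hB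
    calc ∑ c, μ c * prob p (fun z => ∃ i, i ≠ I z ∧ (c i).1 = (c (I z)).1 ∧ L i (y z))
        ≤ ∑ c, μ c * ∑ z, p z * ∑ i, (if i ≠ I z ∧ L i (y z) then 1 else 0) *
            (if (c i).1 = (c (I z)).1 then 1 else 0) := by
          refine Finset.sum_le_sum fun c _ => mul_le_mul_of_nonneg_left ?_ (hμ.1 c)
          rw [prob_eq_sum_mul]
          refine Finset.sum_le_sum fun z _ => mul_le_mul_of_nonneg_left ?_ (hp.1 z)
          split_ifs with h
          · obtain ⟨i, hi1, hi2, hi3⟩ := h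
            refine le_trans ?_ (Finset.single_le_sum (fun j _ => ?_) (Finset.mem_univ i))
            · simp [hi1, hi2, hi3]
            · exact mul_nonneg (by split_ifs <;> simp) (by split_ifs <;> simp)
          · exact Finset.sum_nonneg fun j _ =>
              mul_nonneg (by split_ifs <;> simp) (by split_ifs <;> simp)
      _ = ∑ z, p z * ∑ i, (if i ≠ I z ∧ L i (y z) then 1 else 0) *
            ∑ c, μ c * (if (c i).1 = (c (I z)).1 then 1 else 0) := by
          simp only [Finset.mul_sum]
          rw [Finset.sum_comm]
          refine Finset.sum_congr rfl fun z _ => ?_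
          rw [Finset.sum_comm]
          refine Finset.sum_congr rfl fun i _ => Finset.sum_congr rfl fun c _ => ?_
          ring
      _ ≤ ∑ z, p z * ∑ i, (if L i (y z) then 1 else 0) * (1 / (w : ℝ)) := by
          refine Finset.sum_le_sum fun z _ => mul_le_mul_of_nonneg_left
            (Finset.sum_le_sum fun i _ => ?_) (hp.1 z)
          by_cases h : i = I z
          · simp only [h, ne_eq, not_true, false_and, if_false, zero_mul]
            split_ifs <;> simp
          · rw [hcoll' _ _ h]
            simp [h]
      _ = (∑ i, prob p (fun z => L i (y z))) / w := by
          simp only [prob_eq_sum_mul, Finset.mul_sum, Finset.sum_div]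
          rw [Finset.sum_comm]
          refine Finset.sum_congr rfl fun i _ => Finset.sum_congr rfl fun z _ => ?_
          ring
  have h3 : ∀ c : ι → Fin w × Fin s, 0 ≤ Real.log (w * s) - entropy p (fun z => c (I z)) := by
    intro c
    have := entropy_le_log_card hp (fun z => c (I z))
    rw [Fintype.card_prod, Fintype.card_fin, Fintype.card_fin, Nat.cast_mul] at this
    linarith
  obtain ⟨c, hc1, hc2, -⟩ := exists_le_three_of_average_le hμ hD0 hB0 one_pos
    (F₃ := fun _ => 0) h3 (fun c => prob_nonneg hp.1 _) (fun _ => le_rfl) h1 h2 (by simp)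
  exact ⟨c, hc1, hc2⟩

end Binning

section OneShot

variable {Z X Y 𝒰 : Type*} [Fintype Z] [Fintype Y] [Fintype 𝒰]

/-- If an index is only chosen for source outcomes that are likely under the reverse channel of its
codeword, then all events are unlikely jointly with that index. -/
lemma prob_index_and_le {ι : Type*} {p : Z → ℝ} (hp : p ∈ stdSimplex ℝ Z) (x : Z → X)
    {V : X → 𝒰 → ℝ} (hV : ∀ a, V a ∈ stdSimplex ℝ 𝒰) (I : Z → ι) (i : ι) (u : 𝒰) {a : ℝ}
    (ha : 0 ≤ a)
    (h : ∀ z, I z = i → 0 < (∑ z, p z * V (x z) u) ∧ ∑ z, p z * V (x z) u ≤ a * V (x z) u)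
    (E : Z → Prop) :
    prob p (fun z => I z = i ∧ E z) ≤
      a * (prob (fun z => p z * V (x z) u) E / ∑ z, p z * V (x z) u) := by
  classical
  rw [prob_eq_sum_mul, prob_eq_sum_mul, Finset.sum_div, Finset.mul_sum]
  refine Finset.sum_le_sum fun z _ => ?_
  have hq0 : 0 ≤ ∑ z, p z * V (x z) u :=
    Finset.sum_nonneg fun z _ => mul_nonneg (hp.1 z) ((hV _).1 u)
  by_cases hz : I z = i ∧ E z
  · obtain ⟨h1, h2⟩ := h z hz.1
    simp only [hz.1, hz.2, and_self, if_true, mul_one]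
    rw [← mul_div_assoc, le_div_iff₀ h1]
    have := mul_le_mul_of_nonneg_left h2 (hp.1 z)
    linarith
  · rw [if_neg hz, mul_zero]
    have := (hV (x z)).1 u
    have := hp.1 z
    have : (0 : ℝ) ≤ if E z then 1 else 0 := by split_ifs <;> simp
    positivity

/-- One-shot achievability for the generated-secret model. -/
lemma exists_one_shot_code {p : Z → ℝ} (hp : p ∈ stdSimplex ℝ Z) (x : Z → X) (y : Z → Y)
    {V : X → 𝒰 → ℝ} (hV : ∀ a, V a ∈ stdSimplex ℝ 𝒰) (T : 𝒰 → X → Prop) (G : 𝒰 → Y → Prop)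
    {a a' b β Γ : ℝ} (ha : 0 < a) (ha1 : a ≤ 1) (ha' : 0 < a') (hb : 0 ≤ b) (hβ : 1 ≤ β)
    (hΓ : 1 ≤ Γ)
    (hT : ∀ u ξ, T u ξ → 0 < (∑ z, p z * V (x z) u) ∧ ∑ z, p z * V (x z) u ≤ a * V ξ u ∧
      V ξ u ≤ a' * ∑ z, p z * V (x z) u)
    (hG : ∀ u υ, G u υ → (∑ z, p z * V (x z) u) * law p y υ ≤
        b * law (fun z => p z * V (x z) u) y υ ∧
      law (fun z => p z * V (x z) u) y υ ≤ β * ((∑ z, p z * V (x z) u) * law p y υ))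
    (hΓ' : ∀ u υ, law (fun z => p z * V (x z) u) y υ ≤
      Γ * ((∑ z, p z * V (x z) u) * law p y υ))
    (M : ℕ) {w s : ℕ} (hw : 0 < w) (hs : 0 < s) {A B C D : ℝ} (hA0 : 0 < A) (hB0 : 0 < B)
    (hC0 : 0 < C) (hD0 : 0 < D)
    (hA : prob (kernelJoint p x V) (fun ω => ¬ T ω.1 (x ω.2)) + Real.exp (-(M / a')) ≤ A)
    (hB : M * b ≤ B)
    (hC : M * (a * prob (kernelJoint p x V) (fun ω => ¬ G ω.1 (y ω.2))) ≤ C)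
    (hD : (w * s : ℝ) * a + 3 * A * Real.log (w * s) ≤ D) :
    ∃ (enc : X → Fin w × Fin s) (dec : Fin w × Y → Fin s),
      Real.log (w * s) - entropy p (fun z => enc (x z)) ≤ 3 * D ∧
      prob p (fun z => (enc (x z)).2 ≠ dec ((enc (x z)).1, y z)) ≤ 3 * A + 3 * C + 9 * (B / w) ∧
      mutualInfo p y (fun z => (enc (x z)).1) ≤ Real.log w + (1 - 3 * A) * Real.log a +
        Real.log β + 3 * C * Real.log Γ + Real.log 2 +
        (3 * A + 3 * C + 9 * (B / w)) * Real.log (M + 1) := by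
  classical
  have hw' : (0 : ℝ) < w := by exact_mod_cast hw
  have hs' : (0 : ℝ) < s := by exact_mod_cast hs
  obtain ⟨c, hc1, hc2, hc3⟩ := exists_codebook hp x y hV T G ha.le ha' hb
    (fun u ξ h => (hT u ξ h).2.2) (fun u υ h => (hG u υ h).1) M hA0 hB0 hC0 hA hB hC
  set q : 𝒰 → ℝ := fun u => ∑ z, p z * V (x z) u with hqdef
  let enc₀ : X → Option (Fin M) := fun ξ =>
    if h : ∃ m, T (c m) ξ then some h.choose else none
  have henc₀ : ∀ ξ m, enc₀ ξ = some m → T (c m) ξ := by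
    intro ξ m h
    by_cases h' : ∃ m, T (c m) ξ
    · simp only [enc₀, dif_pos h', Option.some.injEq] at h
      rw [← h]
      exact h'.choose_spec
    · simp [enc₀, dif_neg h'] at h
  have hnone : ∀ ξ, enc₀ ξ = none → ∀ m, ¬ T (c m) ξ := by
    intro ξ h m hm
    have h' : ∃ m, T (c m) ξ := ⟨m, hm⟩
    simp [enc₀, dif_pos h'] at h
  set I : Z → Option (Fin M) := fun z => enc₀ (x z) with hI
  have hindex : ∀ m (E : Z → Prop), prob p (fun z => I z = some m ∧ E z) ≤
      a * (prob (fun z => p z * V (x z) (c m)) E / q (c m)) := fun m E =>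
    prob_index_and_le hp x hV I (some m) (c m) ha.le
      (fun z hz => ⟨(hT _ _ (henc₀ _ _ hz)).1, (hT _ _ (henc₀ _ _ hz)).2.1⟩) E
  have hpair : ∀ m υ, law p (fun z => (I z, y z)) (some m, υ) ≤
      a * (law (fun z => p z * V (x z) (c m)) y υ / q (c m)) := by
    intro m υ
    rw [law_eq_prob, prob_congr p (F := fun z => I z = some m ∧ y z = υ) (by simp)]
    exact hindex m (fun z => y z = υ)
  have hmass : ∀ i, i ≠ none → law p I i ≤ a := by
    rintro (_ | m) h
    · exact absurd rfl h
    · have h1 := hindex m (fun _ => True)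
      have h2 : prob (fun z => p z * V (x z) (c m)) (fun _ => True) / q (c m) ≤ 1 := by
        simp only [prob, if_true]
        exact div_self_le_one _
      have h3 : prob p (fun z => I z = some m ∧ True) = law p I (some m) := by
        rw [law_eq_prob]
        exact prob_congr p (by simp)
      rw [h3] at h1
      nlinarith
  have he : prob p (fun z => ¬ (I z ≠ none)) ≤ 3 * A := by
    refine (prob_mono hp.1 fun z hz => ?_).trans hc1
    exact hnone _ (not_not.1 hz)
  set bad : Z → Prop := fun z => ∃ m, I z = some m ∧ ¬ G (c m) (y z) with hbad
  have hpB : prob p bad ≤ 3 * C := by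
    refine le_trans ?_ hc3
    refine le_trans ?_ (Finset.sum_le_sum fun m _ => hindex m (fun z => ¬ G (c m) (y z)))
    simp only [prob_eq_sum_mul]
    rw [Finset.sum_comm]
    refine Finset.sum_le_sum fun z _ => ?_
    rw [← Finset.mul_sum]
    refine mul_le_mul_of_nonneg_left ?_ (hp.1 z)
    by_cases hz : bad z
    · rw [if_pos hz]
      obtain ⟨m, hm1, hm2⟩ := hz
      refine le_trans ?_ (Finset.single_le_sum (fun j _ => ?_) (Finset.mem_univ m))
      · rw [if_pos ⟨hm1, hm2⟩]
      · split_ifs <;> simp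
    · rw [if_neg hz]
      exact Finset.sum_nonneg fun j _ => by split_ifs <;> simp
  let L : Option (Fin M) → Y → Prop := fun i υ => ∃ m, i = some m ∧ G (c m) υ
  have hL : (∑ i, prob p (fun z => L i (y z))) / w ≤ 3 * (B / w) := by
    rw [Fintype.sum_option]
    have h0 : prob p (fun z => L none (y z)) = 0 := by simp [prob, L]
    have h1 : ∀ m, prob p (fun z => L (some m) (y z)) = prob p (fun z => G (c m) (y z)) := by
      intro m
      simp [L]
    rw [h0, zero_add, ← mul_div_assoc]
    simp only [h1]
    gcongr
  have hlogK : 0 ≤ Real.log ((w : ℝ) * s) := by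
    have := Real.log_natCast_nonneg (w * s)
    rwa [Nat.cast_mul] at this
  obtain ⟨bin, hbin1, hbin2⟩ := exists_binning hp I y (fun i => i ≠ none) L hmass hw hs hD0
    (B := 3 * (B / w)) (by positivity) ha.le
    (le_trans (by gcongr) hD) hL
  let decI : Fin w × Y → Option (Fin M) := fun v =>
    if h : ∃ i, (bin i).1 = v.1 ∧ L i v.2 then h.choose else none
  have hdec : ∀ z, I z ≠ decI ((bin (I z)).1, y z) → ((∀ m, ¬ T (c m) (x z)) ∨ bad z) ∨
      ∃ i, i ≠ I z ∧ (bin i).1 = (bin (I z)).1 ∧ L i (y z) := by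
    intro z hz
    by_contra hcon
    push Not at hcon
    obtain ⟨⟨h1, h2⟩, h3⟩ := hcon
    obtain ⟨m, hm⟩ : ∃ m, I z = some m := by
      rw [← Option.ne_none_iff_exists']
      intro h
      obtain ⟨m, hm⟩ := h1
      exact hnone _ h m hm
    have hGm : G (c m) (y z) := by
      by_contra h
      exact h2 ⟨m, hm, h⟩
    have hex : ∃ i, (bin i).1 = (bin (I z)).1 ∧ L i (y z) := ⟨I z, rfl, m, hm, hGm⟩
    apply hz
    by_contra hne
    have hval : decI ((bin (I z)).1, y z) = hex.choose := by
      simp only [decI]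
      rw [dif_pos hex]
    rw [hval] at hne
    exact h3 _ (Ne.symm hne) hex.choose_spec.1 hex.choose_spec.2
  have hPe : prob p (fun z => I z ≠ decI ((bin (I z)).1, y z)) ≤
      3 * A + 3 * C + 9 * (B / w) := by
    refine (prob_mono hp.1 hdec).trans ((prob_or_le hp.1 _ _).trans ?_)
    have := prob_or_le hp.1 (fun z => ∀ m, ¬ T (c m) (x z)) bad
    linarith
  have hlogM : 0 ≤ Real.log ((M : ℝ) + 1) := by
    have := Real.log_natCast_nonneg (M + 1)
    rwa [Nat.cast_succ] at this
  refine ⟨fun ξ => bin (enc₀ ξ), fun v => (bin (decI v)).2, hbin1, ?_, ?_⟩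
  · refine (prob_mono hp.1 fun z hz => ?_).trans hPe
    intro h
    apply hz
    exact congrArg (fun i => (bin i).2) h
  · have hfano := fano hp I (fun z => ((bin (I z)).1, y z)) decI
    rw [Fintype.card_option, Fintype.card_fin, Nat.cast_succ] at hfano
    have hbe : Real.binEntropy (prob p fun z => I z ≠ decI ((bin (I z)).1, y z)) ≤ Real.log 2 :=
      Real.binEntropy_le_log_two
    have hmul := mul_le_mul_of_nonneg_right hPe hlogM
    have : Nonempty (Fin w) := ⟨⟨0, hw⟩⟩
    have hHW := entropy_le_log_card hp (fun z => (bin (I z)).1)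
    rw [Fintype.card_fin] at hHW
    have hmono : entropy p (fun z => (I z, y z)) ≤
        entropy p (fun z => (I z, (bin (I z)).1, y z)) :=
      entropy_mono hp.1 (by simp; tauto)
    have hcond : entropy p y - entropy p (fun z => (I z, y z)) ≤
        (1 - 3 * A) * Real.log a + Real.log β + 3 * C * Real.log Γ := by
      have hloga : Real.log a ≤ 0 := Real.log_nonpos ha.le ha1
      have hlogβ : 0 ≤ Real.log β := Real.log_nonneg hβ
      have hlogΓ : 0 ≤ Real.log Γ := Real.log_nonneg hΓ
      have h1 : entropy p y - entropy p (fun z => (I z, y z)) ≤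
          ∑ z, (p z * (if I z ≠ none then 1 else 0) * Real.log a + p z * Real.log β +
            p z * (if bad z then 1 else 0) * Real.log Γ) := by
        rw [entropy_eq_neg_sum, entropy_eq_neg_sum, neg_sub_neg, ← Finset.sum_sub_distrib]
        refine Finset.sum_le_sum fun z _ => ?_
        rcases (hp.1 z).eq_or_lt with h0 | h0
        · simp [← h0]
        have l1 := law_pos hp.1 y h0
        have l2 := law_pos hp.1 (fun z => (I z, y z)) h0
        rw [← mul_sub, mul_assoc, mul_assoc, ← mul_add, ← mul_add]
        refine mul_le_mul_of_nonneg_left ?_ h0.le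
        have hcase : ∀ {r : ℝ}, 0 < r → law p (fun z => (I z, y z)) (I z, y z) ≤
            r * law p y (y z) → Real.log (law p (fun z => (I z, y z)) (I z, y z)) -
              Real.log (law p y (y z)) ≤ Real.log r := by
          intro r hr h
          have := Real.log_le_log l2 h
          rw [Real.log_mul hr.ne' l1.ne'] at this
          linarith
        rcases Option.eq_none_or_eq_some (I z) with hIz | ⟨m, hIz⟩
        · have hnb : ¬ bad z := by
            rintro ⟨m, hm, -⟩
            rw [hIz] at hm
            cases hm
          have := hcase one_pos (by
            rw [one_mul]
            exact law_le_of_imp hp.1 (fun ω hω => (Prod.mk.inj hω).2))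
          simp only [hIz, hnb, ne_eq, not_true, if_false, zero_mul, zero_add, add_zero]
          rw [Real.log_one, hIz] at this
          linarith
        · have hq : 0 < q (c m) := (hT _ _ (henc₀ _ _ hIz)).1
          have hup : ∀ {r : ℝ}, law (fun z => p z * V (x z) (c m)) y (y z) ≤
              r * (q (c m) * law p y (y z)) →
              law p (fun z => (I z, y z)) (I z, y z) ≤ a * r * law p y (y z) := by
            intro r h
            rw [hIz]
            refine (hpair m (y z)).trans ?_
            rw [mul_assoc]
            refine mul_le_mul_of_nonneg_left ?_ ha.le
            rw [div_le_iff₀ hq]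
            linarith
          by_cases hb : bad z
          · have := hcase (by positivity) (hup (hΓ' (c m) (y z)))
            rw [Real.log_mul ha.ne' (by positivity), hIz] at this
            simp only [hb, hIz, ne_eq, reduceCtorEq, not_false_eq_true, if_true, one_mul]
            linarith
          · have hGm : G (c m) (y z) := by
              by_contra h
              exact hb ⟨m, hIz, h⟩
            have := hcase (by positivity) (hup (hG (c m) (y z) hGm).2)
            rw [Real.log_mul ha.ne' (by positivity), hIz] at this
            simp only [hb, hIz, ne_eq, reduceCtorEq, not_false_eq_true, if_true, one_mul, if_false,
              zero_mul, add_zero]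
            linarith
      rw [Finset.sum_add_distrib, Finset.sum_add_distrib, ← Finset.sum_mul, ← Finset.sum_mul,
        ← Finset.sum_mul, hp.2, ← prob_eq_sum_mul p bad,
        ← prob_eq_sum_mul p (fun z => I z ≠ none)] at h1
      rw [prob_not hp.2] at he
      nlinarith
    unfold mutualInfo
    rw [entropy_congr p (f := fun z => (y z, (bin (enc₀ (x z))).1))
      (g := fun z => ((bin (I z)).1, y z)) (by simp [hI]; tauto)]
    change entropy p y + entropy p (fun z => (bin (I z)).1) - _ ≤ _
    linarith

end OneShot

section Concentration

variable {ζ : Type*} [Fintype ζ]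

/-- Exponential decay of the probability that an empirical mean exceeds its expectation. -/
lemma exists_prob_sum_gt_le {Q : ζ → ℝ} (hQ : Q ∈ stdSimplex ℝ ζ) (f : ζ → ℝ) {ε : ℝ}
    (hε : 0 < ε) : ∃ ρ : ℝ, 0 < ρ ∧ ρ < 1 ∧ ∀ n : ℕ,
      prob (prodMass Q n) (fun ω => n * (∑ z, Q z * f z) + n * ε < ∑ i, f (ω i)) ≤ ρ ^ n := by
  classical
  set g : ζ → ℝ := fun z => f z - ∑ z, Q z * f z - ε with hg
  have hgm : ∑ z, Q z * g z = -ε := by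
    simp only [hg, mul_sub, Finset.sum_sub_distrib]
    rw [← Finset.sum_mul, ← Finset.sum_mul, hQ.2]
    ring
  set C : ℝ := 1 + ∑ z, |g z| with hC
  have hgC : ∀ z, |g z| ≤ C := fun z => by
    have := Finset.single_le_sum (f := fun z => |g z|) (fun z _ => abs_nonneg _)
      (Finset.mem_univ z)
    linarith
  have hC0 : 0 < C := by
    have : 0 ≤ ∑ z, |g z| := Finset.sum_nonneg fun z _ => abs_nonneg _
    linarith
  set t : ℝ := min (1 / C) (ε / (2 * C ^ 2)) with ht
  have ht0 : 0 < t := by positivity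
  have ht1 : t * C ≤ 1 := by
    have : t ≤ 1 / C := min_le_left _ _
    rwa [le_div_iff₀ hC0] at this
  have ht2 : t * (2 * C ^ 2) ≤ ε := by
    have : t ≤ ε / (2 * C ^ 2) := min_le_right _ _
    rwa [le_div_iff₀ (by positivity)] at this
  have hexp : ∀ z, Real.exp (t * g z) ≤ 1 + t * g z + (t * C) ^ 2 := by
    intro z
    have h1 : |t * g z| ≤ t * C := by
      rw [abs_mul, abs_of_pos ht0]
      exact mul_le_mul_of_nonneg_left (hgC z) ht0.le
    have h2 := Real.abs_exp_sub_one_sub_id_le (h1.trans ht1)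
    have h3 : (t * g z) ^ 2 ≤ (t * C) ^ 2 := by
      rw [← sq_abs (t * g z)]
      exact pow_le_pow_left₀ (abs_nonneg _) h1 2
    have := (abs_le.1 h2).2
    linarith
  have hmgf : ∑ z, Q z * Real.exp (t * g z) ≤ 1 - t * ε / 2 := by
    calc ∑ z, Q z * Real.exp (t * g z) ≤ ∑ z, Q z * (1 + t * g z + (t * C) ^ 2) :=
          Finset.sum_le_sum fun z _ => mul_le_mul_of_nonneg_left (hexp z) (hQ.1 z)
      _ = 1 + t * (∑ z, Q z * g z) + (t * C) ^ 2 := by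
          simp only [mul_add, mul_one, Finset.sum_add_distrib]
          rw [← Finset.sum_mul, hQ.2, Finset.mul_sum, one_mul]
          congr 2
          exact Finset.sum_congr rfl fun z _ => by ring
      _ ≤ 1 - t * ε / 2 := by
          rw [hgm]
          nlinarith
  have hpos : 0 < ∑ z, Q z * Real.exp (t * g z) := by
    have : ∃ z, 0 < Q z := by
      by_contra h0
      push Not at h0
      have := Finset.sum_nonpos fun c (_ : c ∈ Finset.univ) => h0 c
      rw [hQ.2] at this
      linarith
    obtain ⟨z, hz⟩ := this
    exact Finset.sum_pos' (fun z _ => mul_nonneg (hQ.1 z) (Real.exp_pos _).le)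
      ⟨z, Finset.mem_univ z, mul_pos hz (Real.exp_pos _)⟩
  refine ⟨∑ z, Q z * Real.exp (t * g z), hpos, ?_, fun n => ?_⟩
  · have : 0 < t * ε := by positivity
    linarith
  · rw [prob_eq_sum_mul, Fintype.sum_pow]
    refine Finset.sum_le_sum fun ω _ => ?_
    rw [Finset.prod_mul_distrib, ← Real.exp_sum, ← Finset.mul_sum]
    refine mul_le_mul_of_nonneg_left ?_ (Finset.prod_nonneg fun i _ => hQ.1 _)
    split_ifs with h
    · rw [← Real.exp_zero]
      refine Real.exp_le_exp.2 (mul_nonneg ht0.le ?_)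
      simp only [hg, Finset.sum_sub_distrib, Finset.sum_const, Finset.card_univ, Fintype.card_fin,
        nsmul_eq_mul]
      linarith
    · exact (Real.exp_pos _).le

lemma exists_prob_abs_sum_gt_le {Q : ζ → ℝ} (hQ : Q ∈ stdSimplex ℝ ζ) (f : ζ → ℝ) {ε : ℝ}
    (hε : 0 < ε) : ∃ ρ : ℝ, 0 < ρ ∧ ρ < 1 ∧ ∀ n : ℕ,
      prob (prodMass Q n) (fun ω => n * ε < |∑ i, f (ω i) - n * (∑ z, Q z * f z)|) ≤
        2 * ρ ^ n := by
  obtain ⟨ρ₁, h10, h11, h1⟩ := exists_prob_sum_gt_le hQ f hε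
  obtain ⟨ρ₂, h20, h21, h2⟩ := exists_prob_sum_gt_le hQ (fun z => -f z) hε
  refine ⟨max ρ₁ ρ₂, lt_max_of_lt_left h10, max_lt h11 h21, fun n => ?_⟩
  have hQn := prodMass_mem_stdSimplex hQ n
  have h3 := pow_le_pow_left₀ h10.le (le_max_left ρ₁ ρ₂) n
  have h4 := pow_le_pow_left₀ h20.le (le_max_right ρ₁ ρ₂) n
  refine (prob_mono hQn.1 (F := fun ω => (n * (∑ z, Q z * f z) + n * ε < ∑ i, f (ω i)) ∨
    (n * (∑ z, Q z * -f z) + n * ε < ∑ i, -f (ω i))) fun ω hω => ?_).trans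
    ((prob_or_le hQn.1 _ _).trans ?_)
  · simp only [mul_neg, Finset.sum_neg_distrib]
    rcases lt_abs.1 hω with h | h
    · left; linarith
    · right; linarith
  · linarith [h1 n, h2 n]

lemma prob_exists_eq_zero {Q : ζ → ℝ} (n : ℕ) :
    prob (prodMass Q n) (fun ω => ∃ i, Q (ω i) = 0) = 0 := by
  classical
  rw [prob_eq_sum_mul]
  refine Finset.sum_eq_zero fun ω _ => ?_
  split_ifs with h
  · obtain ⟨i, hi⟩ := h
    rw [prodMass, Finset.prod_eq_zero (Finset.mem_univ i) hi, zero_mul]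
  · rw [mul_zero]

end Concentration

section Typicality

variable {𝒵 ξ β 𝒰 : Type*} [Fintype 𝒵]

lemma mutualInfo_eq_sum_log {Ω α γ : Type*} [Fintype Ω] [Fintype α] [Fintype γ] {p : Ω → ℝ}
    (hp : p ∈ stdSimplex ℝ Ω) (f : Ω → α) (g : Ω → γ) :
    mutualInfo p f g = ∑ ω, p ω * Real.log (law p (fun ω => (f ω, g ω)) (f ω, g ω) /
      (law p f (f ω) * law p g (g ω))) := by
  unfold mutualInfo
  rw [entropy_eq_neg_sum, entropy_eq_neg_sum, entropy_eq_neg_sum, sub_neg_eq_add, ← neg_add,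
    neg_add_eq_sub, ← Finset.sum_add_distrib, ← Finset.sum_sub_distrib]
  refine Finset.sum_congr rfl fun ω _ => ?_
  rcases (hp.1 ω).eq_or_lt with h0 | h0
  · simp [← h0]
  · have h1 := law_pos hp.1 f h0
    have h2 := law_pos hp.1 g h0
    rw [Real.log_div (law_pos hp.1 (fun ω => (f ω, g ω)) h0).ne' (by positivity),
      Real.log_mul h1.ne' h2.ne']
    ring

/-- The memoryless extension of a channel. -/
def prodKernel (V : ξ → 𝒰 → ℝ) (n : ℕ) (a : Fin n → ξ) (u : Fin n → 𝒰) : ℝ := ∏ i, V (a i) (u i)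

lemma prodKernel_mem_stdSimplex [Fintype 𝒰] {V : ξ → 𝒰 → ℝ} (hV : ∀ a, V a ∈ stdSimplex ℝ 𝒰) (n : ℕ)
    (a : Fin n → ξ) : prodKernel V n a ∈ stdSimplex ℝ (Fin n → 𝒰) := by
  classical
  refine ⟨fun u => Finset.prod_nonneg fun i _ => (hV _).1 _, ?_⟩
  unfold prodKernel
  rw [← Fintype.piFinset_univ, ← Finset.prod_univ_sum]
  exact Finset.prod_eq_one fun i _ => (hV _).2

lemma sum_prodMass_mul_prodKernel (P : 𝒵 → ℝ) (x : 𝒵 → ξ) (V : ξ → 𝒰 → ℝ) (n : ℕ)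
    (u : Fin n → 𝒰) :
    ∑ z, prodMass P n z * prodKernel V n (fun i => x (z i)) u =
      ∏ i, ∑ z, P z * V (x z) (u i) := by
  classical
  rw [Finset.prod_univ_sum, Fintype.piFinset_univ]
  exact Finset.sum_congr rfl fun z _ => Finset.prod_mul_distrib.symm

lemma law_prodMass_mul_prodKernel (P : 𝒵 → ℝ) (x : 𝒵 → ξ) (y : 𝒵 → β) (V : ξ → 𝒰 → ℝ) (n : ℕ)
    (u : Fin n → 𝒰) (υ : Fin n → β) :
    law (fun z => prodMass P n z * prodKernel V n (fun i => x (z i)) u) (fun z i => y (z i)) υ =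
      ∏ i, law (fun z => P z * V (x z) (u i)) y (υ i) := by
  classical
  simp only [law_apply]
  rw [Finset.prod_univ_sum, Fintype.piFinset_univ]
  refine Finset.sum_congr rfl fun z _ => ?_
  split_ifs with h
  · rw [prodMass, prodKernel, ← Finset.prod_mul_distrib]
    refine Finset.prod_congr rfl fun i _ => ?_
    simp [← h]
  · obtain ⟨i, hi⟩ := Function.ne_iff.1 h
    exact (Finset.prod_eq_zero (Finset.mem_univ i) (by simp [hi])).symm

lemma prob_kernelJoint_prodMass [Fintype 𝒰] (P : 𝒵 → ℝ) (x : 𝒵 → ξ) (V : ξ → 𝒰 → ℝ) (n : ℕ)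
    (E : (Fin n → 𝒰) × (Fin n → 𝒵) → Prop) :
    prob (kernelJoint (prodMass P n) (fun z i => x (z i)) (prodKernel V n)) E =
      prob (prodMass (kernelJoint P x V) n)
        (fun ω => E (fun i => (ω i).1, fun i => (ω i).2)) := by
  classical
  rw [prob_eq_sum_mul, prob_eq_sum_mul,
    ← (Equiv.arrowProdEquivProdArrow (Fin n) (fun _ => 𝒰) (fun _ => 𝒵)).sum_comp]
  refine Finset.sum_congr rfl fun ω _ => ?_
  simp only [Equiv.arrowProdEquivProdArrow, Equiv.coe_fn_mk, kernelJoint, prodMass, prodKernel,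
    Finset.prod_mul_distrib]
  congr 1

/-- Bounds on a likelihood ratio of products from its logarithm. -/
lemma prod_le_of_abs_sum_log_le {n : ℕ} {r t : Fin n → ℝ} (hr : ∀ i, 0 < r i) (ht : ∀ i, 0 < t i)
    {c e : ℝ} (h : |∑ i, Real.log (r i / t i) - c| ≤ e) :
    ∏ i, t i ≤ Real.exp (-(c - e)) * ∏ i, r i ∧ ∏ i, r i ≤ Real.exp (c + e) * ∏ i, t i := by
  have hr' : 0 < ∏ i, r i := Finset.prod_pos fun i _ => hr i
  have ht' : 0 < ∏ i, t i := Finset.prod_pos fun i _ => ht i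
  have h1 : ∑ i, Real.log (r i / t i) = Real.log (∏ i, r i) - Real.log (∏ i, t i) := by
    rw [Real.log_prod fun i _ => (hr i).ne', Real.log_prod fun i _ => (ht i).ne',
      ← Finset.sum_sub_distrib]
    exact Finset.sum_congr rfl fun i _ => Real.log_div (hr i).ne' (ht i).ne'
  rw [h1] at h
  obtain ⟨h2, h3⟩ := abs_le.1 h
  constructor
  · rw [← Real.exp_log ht']
    conv_rhs => rw [← Real.exp_log hr']
    rw [← Real.exp_add]
    exact Real.exp_le_exp.2 (by linarith)
  · rw [← Real.exp_log hr']
    conv_rhs => rw [← Real.exp_log ht']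
    rw [← Real.exp_add]
    exact Real.exp_le_exp.2 (by linarith)

/-- Typicality of codeword and encoder measurement. -/
lemma exists_covering_relation [Fintype 𝒰] [Fintype ξ] {P : 𝒵 → ℝ} (hP : P ∈ stdSimplex ℝ 𝒵)
    (x : 𝒵 → ξ) {V : ξ → 𝒰 → ℝ} (hV : ∀ a, V a ∈ stdSimplex ℝ 𝒰) {ε : ℝ} (hε : 0 < ε) :
    ∃ ρ : ℝ, 0 < ρ ∧ ρ < 1 ∧ ∀ n : ℕ, ∃ T : (Fin n → 𝒰) → (Fin n → ξ) → Prop,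
      (∀ u a, T u a →
        0 < (∑ z, prodMass P n z * prodKernel V n (fun i => x (z i)) u) ∧
        ∑ z, prodMass P n z * prodKernel V n (fun i => x (z i)) u ≤
          Real.exp (-(n * kernelInfo P x V x - n * ε)) * prodKernel V n a u ∧
        prodKernel V n a u ≤ Real.exp (n * kernelInfo P x V x + n * ε) *
          ∑ z, prodMass P n z * prodKernel V n (fun i => x (z i)) u) ∧
      prob (kernelJoint (prodMass P n) (fun z i => x (z i)) (prodKernel V n))
        (fun ω => ¬ T ω.1 (fun i => x (ω.2 i))) ≤ 2 * ρ ^ n := by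
  classical
  set q : 𝒰 → ℝ := fun u => ∑ z, P z * V (x z) u with hq
  have hQ := kernelJoint_mem_stdSimplex hP x hV
  set f : 𝒰 × 𝒵 → ℝ := fun ω => Real.log (V (x ω.2) ω.1 / q ω.1) with hf
  have hpos : ∀ ω, 0 < kernelJoint P x V ω → 0 < V (x ω.2) ω.1 ∧ 0 < q ω.1 := by
    intro ω h
    have h1 := law_pos hQ.1 (fun ω => ω.1) h
    rw [law_kernelJoint_fst] at h1
    exact ⟨pos_of_mul_pos_right h (hP.1 _), h1⟩
  have hmean : ∑ ω, kernelJoint P x V ω * f ω = kernelInfo P x V x := by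
    rw [kernelInfo, mutualInfo_eq_sum_log hQ]
    refine Finset.sum_congr rfl fun ω _ => ?_
    rcases (hQ.1 ω).eq_or_lt with h0 | h0
    · simp [← h0]
    · obtain ⟨h1, h2⟩ := hpos ω h0
      have h3 := law_pos hQ.1 (fun ω => x ω.2) h0
      rw [law_kernelJoint_snd P x (fun a => (hV a).2) x] at h3
      rw [law_kernelJoint_fst, law_kernelJoint_pair P x V x,
        law_kernelJoint_snd P x (fun a => (hV a).2) x]
      have h4 : law (fun z => P z * V (x z) ω.1) x (x ω.2) =
          V (x ω.2) ω.1 * law P x (x ω.2) := by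
        rw [law_apply, law_apply, Finset.mul_sum]
        refine Finset.sum_congr rfl fun z _ => ?_
        split_ifs with h
        · rw [h]; ring
        · ring
      rw [h4, mul_div_mul_right _ _ h3.ne']
  obtain ⟨ρ, h0, h1, h2⟩ := exists_prob_abs_sum_gt_le hQ f hε
  refine ⟨ρ, h0, h1, fun n => ⟨fun u a => (∀ i, 0 < V (a i) (u i) ∧ 0 < q (u i)) ∧
    |∑ i, Real.log (V (a i) (u i) / q (u i)) - n * kernelInfo P x V x| ≤ n * ε, ?_, ?_⟩⟩
  · rintro u a ⟨hpos, habs⟩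
    rw [sum_prodMass_mul_prodKernel]
    have := prod_le_of_abs_sum_log_le (fun i => (hpos i).1) (fun i => (hpos i).2) habs
    exact ⟨Finset.prod_pos fun i _ => (hpos i).2, this.1, this.2⟩
  · rw [prob_kernelJoint_prodMass P x V n (fun ω => ¬ ((∀ i, 0 < V (x (ω.2 i)) (ω.1 i) ∧
      0 < q (ω.1 i)) ∧ |∑ i, Real.log (V (x (ω.2 i)) (ω.1 i) / q (ω.1 i)) -
        n * kernelInfo P x V x| ≤ n * ε))]
    have hQn := prodMass_mem_stdSimplex hQ n
    refine (prob_mono hQn.1 (F := fun ω => (∃ i, kernelJoint P x V (ω i) = 0) ∨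
      n * ε < |∑ i, f (ω i) - n * (∑ ω, kernelJoint P x V ω * f ω)|) fun ω hω => ?_).trans
      ((prob_or_le hQn.1 _ _).trans ?_)
    · by_contra hcon
      push Not at hcon
      rw [hmean] at hcon
      exact hω ⟨fun i => hpos (ω i) ((hQ.1 _).lt_of_ne' (hcon.1 i)), hcon.2⟩
    · rw [prob_exists_eq_zero, zero_add]
      exact h2 n

/-- Typicality of codeword and decoder measurement. -/
lemma exists_packing_relation [Fintype 𝒰] [Fintype β] {P : 𝒵 → ℝ} (hP : P ∈ stdSimplex ℝ 𝒵)
    (x : 𝒵 → ξ) (y : 𝒵 → β) {V : ξ → 𝒰 → ℝ} (hV : ∀ a, V a ∈ stdSimplex ℝ 𝒰) {ε : ℝ} (hε : 0 < ε) :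
    ∃ ρ : ℝ, 0 < ρ ∧ ρ < 1 ∧ ∀ n : ℕ, ∃ G : (Fin n → 𝒰) → (Fin n → β) → Prop,
      (∀ u υ, G u υ →
        (∑ z, prodMass P n z * prodKernel V n (fun i => x (z i)) u) *
            law (prodMass P n) (fun z i => y (z i)) υ ≤
          Real.exp (-(n * kernelInfo P x V y - n * ε)) *
            law (fun z => prodMass P n z * prodKernel V n (fun i => x (z i)) u)
              (fun z i => y (z i)) υ ∧
        law (fun z => prodMass P n z * prodKernel V n (fun i => x (z i)) u)
            (fun z i => y (z i)) υ ≤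
          Real.exp (n * kernelInfo P x V y + n * ε) *
            ((∑ z, prodMass P n z * prodKernel V n (fun i => x (z i)) u) *
              law (prodMass P n) (fun z i => y (z i)) υ)) ∧
      prob (kernelJoint (prodMass P n) (fun z i => x (z i)) (prodKernel V n))
        (fun ω => ¬ G ω.1 (fun i => y (ω.2 i))) ≤ 2 * ρ ^ n := by
  classical
  set q : 𝒰 → ℝ := fun u => ∑ z, P z * V (x z) u with hq
  set J : 𝒰 → β → ℝ := fun u b => law (fun z => P z * V (x z) u) y b with hJ
  have hQ := kernelJoint_mem_stdSimplex hP x hV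
  set f : 𝒰 × 𝒵 → ℝ := fun ω => Real.log (J ω.1 (y ω.2) / (q ω.1 * law P y (y ω.2))) with hf
  have hpos : ∀ ω, 0 < kernelJoint P x V ω →
      0 < J ω.1 (y ω.2) ∧ 0 < q ω.1 * law P y (y ω.2) := by
    intro ω h
    have h1 := law_pos hQ.1 (fun ω => ω.1) h
    rw [law_kernelJoint_fst] at h1
    have h2 := law_pos hQ.1 (fun ω => (ω.1, y ω.2)) h
    rw [law_kernelJoint_pair P x V y] at h2
    have h3 := law_pos hQ.1 (fun ω => y ω.2) h
    rw [law_kernelJoint_snd P x (fun a => (hV a).2) y] at h3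
    exact ⟨h2, mul_pos h1 h3⟩
  have hmean : ∑ ω, kernelJoint P x V ω * f ω = kernelInfo P x V y := by
    rw [kernelInfo, mutualInfo_eq_sum_log hQ]
    refine Finset.sum_congr rfl fun ω _ => ?_
    rw [law_kernelJoint_fst, law_kernelJoint_pair P x V y,
      law_kernelJoint_snd P x (fun a => (hV a).2) y]
  obtain ⟨ρ, h0, h1, h2⟩ := exists_prob_abs_sum_gt_le hQ f hε
  refine ⟨ρ, h0, h1, fun n => ⟨fun u υ => (∀ i, 0 < J (u i) (υ i) ∧ 0 < q (u i) * law P y (υ i)) ∧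
    |∑ i, Real.log (J (u i) (υ i) / (q (u i) * law P y (υ i))) - n * kernelInfo P x V y| ≤ n * ε,
    ?_, ?_⟩⟩
  · rintro u υ ⟨hpos, habs⟩
    rw [sum_prodMass_mul_prodKernel, law_prodMass_mul_prodKernel, law_prodMass]
    have := prod_le_of_abs_sum_log_le (fun i => (hpos i).1) (fun i => (hpos i).2) habs
    rw [Finset.prod_mul_distrib] at this
    exact this
  · rw [prob_kernelJoint_prodMass P x V n (fun ω => ¬ ((∀ i, 0 < J (ω.1 i) (y (ω.2 i)) ∧
      0 < q (ω.1 i) * law P y (y (ω.2 i))) ∧ |∑ i, Real.log (J (ω.1 i) (y (ω.2 i)) /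
        (q (ω.1 i) * law P y (y (ω.2 i)))) - n * kernelInfo P x V y| ≤ n * ε))]
    have hQn := prodMass_mem_stdSimplex hQ n
    refine (prob_mono hQn.1 (F := fun ω => (∃ i, kernelJoint P x V (ω i) = 0) ∨
      n * ε < |∑ i, f (ω i) - n * (∑ ω, kernelJoint P x V ω * f ω)|) fun ω hω => ?_).trans
      ((prob_or_le hQn.1 _ _).trans ?_)
    · by_contra hcon
      push Not at hcon
      rw [hmean] at hcon
      exact hω ⟨fun i => hpos (ω i) ((hQ.1 _).lt_of_ne' (hcon.1 i)), hcon.2⟩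
    · rw [prob_exists_eq_zero, zero_add]
      exact h2 n

/-- The likelihood ratio of a memoryless extension grows at most exponentially. -/
lemma exists_likelihood_ratio_bound [Fintype 𝒰] [Fintype β] {P : 𝒵 → ℝ}
    (hP : P ∈ stdSimplex ℝ 𝒵) (x : 𝒵 → ξ) (y : 𝒵 → β) {V : ξ → 𝒰 → ℝ}
    (hV : ∀ a, V a ∈ stdSimplex ℝ 𝒰) :
    ∃ C : ℝ, 1 ≤ C ∧ ∀ (n : ℕ) (u : Fin n → 𝒰) (υ : Fin n → β),
      law (fun z => prodMass P n z * prodKernel V n (fun i => x (z i)) u) (fun z i => y (z i)) υ ≤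
        C ^ n * ((∑ z, prodMass P n z * prodKernel V n (fun i => x (z i)) u) *
          law (prodMass P n) (fun z i => y (z i)) υ) := by
  classical
  set q : 𝒰 → ℝ := fun u => ∑ z, P z * V (x z) u with hq
  set J : 𝒰 → β → ℝ := fun u b => law (fun z => P z * V (x z) u) y b with hJ
  have hpV : ∀ u z, 0 ≤ P z * V (x z) u := fun u z => mul_nonneg (hP.1 z) ((hV _).1 u)
  have hJ0 : ∀ u b, 0 ≤ J u b := fun u b => law_nonneg (hpV u) y b
  have hq0 : ∀ u, 0 ≤ q u := fun u => Finset.sum_nonneg fun z _ => hpV u z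
  have hy0 : ∀ b, 0 ≤ law P y b := fun b => law_nonneg hP.1 y b
  have hJq : ∀ u b, J u b ≤ q u := by
    intro u b
    exact (Finset.single_le_sum (fun b _ => hJ0 u b) (Finset.mem_univ b)).trans_eq
      (sum_law (fun z => P z * V (x z) u) y)
  have hJy : ∀ u b, J u b ≤ law P y b := by
    intro u b
    simp only [hJ, law_apply]
    refine Finset.sum_le_sum fun z _ => ?_
    have h1 : V (x z) u ≤ 1 := by
      rw [← (hV (x z)).2]
      exact Finset.single_le_sum (fun u _ => (hV (x z)).1 u) (Finset.mem_univ u)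
    split_ifs
    · exact mul_le_of_le_one_right (hP.1 z) h1
    · exact le_rfl
  set C : ℝ := 1 + ∑ ub : 𝒰 × β, J ub.1 ub.2 / (q ub.1 * law P y ub.2) with hC
  have hnn : ∀ ub : 𝒰 × β, 0 ≤ J ub.1 ub.2 / (q ub.1 * law P y ub.2) := fun ub =>
    div_nonneg (hJ0 _ _) (mul_nonneg (hq0 _) (hy0 _))
  have hC1 : 1 ≤ C := by
    have : 0 ≤ ∑ ub : 𝒰 × β, J ub.1 ub.2 / (q ub.1 * law P y ub.2) :=
      Finset.sum_nonneg fun ub _ => hnn ub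
    linarith
  refine ⟨C, hC1, fun n u υ => ?_⟩
  rw [sum_prodMass_mul_prodKernel, law_prodMass_mul_prodKernel, law_prodMass, prodMass,
    ← Finset.prod_mul_distrib]
  have hCn : C ^ n = ∏ _i : Fin n, C := by simp
  rw [hCn, ← Finset.prod_mul_distrib]
  refine Finset.prod_le_prod (fun i _ => hJ0 _ _) fun i _ => ?_
  change J (u i) (υ i) ≤ C * (q (u i) * law P y (υ i))
  rcases (mul_nonneg (hq0 (u i)) (hy0 (υ i))).eq_or_lt with h0 | h0
  · rw [← h0, mul_zero]
    rcases mul_eq_zero.1 h0.symm with h | h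
    · exact h ▸ hJq (u i) (υ i)
    · exact h ▸ hJy (u i) (υ i)
  · rw [← div_le_iff₀ h0]
    have := Finset.single_le_sum (fun ub _ => hnn ub) (Finset.mem_univ (u i, υ i))
    simp only at this
    linarith

end Typicality

section Asymptotics

open Filter Topology

/-- The error terms of the random coding scheme vanish. -/
lemma eventually_error_terms_le {ρ η σ τ : ℝ} (hρ : 0 < ρ ∧ ρ < 1) (hη : 0 < η ∧ η < 1)
    (hσ : 0 < σ ∧ σ < 1) (hτ : 0 < τ ∧ τ < 1) (c₁ c₂ c₃ c₄ : ℝ) {δ : ℝ} (hδ : 0 < δ) :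
    ∀ᶠ n : ℕ in atTop,
      3 * (2 * τ ^ n + 3 * (2 * ρ ^ n + η ^ n) * (n * c₁)) ≤ δ ∧
      3 * (2 * ρ ^ n + η ^ n) + 3 * (4 * σ ^ n) + 9 * (2 * τ ^ n) ≤ δ ∧
      2 * Real.log 2 / n + 3 * (2 * ρ ^ n + η ^ n) * c₂ + 3 * (4 * σ ^ n) * c₃ +
        (3 * (2 * ρ ^ n + η ^ n) + 3 * (4 * σ ^ n) + 9 * (2 * τ ^ n)) * c₄ ≤ δ := by
  have hp : ∀ {r : ℝ}, 0 < r ∧ r < 1 → Tendsto (fun n : ℕ => r ^ n) atTop (𝓝 0) := fun h =>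
    tendsto_pow_atTop_nhds_zero_of_lt_one h.1.le h.2
  have hnp : ∀ {r : ℝ}, 0 < r ∧ r < 1 → Tendsto (fun n : ℕ => n * r ^ n) atTop (𝓝 0) := fun h =>
    tendsto_self_mul_const_pow_of_lt_one h.1.le h.2
  have hA : Tendsto (fun n : ℕ => 3 * (2 * ρ ^ n + η ^ n)) atTop (𝓝 0) := by
    simpa using (((hp hρ).const_mul 2).add (hp hη)).const_mul 3
  have hC : Tendsto (fun n : ℕ => 3 * (4 * σ ^ n)) atTop (𝓝 0) := by
    simpa using ((hp hσ).const_mul 4).const_mul 3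
  have hT : Tendsto (fun n : ℕ => 9 * (2 * τ ^ n)) atTop (𝓝 0) := by
    simpa using ((hp hτ).const_mul 2).const_mul 9
  have hE : Tendsto (fun n : ℕ => 3 * (2 * ρ ^ n + η ^ n) + 3 * (4 * σ ^ n) + 9 * (2 * τ ^ n))
      atTop (𝓝 0) := by
    simpa using (hA.add hC).add hT
  have h1 : Tendsto (fun n : ℕ => 3 * (2 * τ ^ n + 3 * (2 * ρ ^ n + η ^ n) * (n * c₁)))
      atTop (𝓝 0) := by
    have := (((hp hτ).const_mul 2).add
      (((((hnp hρ).const_mul 2).add (hnp hη)).const_mul 3).mul_const c₁)).const_mul 3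
    simp only [mul_zero, add_zero, zero_mul] at this
    refine this.congr fun n => ?_
    ring
  have h3 : Tendsto (fun n : ℕ => 2 * Real.log 2 / n + 3 * (2 * ρ ^ n + η ^ n) * c₂ +
      3 * (4 * σ ^ n) * c₃ + (3 * (2 * ρ ^ n + η ^ n) + 3 * (4 * σ ^ n) + 9 * (2 * τ ^ n)) * c₄)
      atTop (𝓝 0) := by
    have := (((tendsto_const_div_atTop_nhds_zero_nat (2 * Real.log 2)).add (hA.mul_const c₂)).add
      (hC.mul_const c₃)).add (hE.mul_const c₄)
    simpa using this
  filter_upwards [h1.eventually_le_const hδ, hE.eventually_le_const hδ,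
    h3.eventually_le_const hδ] with n a b c using ⟨a, b, c⟩

lemma natCeil_exp_bounds {t : ℝ} (ht : 0 ≤ t) :
    Real.exp t ≤ ⌈Real.exp t⌉₊ ∧ (⌈Real.exp t⌉₊ : ℝ) ≤ 2 * Real.exp t ∧ 0 < ⌈Real.exp t⌉₊ := by
  have h1 := Real.one_le_exp ht
  refine ⟨Nat.le_ceil _, ?_, Nat.ceil_pos.2 (Real.exp_pos t)⟩
  have := Nat.ceil_lt_add_one (Real.exp_pos t).le
  linarith

variable {𝒵 ξ β 𝒰 : Type*} [Fintype 𝒵] [Fintype ξ] [Fintype β] [Fintype 𝒰]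

lemma kernelInfo_le_kernelInfo_self {P : 𝒵 → ℝ} (hP : P ∈ stdSimplex ℝ 𝒵) (x : 𝒵 → ξ) (y : 𝒵 → β)
    {V : ξ → 𝒰 → ℝ} (hV : ∀ a, V a ∈ stdSimplex ℝ 𝒰) :
    kernelInfo P x V y ≤ kernelInfo P x V x := by
  have h : IsMarkovChain P x x y := by
    intro a b c
    by_cases hab : a = b
    · subst hab
      rw [law_congr_of_iff P (f := fun ω => (x ω, x ω, y ω)) (g := fun ω => (x ω, y ω))
          (b := (a, c)) (by simp), law_congr_of_iff P (f := fun ω => (x ω, x ω)) (g := x)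
          (b := a) (by simp), mul_comm]
    · have h0 : ∀ {κ : Type _} (f : 𝒵 → κ) (k : κ), (∀ z, f z ≠ k) → law P f k = 0 := by
        classical
        intro κ f k h
        rw [law_apply]
        simp [h]
      rw [law_congr_of_iff P (f := fun ω => (x ω, x ω, y ω)) (a := (a, b, c))
          (g := fun ω => (x ω, x ω)) (b := (a, b)) (by
            intro z
            simp only [Prod.mk.injEq]
            constructor
            · exact fun h => ⟨h.1, h.2.1⟩
            · exact fun h => absurd (h.1.symm.trans h.2) hab),
        h0 (fun ω => (x ω, x ω)) (a, b) (by
            intro z h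
            simp only [Prod.mk.injEq] at h
            exact hab (h.1.symm.trans h.2))]
      ring
  exact (h.kernelJoint fun a => (hV a).2).mutualInfo_le (kernelJoint_mem_stdSimplex hP _ hV)

/-- Block codes for the generated-secret model at every key rate below `I(U; Y)`. -/
lemma exists_block_code {P : 𝒵 → ℝ} (hP : P ∈ stdSimplex ℝ 𝒵) (x : 𝒵 → ξ) (y : 𝒵 → β)
    {V : ξ → 𝒰 → ℝ} (hV : ∀ a, V a ∈ stdSimplex ℝ 𝒰) {r δ : ℝ} (hr0 : 0 ≤ r)
    (hr : r < kernelInfo P x V y) (hδ : 0 < δ) :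
    ∀ᶠ n : ℕ in atTop, ∀ s : ℕ, 0 < s → Real.log s = n * r → ∃ w : ℕ, 0 < w ∧
      ∃ (enc : (Fin n → ξ) → Fin w × Fin s) (dec : Fin w × (Fin n → β) → Fin s),
        Real.log (w * s) - entropy (prodMass P n) (fun z => enc (fun i => x (z i))) ≤ δ ∧
        prob (prodMass P n) (fun z => (enc (fun i => x (z i))).2 ≠
          dec ((enc (fun i => x (z i))).1, fun i => y (z i))) ≤ δ ∧
        mutualInfo (prodMass P n) (fun z i => y (z i)) (fun z => (enc (fun i => x (z i))).1) ≤
          n * δ ∧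
        Real.log w ≤ n * (kernelInfo P x V x - kernelInfo P x V y + δ) := by
  have hxy := kernelInfo_le_kernelInfo_self hP x y hV
  set Ix := kernelInfo P x V x with hIx
  set Iy := kernelInfo P x V y with hIy
  set ε₂ : ℝ := min ((Iy - r) / 6) (δ / 16) with hε₂
  have hε₂0 : 0 < ε₂ := lt_min (by linarith) (by linarith)
  have hε₂r : 6 * ε₂ ≤ Iy - r := by
    have : ε₂ ≤ (Iy - r) / 6 := min_le_left _ _
    linarith
  have hε₂δ : 16 * ε₂ ≤ δ := by
    have : ε₂ ≤ δ / 16 := min_le_right _ _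
    linarith
  obtain ⟨ρ₂, hρ₂0, hρ₂1, hpack⟩ := exists_packing_relation hP x y hV hε₂0
  have hlogρ₂ : Real.log ρ₂ < 0 := Real.log_neg hρ₂0 hρ₂1
  set ε : ℝ := min ε₂ (-Real.log ρ₂ / 6) with hε
  have hε0 : 0 < ε := lt_min hε₂0 (by linarith)
  have hεε₂ : ε ≤ ε₂ := min_le_left _ _
  have hερ : 6 * ε ≤ -Real.log ρ₂ := by
    have : ε ≤ -Real.log ρ₂ / 6 := min_le_right _ _
    linarith
  obtain ⟨ρ₁, hρ₁0, hρ₁1, hcov⟩ := exists_covering_relation hP x hV hε0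
  obtain ⟨C₀, hC₀1, hC₀⟩ := exists_likelihood_ratio_bound hP x y hV
  set η := Real.exp (-ε) with hη
  set τ := Real.exp (-ε₂) with hτ
  set σ := Real.exp (3 * ε) * ρ₂ with hσ
  have hη01 : 0 < η ∧ η < 1 := ⟨Real.exp_pos _, Real.exp_lt_one_iff.2 (by linarith)⟩
  have hτ01 : 0 < τ ∧ τ < 1 := ⟨Real.exp_pos _, Real.exp_lt_one_iff.2 (by linarith)⟩
  have hσ01 : 0 < σ ∧ σ < 1 := by
    refine ⟨by positivity, ?_⟩
    have h : σ = Real.exp (3 * ε + Real.log ρ₂) := by rw [Real.exp_add, Real.exp_log hρ₂0]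
    rw [h]
    exact Real.exp_lt_one_iff.2 (by linarith)
  set c₁ : ℝ := Ix - Iy + 4 * ε₂ + Real.log 2 + r with hc₁
  set c₄ : ℝ := Ix + 2 * ε + Real.log 3 with hc₄
  have hlog2 : 0 < Real.log 2 := Real.log_pos (by norm_num)
  filter_upwards [eventually_error_terms_le ⟨hρ₁0, hρ₁1⟩ hη01 hσ01 hτ01 c₁ Ix (Real.log C₀) c₄
    (half_pos hδ), eventually_ge_atTop 1] with n hn hn1 s hs hlogs
  obtain ⟨he1, he2, he3⟩ := hn
  have hn1' : (1 : ℝ) ≤ n := by exact_mod_cast hn1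
  have hn0 : (0 : ℝ) < n := by linarith
  have hnlog2 : Real.log 2 ≤ n * Real.log 2 := le_mul_of_one_le_left hlog2.le hn1'
  have hnε : n * ε ≤ n * ε₂ := mul_le_mul_of_nonneg_left hεε₂ hn0.le
  have hnε₂ : 0 < n * ε₂ := by positivity
  have hnr : n * (6 * ε₂) ≤ n * (Iy - r) := mul_le_mul_of_nonneg_left hε₂r hn0.le
  have hnδ : n * (16 * ε₂) ≤ n * δ := mul_le_mul_of_nonneg_left hε₂δ hn0.le
  obtain ⟨T, hT, hTp⟩ := hcov n
  obtain ⟨G, hG, hGp⟩ := hpack n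
  have hηn : η ^ n = Real.exp (-(n * ε)) := by rw [hη, ← Real.exp_nat_mul]; congr 1; ring
  have hτn : τ ^ n = Real.exp (-(n * ε₂)) := by rw [hτ, ← Real.exp_nat_mul]; congr 1; ring
  have hσn : σ ^ n = Real.exp (n * (3 * ε)) * ρ₂ ^ n := by
    rw [hσ, mul_pow, ← Real.exp_nat_mul]
  have hs' : (s : ℝ) = Real.exp (n * r) := by
    rw [← hlogs, Real.exp_log (by exact_mod_cast hs)]
  obtain ⟨hM1, hM2, hM0⟩ := natCeil_exp_bounds (t := n * (Ix + 2 * ε)) (by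
    have : 0 ≤ Ix + 2 * ε := by linarith
    positivity)
  set M := ⌈Real.exp (n * (Ix + 2 * ε))⌉₊ with hM
  obtain ⟨hw1, hw2, hw0⟩ := natCeil_exp_bounds (t := n * (Ix - Iy + 4 * ε₂)) (by
    have : 0 ≤ Ix - Iy + 4 * ε₂ := by linarith
    positivity)
  set w := ⌈Real.exp (n * (Ix - Iy + 4 * ε₂))⌉₊ with hw
  have hw0' : (0 : ℝ) < w := by exact_mod_cast hw0
  have hs0' : (0 : ℝ) < s := by exact_mod_cast hs
  have hM0' : (0 : ℝ) < M := by exact_mod_cast hM0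
  have hlogw : Real.log w ≤ Real.log 2 + n * (Ix - Iy + 4 * ε₂) := by
    have := Real.log_le_log hw0' hw2
    rwa [Real.log_mul (by norm_num) (Real.exp_pos _).ne', Real.log_exp] at this
  have hlogws : Real.log (w * s) ≤ n * c₁ := by
    rw [Real.log_mul hw0'.ne' hs0'.ne', hlogs, hc₁]
    linarith
  have hlogM : Real.log (M + 1) ≤ n * c₄ := by
    have h1 : (M : ℝ) + 1 ≤ 3 * Real.exp (n * (Ix + 2 * ε)) := by
      have : 1 ≤ Real.exp (n * (Ix + 2 * ε)) := Real.one_le_exp (by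
        have : 0 ≤ Ix + 2 * ε := by linarith
        positivity)
      linarith
    have h2 := Real.log_le_log (by positivity) h1
    rw [Real.log_mul (by norm_num) (Real.exp_pos _).ne', Real.log_exp] at h2
    have h3 : 0 < Real.log 3 := Real.log_pos (by norm_num)
    have h4 : Real.log 3 ≤ n * Real.log 3 := le_mul_of_one_le_left h3.le hn1'
    rw [hc₄]
    linarith
  have hA : prob (kernelJoint (prodMass P n) (fun z i => x (z i)) (prodKernel V n))
      (fun ω => ¬ T ω.1 (fun i => x (ω.2 i))) + Real.exp (-(M / Real.exp (n * Ix + n * ε))) ≤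
        2 * ρ₁ ^ n + η ^ n := by
    refine add_le_add hTp ?_
    rw [hηn]
    refine Real.exp_le_exp.2 (neg_le_neg ?_)
    rw [le_div_iff₀ (Real.exp_pos _)]
    refine le_trans ?_ hM1
    have h1 : n * ε ≤ Real.exp (n * ε) := by
      have := Real.add_one_le_exp (n * ε)
      linarith
    calc n * ε * Real.exp (n * Ix + n * ε) ≤ Real.exp (n * ε) * Real.exp (n * Ix + n * ε) := by
          gcongr
      _ = Real.exp (n * (Ix + 2 * ε)) := by rw [← Real.exp_add]; congr 1; ring
  have hB : M * Real.exp (-(n * Iy - n * ε₂)) ≤ 2 * τ ^ n * w := by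
    calc M * Real.exp (-(n * Iy - n * ε₂))
        ≤ 2 * Real.exp (n * (Ix + 2 * ε)) * Real.exp (-(n * Iy - n * ε₂)) := by gcongr
      _ = 2 * Real.exp (n * (Ix + 2 * ε) + -(n * Iy - n * ε₂)) := by rw [Real.exp_add]; ring
      _ ≤ 2 * Real.exp (-(n * ε₂) + n * (Ix - Iy + 4 * ε₂)) := by
          refine mul_le_mul_of_nonneg_left (Real.exp_le_exp.2 ?_) zero_le_two
          linarith
      _ = 2 * τ ^ n * Real.exp (n * (Ix - Iy + 4 * ε₂)) := by rw [Real.exp_add, hτn]; ring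
      _ ≤ 2 * τ ^ n * w := by
          have := hτ01.1
          gcongr
  have hGp0 := prob_nonneg (kernelJoint_mem_stdSimplex (prodMass_mem_stdSimplex hP n)
    (fun z i => x (z i)) (prodKernel_mem_stdSimplex hV n)).1
    (fun ω => ¬ G ω.1 (fun i => y (ω.2 i)))
  have hC : M * (Real.exp (-(n * Ix - n * ε)) *
      prob (kernelJoint (prodMass P n) (fun z i => x (z i)) (prodKernel V n))
        (fun ω => ¬ G ω.1 (fun i => y (ω.2 i)))) ≤ 4 * σ ^ n := by
    calc M * (Real.exp (-(n * Ix - n * ε)) *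
        prob (kernelJoint (prodMass P n) (fun z i => x (z i)) (prodKernel V n))
          (fun ω => ¬ G ω.1 (fun i => y (ω.2 i))))
        ≤ 2 * Real.exp (n * (Ix + 2 * ε)) * (Real.exp (-(n * Ix - n * ε)) * (2 * ρ₂ ^ n)) :=
          mul_le_mul hM2 (mul_le_mul_of_nonneg_left hGp (Real.exp_pos _).le)
            (mul_nonneg (Real.exp_pos _).le hGp0) (by positivity)
      _ = 4 * (Real.exp (n * (Ix + 2 * ε) + -(n * Ix - n * ε)) * ρ₂ ^ n) := by
          rw [Real.exp_add]; ring
      _ = 4 * σ ^ n := by rw [hσn]; congr 3; ring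
  have hA0 : 0 < 2 * ρ₁ ^ n + η ^ n := by
    have := hη01.1
    positivity
  have hwsa : (w * s : ℝ) * Real.exp (-(n * Ix - n * ε)) ≤ 2 * τ ^ n := by
    calc (w * s : ℝ) * Real.exp (-(n * Ix - n * ε))
        ≤ 2 * Real.exp (n * (Ix - Iy + 4 * ε₂)) * s * Real.exp (-(n * Ix - n * ε)) := by gcongr
      _ = 2 * Real.exp (n * (Ix - Iy + 4 * ε₂) + n * r + -(n * Ix - n * ε)) := by
          rw [hs', Real.exp_add, Real.exp_add]; ring
      _ ≤ 2 * Real.exp (-(n * ε₂)) := by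
          refine mul_le_mul_of_nonneg_left (Real.exp_le_exp.2 ?_) zero_le_two
          linarith
      _ = 2 * τ ^ n := by rw [hτn]
  have hD : (w * s : ℝ) * Real.exp (-(n * Ix - n * ε)) +
      3 * (2 * ρ₁ ^ n + η ^ n) * Real.log (w * s) ≤
        2 * τ ^ n + 3 * (2 * ρ₁ ^ n + η ^ n) * (n * c₁) := by
    gcongr
  have hτn0 : 0 < τ ^ n := pow_pos hτ01.1 n
  have hσn0 : 0 < σ ^ n := pow_pos hσ01.1 n
  have hD0 : 0 < 2 * τ ^ n + 3 * (2 * ρ₁ ^ n + η ^ n) * (n * c₁) := by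
    have : 0 ≤ c₁ := by rw [hc₁]; linarith
    positivity
  have hεIx : n * ε ≤ n * Ix := mul_le_mul_of_nonneg_left (by linarith) hn0.le
  obtain ⟨enc, dec, h1, h2, h3⟩ := exists_one_shot_code (prodMass_mem_stdSimplex hP n)
    (fun z i => x (z i)) (fun z i => y (z i)) (prodKernel_mem_stdSimplex hV n) T G
    (Real.exp_pos _) (Real.exp_le_one_iff.2 (by linarith)) (Real.exp_pos _) (Real.exp_pos _).le
    (Real.one_le_exp (by
      have : 0 ≤ Iy := by linarith
      positivity)) (one_le_pow₀ hC₀1 (n := n)) hT hG (hC₀ n) M hw0 hs hA0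
    (B := 2 * τ ^ n * w) (by positivity) (by positivity) hD0 hA hB hC hD
  rw [mul_div_assoc, div_self hw0'.ne', mul_one] at h2 h3
  refine ⟨w, hw0, enc, dec, by linarith, by linarith, h3.trans ?_, ?_⟩
  · rw [Real.log_exp, Real.log_exp, Real.log_pow]
    set A := 3 * (2 * ρ₁ ^ n + η ^ n) with hAdef
    set Pe := A + 3 * (4 * σ ^ n) + 9 * (2 * τ ^ n) with hPe
    have hPe0 : 0 ≤ Pe := by positivity
    have hA0' : 0 ≤ A := by positivity
    have h4 : Pe * Real.log (M + 1) ≤ Pe * (n * c₄) := mul_le_mul_of_nonneg_left hlogM hPe0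
    have h5 : n * (2 * Real.log 2 / n + A * Ix + 3 * (4 * σ ^ n) * Real.log C₀ + Pe * c₄) ≤
        n * (δ / 2) := mul_le_mul_of_nonneg_left he3 hn0.le
    have h6 : n * (2 * Real.log 2 / n + A * Ix + 3 * (4 * σ ^ n) * Real.log C₀ + Pe * c₄) =
        2 * Real.log 2 + A * (n * Ix) + 3 * (4 * σ ^ n) * (n * Real.log C₀) + Pe * (n * c₄) := by
      field_simp
    have h7 : 0 ≤ A * (n * ε) := by positivity
    rw [h6] at h5
    linarith
  · have h4 : Real.log 2 ≤ n * (δ / 2) := by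
      have hA0' : 0 ≤ 3 * (2 * ρ₁ ^ n + η ^ n) := by positivity
      have h5 : 2 * Real.log 2 / n ≤ δ / 2 := by
        have h6 : 0 ≤ Real.log C₀ := Real.log_nonneg hC₀1
        have h7 : 0 ≤ Ix := by linarith
        have h8 : 0 ≤ c₄ := by
          have : 0 < Real.log 3 := Real.log_pos (by norm_num)
          rw [hc₄]; linarith
        refine le_trans ?_ he3
        have : 0 ≤ 3 * (2 * ρ₁ ^ n + η ^ n) * Ix + 3 * (4 * σ ^ n) * Real.log C₀ +
          (3 * (2 * ρ₁ ^ n + η ^ n) + 3 * (4 * σ ^ n) + 9 * (2 * τ ^ n)) * c₄ := by positivity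
        linarith
      rw [div_le_iff₀ hn0] at h5
      linarith
    linarith

end Asymptotics

section Markov

variable {Ω α α' β γ : Type*} [Fintype Ω]

lemma mutualInfo_comm [Fintype α] [Fintype β] (p : Ω → ℝ) (f : Ω → α) (g : Ω → β) :
    mutualInfo p f g = mutualInfo p g f := by
  unfold mutualInfo
  rw [entropy_congr p (f := fun ω => (f ω, g ω)) (g := fun ω => (g ω, f ω)) (by simp; tauto)]
  ring

lemma law_pair_comp_left [Fintype α] [DecidableEq α'] (p : Ω → ℝ) (f : Ω → α) (k : Ω → β)
    (φ : α → α') (a' : α') (b : β) :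
    law p (fun ω => (φ (f ω), k ω)) (a', b) =
      ∑ a, if φ a = a' then law p (fun ω => (f ω, k ω)) (a, b) else 0 := by
  classical
  have h : ∀ a, (if φ a = a' then law p (fun ω => (f ω, k ω)) (a, b) else 0) =
      ∑ ω, if f ω = a then (if φ a = a' ∧ k ω = b then p ω else 0) else 0 := by
    intro a
    rw [law_apply]
    by_cases ha : φ a = a' <;> simp [ha, ite_and]
  simp only [h]
  rw [law_apply, Finset.sum_comm]
  simp

lemma IsMarkovChain.comp_left [Fintype α] {p : Ω → ℝ} {f : Ω → α} {g : Ω → β} {h : Ω → γ}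
    (H : IsMarkovChain p f g h) (φ : α → α') : IsMarkovChain p (fun ω => φ (f ω)) g h := by
  classical
  intro a b c
  rw [law_pair_comp_left p f (fun ω => (g ω, h ω)) φ, law_pair_comp_left p f g φ, Finset.sum_mul,
    Finset.sum_mul]
  refine Finset.sum_congr rfl fun a' _ => ?_
  split_ifs
  · exact H a' b c
  · ring

/-- Componentwise Markov chains of an i.i.d. source form a Markov chain of sequences. -/
lemma IsMarkovChain.prodMass [Fintype α] [Fintype β] [Fintype γ] {P : Ω → ℝ} {f : Ω → α}
    {g : Ω → β} {h : Ω → γ} (H : IsMarkovChain P f g h) (n : ℕ) :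
    IsMarkovChain (prodMass P n) (fun ω i => f (ω i)) (fun ω i => g (ω i))
      (fun ω i => h (ω i)) := by
  intro a b c
  have h3 := congrFun (law_prodMass P n (fun z => (f z, g z, h z))) (fun i => (a i, b i, c i))
  have h2 := congrFun (law_prodMass P n (fun z => (f z, g z))) (fun i => (a i, b i))
  have h2' := congrFun (law_prodMass P n (fun z => (g z, h z))) (fun i => (b i, c i))
  have h1 := congrFun (law_prodMass P n g) b
  rw [law_congr_of_iff _ (g := fun (ω : Fin n → Ω) =>
    (fun i => f (ω i), fun i => g (ω i), fun i => h (ω i))) (b := (a, b, c))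
    fun ω => by simp only [funext_iff, Prod.mk.injEq, forall_and]] at h3
  rw [law_congr_of_iff _ (g := fun (ω : Fin n → Ω) => (fun i => f (ω i), fun i => g (ω i)))
    (b := (a, b)) fun ω => by simp only [funext_iff, Prod.mk.injEq, forall_and]] at h2
  rw [law_congr_of_iff _ (g := fun (ω : Fin n → Ω) => (fun i => g (ω i), fun i => h (ω i)))
    (b := (b, c)) fun ω => by simp only [funext_iff, Prod.mk.injEq, forall_and]] at h2'
  rw [h3, h2, h2', h1]
  simp only [KeyAgreement.prodMass, ← Finset.prod_mul_distrib]
  exact Finset.prod_congr rfl fun i _ => H (a i) (b i) (c i)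

end Markov

section OneTimePad

variable {Z α : Type*} [Fintype Z] [Fintype α] {s : ℕ} [NeZero s]

lemma uniform_mem_stdSimplex : (fun _ : Fin s => 1 / (s : ℝ)) ∈ stdSimplex ℝ (Fin s) := by
  have : (s : ℝ) ≠ 0 := by exact_mod_cast NeZero.ne s
  refine ⟨fun _ => by positivity, ?_⟩
  simp [this]

lemma entropy_uniform : entropy (fun _ : Fin s => 1 / (s : ℝ)) (fun k => k) = Real.log s := by
  classical
  have : (s : ℝ) ≠ 0 := by exact_mod_cast NeZero.ne s
  rw [entropy_eq_neg_sum]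
  simp [law_apply]
  field_simp

/-- A uniform key added modulo `s` is independent of the source. -/
lemma entropy_pair_add_uniform {P : Z → ℝ} (hP : P ∈ stdSimplex ℝ Z) (f : Z → α) (g : Z → Fin s) :
    entropy (fun ω : Z × Fin s => P ω.1 * (1 / (s : ℝ))) (fun ω => (f ω.1, g ω.1 + ω.2)) =
      entropy P f + Real.log s := by
  classical
  have hU := uniform_mem_stdSimplex (s := s)
  rw [← entropy_uniform (s := s), ← entropy_mul_pair hP hU f (fun k => k)]
  unfold entropy
  refine Finset.sum_congr rfl fun ⟨a, t⟩ _ => congrArg _ ?_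
  rw [law_apply, law_apply, Fintype.sum_prod_type, Fintype.sum_prod_type]
  refine Finset.sum_congr rfl fun z _ => ?_
  exact Equiv.sum_comp (Equiv.addLeft (g z))
    (fun k => if (f z, k) = (a, t) then P z * (1 / (s : ℝ)) else 0)

lemma prob_mul_fst {Z' : Type*} [Fintype Z'] (P : Z → ℝ) {P' : Z' → ℝ} (hP' : ∑ z, P' z = 1)
    (E : Z → Prop) : prob (fun ω : Z × Z' => P ω.1 * P' ω.2) (fun ω => E ω.1) = prob P E := by
  have h := congrFun (law_mul_fst P hP' E) True
  rw [law_eq_prob, law_eq_prob] at h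
  simpa using h

end OneTimePad

section Achievability

variable {𝒳 𝒳t 𝒴 : Type*} [Fintype 𝒳] [Fintype 𝒳t] [Fintype 𝒴]

/-- The bounds that make a code for the generated-secret model good. -/
structure IsGoodCode (P : 𝒳 × 𝒳t × 𝒴 → ℝ) {n s w : ℕ}
    (enc : (Fin n → 𝒳t) → Fin w × Fin s) (dec : Fin w × (Fin n → 𝒴) → Fin s) (ρ δ : ℝ) :
    Prop where
  deficit : Real.log (w * s) - entropy (iid P n) (fun ω => enc (seqXt ω)) ≤ δ
  error : prob (iid P n) (fun ω => (enc (seqXt ω)).2 ≠ dec ((enc (seqXt ω)).1, seqY ω)) ≤ δ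
  leakage : mutualInfo (iid P n) seqX (fun ω => (enc (seqXt ω)).1) ≤ n * δ
  storage : Real.log w ≤ n * (ρ + δ)

lemma exists_isGoodCode {P : 𝒳 × 𝒳t × 𝒴 → ℝ} (hP : P ∈ stdSimplex ℝ (𝒳 × 𝒳t × 𝒴))
    (hM : IsMarkovChain P (fun ω => ω.2.1) (fun ω => ω.2.2) (fun ω => ω.1)) {k : ℕ}
    {V : 𝒳t → Fin k → ℝ} (hV : ∀ x, V x ∈ stdSimplex ℝ (Fin k)) {q : ℚ} (hq0 : 0 < q)
    (hq : q * Real.log 2 < infoUY P V) {δ : ℝ} (hδ : 0 < δ) :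
    ∃ n s w : ℕ, 1 ≤ n ∧ 0 < s ∧ 0 < w ∧ Real.log s = n * (q * Real.log 2) ∧
      ∃ (enc : (Fin n → 𝒳t) → Fin w × Fin s) (dec : Fin w × (Fin n → 𝒴) → Fin s),
        IsGoodCode P enc dec (infoUXt P V - infoUY P V) δ := by
  have hlog2 : 0 < Real.log 2 := Real.log_pos (by norm_num)
  have hq0' : (0 : ℝ) < q := by exact_mod_cast hq0
  have hev := exists_block_code hP (fun z => z.2.1) (fun z => z.2.2) hV (by positivity) hq hδ
  obtain ⟨N₀, hN₀⟩ := Filter.eventually_atTop.1 hev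
  have hden : 1 ≤ q.den := q.den_pos
  have hn : N₀ ≤ q.den * (N₀ + 1) := by nlinarith
  have hlogs : Real.log ((2 ^ (q.num.toNat * (N₀ + 1)) : ℕ) : ℝ) =
      ((q.den * (N₀ + 1) : ℕ) : ℝ) * (q * Real.log 2) := by
    have h1 : (q.den : ℝ) * q = (q.num.toNat : ℝ) := by
      have h2 : ((q.num.toNat : ℤ) : ℝ) = (q.num : ℝ) := by
        rw [Int.toNat_of_nonneg (Rat.num_nonneg.2 hq0.le)]
      rw [Int.cast_natCast] at h2
      rw [h2, mul_comm]
      exact_mod_cast Rat.mul_den_eq_num q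
    push_cast
    rw [Real.log_pow]
    push_cast
    rw [← h1]
    ring
  obtain ⟨w, hw, enc, dec, h1, h2, h3, h4⟩ := hN₀ _ hn _ (by positivity) hlogs
  refine ⟨_, _, w, ?_, by positivity, hw, hlogs, enc, dec, h1, h2, ?_, h4⟩
  · exact Nat.one_le_iff_ne_zero.2 (by positivity)
  · refine le_trans ?_ h3
    rw [mutualInfo_comm, mutualInfo_comm (prodMass P _) _ (fun z => (enc (fun i => (z i).2.1)).1)]
    exact ((hM.prodMass _).comp_left (fun a => (enc a).1)).mutualInfo_le
      (prodMass_mem_stdSimplex hP _)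

lemma IsGoodCode.gsFeasible {P : 𝒳 × 𝒳t × 𝒴 → ℝ} (hP : P ∈ stdSimplex ℝ (𝒳 × 𝒳t × 𝒴))
    {n s w : ℕ} (hn : 1 ≤ n) (hs : 0 < s) (hw : 0 < w)
    {enc : (Fin n → 𝒳t) → Fin w × Fin s} {dec : Fin w × (Fin n → 𝒴) → Fin s} {ρ δ : ℝ}
    (H : IsGoodCode P enc dec ρ δ) (hδ : 0 < δ) {R : ℝ × ℝ × ℝ} (hR₁ : Real.log s = n * R.1)
    (hR₂ : 0 ≤ R.2.1) (hR₃ : ρ ≤ R.2.2) : GSFeasible P enc dec R δ := by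
  have hp := iid_mem_stdSimplex hP n
  have hn1 : (1 : ℝ) ≤ n := by exact_mod_cast hn
  have hn0 : (0 : ℝ) < n := by linarith
  have hs' : (0 : ℝ) < s := by exact_mod_cast hs
  have hw' : (0 : ℝ) < w := by exact_mod_cast hw
  have : Nonempty (Fin s) := ⟨⟨0, hs⟩⟩
  have : Nonempty (Fin w) := ⟨⟨0, hw⟩⟩
  have hS := entropy_le_log_card hp (fun ω => (enc (seqXt ω)).2)
  have hW := entropy_le_log_card hp (fun ω => (enc (seqXt ω)).1)
  have hSW := mutualInfo_nonneg hp (fun ω => (enc (seqXt ω)).2) (fun ω => (enc (seqXt ω)).1)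
  have hpair : entropy (iid P n) (fun ω => ((enc (seqXt ω)).2, (enc (seqXt ω)).1)) =
      entropy (iid P n) (fun ω => enc (seqXt ω)) :=
    entropy_congr _ (by simp [Prod.ext_iff]; tauto)
  have hdef := H.deficit
  rw [Real.log_mul hw'.ne' hs'.ne'] at hdef
  rw [Fintype.card_fin] at hS hW
  unfold mutualInfo at hSW
  refine ⟨?_, H.error, ?_, ?_, ?_, ?_⟩
  · rw [hR₁]; field_simp
  · unfold mutualInfo
    linarith
  · rw [one_div, ← div_eq_inv_mul, div_le_iff₀ hn0]
    have := H.leakage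
    nlinarith
  · rw [ge_iff_le, one_div, ← div_eq_inv_mul, le_div_iff₀ hn0]
    nlinarith
  · rw [one_div, ← div_eq_inv_mul, div_le_iff₀ hn0]
    have := H.storage
    nlinarith

/-- Adding the generated key to the chosen key as a one-time pad. -/
lemma IsGoodCode.exists_csFeasible {P : 𝒳 × 𝒳t × 𝒴 → ℝ} (hP : P ∈ stdSimplex ℝ (𝒳 × 𝒳t × 𝒴))
    {n s w : ℕ} (hn : 1 ≤ n) (hs : 0 < s) (hw : 0 < w)
    {enc : (Fin n → 𝒳t) → Fin w × Fin s} {dec : Fin w × (Fin n → 𝒴) → Fin s} {ρ δ : ℝ}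
    (H : IsGoodCode P enc dec ρ δ) (hδ : 0 < δ) {R : ℝ × ℝ × ℝ} (hR₁ : Real.log s = n * R.1)
    (hR₂ : 0 ≤ R.2.1) (hR₃ : ρ + R.1 ≤ R.2.2) :
    ∃ (enc' : (Fin n → 𝒳t) × Fin s → Fin (w * s)) (dec' : Fin (w * s) × (Fin n → 𝒴) → Fin s),
      CSFeasible P (fun _ => 1 / (s : ℝ)) enc' dec' R δ := by
  have : NeZero s := ⟨hs.ne'⟩
  have hiid := iid_mem_stdSimplex hP n
  have hU := uniform_mem_stdSimplex (s := s)
  have hp := mul_mem_stdSimplex hiid hU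
  have hn1 : (1 : ℝ) ≤ n := by exact_mod_cast hn
  have hn0 : (0 : ℝ) < n := by linarith
  have hs' : (0 : ℝ) < s := by exact_mod_cast hs
  have hw' : (0 : ℝ) < w := by exact_mod_cast hw
  set p : (Fin n → 𝒳 × 𝒳t × 𝒴) × Fin s → ℝ := fun ω => iid P n ω.1 * (1 / (s : ℝ)) with hpdef
  set e : Fin w × Fin s ≃ Fin (w * s) := finProdFinEquiv with he
  have : Nonempty (Fin (w * s)) := ⟨e (⟨0, hw⟩, ⟨0, hs⟩)⟩
  let enc' : (Fin n → 𝒳t) × Fin s → Fin (w * s) := fun v =>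
    e ((enc v.1).1, (enc v.1).2 + v.2)
  let dec' : Fin (w * s) × (Fin n → 𝒴) → Fin s := fun v =>
    (e.symm v.1).2 - dec ((e.symm v.1).1, v.2)
  have hK : entropy p (fun ω => ω.2) = Real.log s := by
    rw [← entropy_uniform (s := s)]
    unfold entropy
    rw [law_mul_snd hiid.2 (fun _ : Fin s => 1 / (s : ℝ)) (fun k => k)]
  have hX : entropy p (fun ω => seqX ω.1) = entropy (iid P n) seqX := by
    unfold entropy
    rw [law_mul_fst (iid P n) hU.2 seqX]
  have hW' : entropy p (fun ω => enc' (seqXt ω.1, ω.2)) =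
      entropy (iid P n) (fun ω => (enc (seqXt ω)).1) + Real.log s := by
    rw [← entropy_pair_add_uniform hiid (fun ω => (enc (seqXt ω)).1)
      (fun ω => (enc (seqXt ω)).2)]
    exact entropy_congr _ (by simp [enc'])
  have hXW' : entropy p (fun ω => (seqX ω.1, enc' (seqXt ω.1, ω.2))) =
      entropy (iid P n) (fun ω => (seqX ω, (enc (seqXt ω)).1)) + Real.log s := by
    rw [← entropy_pair_add_uniform hiid (fun ω => (seqX ω, (enc (seqXt ω)).1))
      (fun ω => (enc (seqXt ω)).2)]
    exact entropy_congr _ (by simp [enc']; tauto)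
  have hKW' : entropy p (fun ω => (ω.2, enc' (seqXt ω.1, ω.2))) =
      entropy (iid P n) (fun ω => enc (seqXt ω)) + Real.log s := by
    rw [← entropy_uniform (s := s),
      ← entropy_mul_pair hiid hU (fun ω => enc (seqXt ω)) (fun k => k)]
    refine entropy_congr _ fun ω ω' => ?_
    simp only [enc', EmbeddingLike.apply_eq_iff_eq, Prod.ext_iff]
    constructor
    · rintro ⟨h1, h2, h3⟩
      rw [h1] at h3
      exact ⟨⟨h2, add_right_cancel h3⟩, h1⟩
    · rintro ⟨⟨h1, h2⟩, h3⟩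
      exact ⟨h3, h1, by rw [h2, h3]⟩
  have hlogcard := entropy_le_log_card hp (fun ω => enc' (seqXt ω.1, ω.2))
  rw [Fintype.card_fin, Nat.cast_mul] at hlogcard
  refine ⟨enc', dec', ?_, ?_, ?_, ?_, ?_, ?_⟩
  · rw [hR₁]; field_simp
  · refine le_trans (prob_mono hp.1 (F := fun ω => (enc (seqXt ω.1)).2 ≠
      dec ((enc (seqXt ω.1)).1, seqY ω.1)) fun ω hω h => hω ?_) ?_
    · simp only [enc', dec', Equiv.symm_apply_apply]
      rw [← h]
      abel
    · rw [hpdef, prob_mul_fst (iid P n) hU.2 (fun ω => (enc (seqXt ω)).2 ≠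
        dec ((enc (seqXt ω)).1, seqY ω))]
      exact H.error
  · have := H.deficit
    unfold mutualInfo
    rw [← hpdef, hK, hKW']
    linarith
  · rw [one_div, ← div_eq_inv_mul, div_le_iff₀ hn0]
    have := H.leakage
    unfold mutualInfo at this ⊢
    rw [← hpdef, hX, hW', hXW']
    nlinarith
  · rw [ge_iff_le, one_div, ← div_eq_inv_mul, le_div_iff₀ hn0, ← hpdef, hK, hR₁]
    nlinarith
  · rw [one_div, ← div_eq_inv_mul, div_le_iff₀ hn0, Nat.cast_mul, Real.log_mul hw'.ne' hs'.ne', hR₁]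
    have := H.storage
    nlinarith

/-- The code without key and helper data. -/
lemma meetsConstraints_trivial {Ω : Type*} [Fintype Ω] {p : Ω → ℝ} (hp : p ∈ stdSimplex ℝ Ω)
    {n : ℕ} (S S' W : Ω → Fin 1) (Xn : Ω → (Fin n → 𝒳)) {R : ℝ × ℝ × ℝ} (hR₁ : R.1 = 0)
    (hR₂ : 0 ≤ R.2.1) (hR₃ : 0 ≤ R.2.2) {δ : ℝ} (hδ : 0 < δ) :
    MeetsConstraints p S S' W Xn R δ := by
  have h0 : ∀ T : Ω → Fin 1, entropy p T = 0 := fun T => by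
    rw [entropy_congr p (g := fun _ => ()) fun ω ω' => by simp [Subsingleton.elim (T ω) (T ω')],
      entropy_const hp]
  have hS := h0 S
  have hW := h0 W
  have hSW : entropy p (fun ω => (S ω, W ω)) = 0 := by
    rw [entropy_congr p (g := W) fun ω ω' => by simp [Subsingleton.elim (S ω) (S ω')], hW]
  have hXW : entropy p (fun ω => (Xn ω, W ω)) = entropy p Xn :=
    entropy_congr p fun ω ω' => by simp [Subsingleton.elim (W ω) (W ω')]
  refine ⟨?_, ?_, ?_, ?_, ?_, ?_⟩
  · simp [hR₁]
  · rw [prob_congr p (F := fun _ => False) fun ω => by simp [Subsingleton.elim (S ω) (S' ω)]]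
    simpa [prob] using hδ.le
  · simpa [mutualInfo, hS, hW, hSW] using hδ.le
  · simp only [mutualInfo, hW, hXW, add_zero, sub_self, mul_zero]
    linarith
  · simp only [hS, hR₁]
    linarith
  · simp only [Nat.cast_one, Real.log_one, mul_zero]
    linarith

/-- Key rates that are rational multiples of `log 2` are dense. -/
lemma mem_closure_of_forall_rat {A : Set (ℝ × ℝ × ℝ)} {R : ℝ × ℝ × ℝ} (hR : 0 < R.1)
    (h : ∀ q : ℚ, 0 < q → q * Real.log 2 < R.1 → ((q * Real.log 2, R.2) : ℝ × ℝ × ℝ) ∈ A) :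
    R ∈ closure A := by
  have hlog2 : 0 < Real.log 2 := Real.log_pos (by norm_num)
  rw [Metric.mem_closure_iff]
  intro ε hε
  obtain ⟨q, hq1, hq2⟩ := exists_rat_btwn (show max 0 (R.1 - ε) / Real.log 2 < R.1 / Real.log 2 from
    div_lt_div_of_pos_right (max_lt hR (by linarith)) hlog2)
  rw [div_lt_iff₀ hlog2] at hq1
  rw [lt_div_iff₀ hlog2] at hq2
  have hq0 : (0 : ℝ) < q := by
    have := (le_max_left 0 (R.1 - ε)).trans_lt hq1
    exact pos_of_mul_pos_left this hlog2.le
  refine ⟨_, h q (by exact_mod_cast hq0) hq2, ?_⟩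
  have h1 := (le_max_right 0 (R.1 - ε)).trans_lt hq1
  rw [Prod.dist_eq, dist_self, max_eq_left dist_nonneg, Real.dist_eq, abs_lt]
  constructor <;> linarith

lemma infoUY_le_infoUXt {P : 𝒳 × 𝒳t × 𝒴 → ℝ} (hP : P ∈ stdSimplex ℝ (𝒳 × 𝒳t × 𝒴)) {k : ℕ}
    {V : 𝒳t → Fin k → ℝ} (hV : ∀ x, V x ∈ stdSimplex ℝ (Fin k)) : infoUY P V ≤ infoUXt P V := by
  rw [infoUY_eq, infoUXt_eq]
  exact kernelInfo_le_kernelInfo_self hP (fun z => z.2.1) (fun z => z.2.2) hV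

/-- Achievability for the generated-secret model. -/
lemma testRegion_one_subset_gsRegion {P : 𝒳 × 𝒳t × 𝒴 → ℝ}
    (hP : P ∈ stdSimplex ℝ (𝒳 × 𝒳t × 𝒴))
    (hM : IsMarkovChain P (fun ω => ω.2.1) (fun ω => ω.2.2) (fun ω => ω.1)) (k : ℕ) :
    testRegion P 1 k ⊆ gsRegion P := by
  rintro R ⟨V, hV, h0, h1, h2, h3⟩
  rw [one_mul] at h3
  rcases h0.eq_or_lt with hR | hR
  · refine subset_closure fun δ hδ => ⟨1, 1, 1, le_rfl, fun _ => (0, 0), fun _ => 0, ?_⟩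
    exact meetsConstraints_trivial (iid_mem_stdSimplex hP 1) _ _ _ _ hR.symm h2
      (by linarith [infoUY_le_infoUXt hP hV]) hδ
  · refine mem_closure_of_forall_rat hR fun q hq0 hq δ hδ => ?_
    obtain ⟨n, s, w, hn, hs, hw, hlog, enc, dec, H⟩ :=
      exists_isGoodCode hP hM hV hq0 (hq.trans_le h1) hδ
    exact ⟨n, s, w, hn, enc, dec, H.gsFeasible hP hn hs hw hδ hlog h2 h3⟩

/-- Achievability for the chosen-secret model with a uniform key. -/
lemma testRegion_zero_subset_csUniformRegion {P : 𝒳 × 𝒳t × 𝒴 → ℝ}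
    (hP : P ∈ stdSimplex ℝ (𝒳 × 𝒳t × 𝒴))
    (hM : IsMarkovChain P (fun ω => ω.2.1) (fun ω => ω.2.2) (fun ω => ω.1)) (k : ℕ) :
    testRegion P 0 k ⊆ csUniformRegion P := by
  rintro R ⟨V, hV, h0, h1, h2, h3⟩
  rw [zero_mul, sub_zero] at h3
  rcases h0.eq_or_lt with hR | hR
  · refine subset_closure fun δ hδ => ⟨1, 1, 1, le_rfl, le_rfl, fun _ => 0, fun _ => 0, ?_⟩
    exact meetsConstraints_trivial
      (mul_mem_stdSimplex (iid_mem_stdSimplex hP 1) (uniform_mem_stdSimplex (s := 1))) _ _ _ _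
      hR.symm h2 (by linarith [infoUY_le_infoUXt hP hV]) hδ
  · refine mem_closure_of_forall_rat hR fun q hq0 hq δ hδ => ?_
    obtain ⟨n, s, w, hn, hs, hw, hlog, enc, dec, H⟩ :=
      exists_isGoodCode hP hM hV hq0 (hq.trans_le h1) hδ
    obtain ⟨enc', dec', H'⟩ := H.exists_csFeasible hP hn hs hw hδ
      (R := (q * Real.log 2, R.2)) hlog h2 (by dsimp only; linarith)
    exact ⟨n, s, w * s, hn, hs, enc', dec', H'⟩

lemma CSUniformAchievable.csAchievable {P : 𝒳 × 𝒳t × 𝒴 → ℝ} {R : ℝ × ℝ × ℝ}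
    (H : CSUniformAchievable P R) : CSAchievable P R := by
  intro δ hδ
  obtain ⟨n, s, w, hn, hs, enc, dec, h⟩ := H δ hδ
  have : NeZero s := ⟨by omega⟩
  exact ⟨n, s, w, hn, _, uniform_mem_stdSimplex, enc, dec, h⟩

lemma iUnion_testRegion (P : 𝒳 × 𝒳t × 𝒴 → ℝ) (c : ℝ) :
    ⋃ k, testRegion P c k = testRegion P c (Fintype.card 𝒳t + 1) :=
  Set.Subset.antisymm (Set.iUnion_subset fun k => testRegion_subset P c k)
    (Set.subset_iUnion (testRegion P c) _)

end Achievability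

end KeyAgreement

theorem theorem2 {𝒳 𝒳t 𝒴 : Type*} [Fintype 𝒳] [Fintype 𝒳t] [Fintype 𝒴]
    (P : 𝒳 × 𝒳t × 𝒴 → ℝ) (hP : P ∈ stdSimplex ℝ (𝒳 × 𝒳t × 𝒴))
    (hMarkov : KeyAgreement.IsMarkovChain P
      (fun ω => ω.2.1) (fun ω => ω.2.2) (fun ω => ω.1)) :
    KeyAgreement.gsRegion P = KeyAgreement.regionR2 P ∧
    KeyAgreement.csRegion P = KeyAgreement.regionR4 P ∧
    KeyAgreement.csUniformRegion P = KeyAgreement.regionR4 P ∧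
    KeyAgreement.regionR2 P =
      KeyAgreement.regionR2Card P (Fintype.card 𝒳t + 1) ∧
    KeyAgreement.regionR4 P =
      KeyAgreement.regionR4Card P (Fintype.card 𝒳t + 1) := by
  open KeyAgreement in
  have h2 : regionR2 P = testRegion P 1 (Fintype.card 𝒳t + 1) := by
    simp only [regionR2, regionR2Card_eq_testRegion hP hMarkov, iUnion_testRegion]
  have h4 : regionR4 P = testRegion P 0 (Fintype.card 𝒳t + 1) := by
    simp only [regionR4, regionR4Card_eq_testRegion hP hMarkov, iUnion_testRegion]
  have hgs : gsRegion P ⊆ testRegion P 1 (Fintype.card 𝒳t + 1) :=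
    closure_minimal (fun R hR => GSAchievable.mem_testRegion hP hR) (isClosed_testRegion P 1 _)
  have hcs : csRegion P ⊆ testRegion P 0 (Fintype.card 𝒳t + 1) :=
    closure_minimal (fun R hR => CSAchievable.mem_testRegion hP hR) (isClosed_testRegion P 0 _)
  have hcsu : csUniformRegion P ⊆ csRegion P :=
    closure_mono fun R hR => CSUniformAchievable.csAchievable hR
  have hach := testRegion_zero_subset_csUniformRegion hP hMarkov (Fintype.card 𝒳t + 1)
  rw [h2, h4, regionR2Card_eq_testRegion hP hMarkov, regionR4Card_eq_testRegion hP hMarkov]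
  exact ⟨hgs.antisymm (testRegion_one_subset_gsRegion hP hMarkov _), hcs.antisymm (hach.trans hcsu),
    (hcsu.trans hcs).antisymm hach, rfl, rfl⟩
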